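/- **Notation.** Let $\Sigma_2=\{0,1\}^{\mathbb N}$ be the space of one-sided binary sequences with the shift $\sigma$, the lexicographic order $\prec$ and $\pi(x)=\sum_{i\ge1}x_i2^{-i}$. For $\alpha,\beta\in\Sigma_2$ put $\Sigma_{(\alpha,\beta)}=\{x:\beta\preccurlyeq\sigma^n(x)\preccurlyeq\alpha\ \forall n\ge0\}$. The lexicographic world $\mathcal{LW}$ is the set of pairs $(\alpha,\beta)$ such that $\alpha$ starts with $1$, $\beta$ starts with $0$, and $\beta\preccurlyeq\sigma^n(\alpha)\preccurlyeq\alpha$, $\beta\preccurlyeq\sigma^n(\beta)\preccurlyeq\alpha$ for all $n$. A subshift is of finite type if it is the set of sequences avoiding finitely many words. The entropy of a shift-invariant set $A$ is $h(A)=\lim_n\frac1n\log_2|B_n(A)|$, where $B_n(A)$ is the set of words of length $n$ occurring in elements of $A$; $\{\omega,\nu\}^\infty$ is the set of all infinite concatenations of the words $\omega,\nu$ together with their shifts. For the doubling map $f$ of $\mathbb R/\mathbb Z$ let $X_{(a,b)}=\{x:f^n(x)\notin(a,b)\ \forall n\ge0\}$, let $D_1$ be the set of $(a,b)\in(\frac14,\frac12)\times(\frac12,\frac34)$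 with $\dim_HX_{(a,b)}>0$, and let $D_2$ be the set of $(a,b)\in D_1$ for which only finitely many $n\ge3$ are bad, i.e. are such that every cycle of length $n$ of $f$ meets $(a,b)$. For a word $w$ let $0\text{-}\max_w$ (resp. $1\text{-}\min_w$) be its largest cyclic permutation starting with $0$ (resp. smallest starting with $1$). A pair $(\alpha,\beta)\in\mathcal{LW}$ is renormalisable if there are words $\omega=0\text{-}\max_\omega$, $\nu=1\text{-}\min_\nu$ with $\ell(\omega\nu)\ge3$, $(0\text{-}\max_\nu)^\infty\prec\omega^\infty$, $\nu^\infty\prec(1\text{-}\min_\omega)^\infty$ (both words $0\text{-}\max_\nu$ and $1\text{-}\min_\omega$ being required to exist), $0\alpha=\omega\nu^{n_1}\omega^{n_2}\nu^{n_3}\cdots$ and $1\beta=\nu\omega^{m_1}\nu^{m_2}\omega^{m_3}\cdots$ with exponents in $\{1,2,\dots\}\cup\{\infty\}$. An essential pair is a non-renormalisable pair $(\alpha',\beta')\in\mathcal{LW}$ with both sequences periodic; its associated pair $(\omega,\nu)$ consists of the shortest words with $0\alpha'=\omega^\infty$, $1\beta'=\nu^\infty$. The renormalisation box $\mathcal B^0(\omega,\nu)$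 is the set of $(\alpha,\beta)\in\mathcal{LW}$ with $\omega^\infty\preccurlyeq0\alpha\preccurlyeq\omega\nu^\infty$ and $\nu\omega^\infty\preccurlyeq1\beta\preccurlyeq\nu^\infty$. A transitive component of $\Sigma_{(\alpha,\beta)}$ is a nonempty closed set $A\subseteq\Sigma_{(\alpha,\beta)}$ with $\sigma(A)=A$ and $\sigma|_A$ topologically transitive (any two words $u,v$ of its language admit a word $b$ of its language such that $ubv$ is in its language), maximal among such sets. **Theorem.** Let $(\alpha,\beta)\in\mathcal{LW}$ be such that $\Sigma_{(\alpha,\beta)}$ is a subshift of finite type and $(\pi(0\alpha),\pi(1\beta))\in D_2$. Then $(\alpha,\beta)\in\mathcal B^0(\omega,\nu)$ for the associated pair $(\omega,\nu)$ of some essential pair. Moreover, for every such $(\omega,\nu)$, the set $A=\Sigma_{(\sigma(\omega^\infty),\sigma(\nu^\infty))}$ is a transitive component of $\Sigma_{(\alpha,\beta)}$, it satisfies $\sigma^{-1}(A)\cap\Sigma_{(\alpha,\beta)}=A$ and $h(A)=h(\Sigma_{(\alpha,\beta)})$, it is the only transitive component of entropy $h(\Sigma_{(\alpha,\beta)})$,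 and every other transitive component $B$ of $\Sigma_{(\alpha,\beta)}$ satisfies $$h(B)<h(\{\omega,\nu\}^\infty)\le h(A);$$ the second inequality always holds, and at least one other transitive component exists unless $(\alpha,\beta)=(\sigma(\omega^\infty),\sigma(\nu^\infty))$. -/

import Mathlib

open Filter Topology Set

namespace LexShift

/-- One-sided binary sequences `x₁ x₂ x₃ …`, indexed from `0` (`false` is the digit `0`, `true` is
the digit `1`), with the product topology.  Words are lists of digits.  Sequences are compared
lexicographically through Mathlib's order on `Lex (ℕ → Bool)`, words through the order on lists. -/
abbrev BinSeq := ℕ → Bool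

/-- The one-sided full shift. -/
def shift (x : BinSeq) : BinSeq := fun n => x (n + 1)

/-- The mirror image of a sequence. -/
def mirror (x : BinSeq) : BinSeq := fun n => !(x n)

/-- The concatenation `w x` of a finite word and a sequence. -/
def prepend (w : List Bool) (x : BinSeq) : BinSeq :=
  fun n => if n < w.length then w.getD n false else x (n - w.length)

/-- The sequence `w^∞` (meaningful for a nonempty word `w`). -/
def periodicSeq (w : List Bool) : BinSeq := fun n => w.getD (n % w.length) false

/-- The word `w` occurs in `x` at position `k`. -/
def OccursAt (w : List Bool) (x : BinSeq) (k : ℕ) : Prop :=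
  ∀ (i : ℕ) (h : i < w.length), x (k + i) = w[i]

/-- The word `w` is a factor of `x`. -/
def IsFactor (w : List Bool) (x : BinSeq) : Prop := ∃ k, OccursAt w x k

/-- The set of sequences which avoid every word of `F`. -/
def avoiding (F : Set (List Bool)) : Set BinSeq := {x | ∀ w ∈ F, ¬ IsFactor w x}

/-- Subshifts of finite type: finitely many forbidden words. -/
def IsSFT (A : Set BinSeq) : Prop := ∃ F : Set (List Bool), F.Finite ∧ A = avoiding F

/-- The words that occur in elements of `A`. -/
def language (A : Set BinSeq) : Set (List Bool) := {w | ∃ x ∈ A, IsFactor w x}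

/-- The words of length `n` in the language of `A`. -/
def words (A : Set BinSeq) (n : ℕ) : Set (List Bool) := {w | w ∈ language A ∧ w.length = n}

/-- The topological entropy `lim (1/n) log₂ |B_n(A)|`.  It is written as a limit superior;
`tendsto_entropy` below shows that it is the limit for every nonempty `A`. -/
noncomputable def entropy (A : Set BinSeq) : ℝ :=
  limsup (fun n : ℕ => Real.logb 2 ((words A n).ncard : ℝ) / n) atTop

/-- The lexicographic subshift `Σ_(α,β)`. -/
def lexShift (α β : BinSeq) : Set BinSeq :=
  {x | ∀ n : ℕ, toLex β ≤ toLex (shift^[n] x) ∧ toLex (shift^[n] x) ≤ toLex α}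

/-- Parry sequences. -/
def IsParry (α : BinSeq) : Prop :=
  α 0 = true ∧ ∀ n : ℕ, toLex (shift^[n] α) ≤ toLex α

/-- Membership of `(α, β)` in the lexicographic world. -/
def LexWorld (α β : BinSeq) : Prop :=
  IsParry α ∧ IsParry (mirror β) ∧
    ∀ n : ℕ, toLex β ≤ toLex (shift^[n] α) ∧ toLex (shift^[n] β) ≤ toLex α

/-- `u` is the lexicographically largest cyclic permutation of `w` starting with `0`. -/
def IsZeroMax (u w : List Bool) : Prop :=
  u ~r w ∧ u.head? = some false ∧ ∀ v : List Bool, v ~r w → v.head? = some false → v ≤ u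

/-- `u` is the lexicographically smallest cyclic permutation of `w` starting with `1`. -/
def IsOneMin (u w : List Bool) : Prop :=
  u ~r w ∧ u.head? = some true ∧ ∀ v : List Bool, v ~r w → v.head? = some true → u ≤ v

/-- The word obtained from the first `n` digits of `s` by substituting `0 ↦ ω` and `1 ↦ ν`. -/
def substWord (ω ν : List Bool) (s : BinSeq) (n : ℕ) : List Bool :=
  (List.range n).flatMap fun i => if s i then ν else ω

/-- `x` is the infinite concatenation of the words `ω` and `ν` in the order prescribed by `s`. -/
def IsConcat (ω ν : List Bool) (s x : BinSeq) : Prop :=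
  ∀ n : ℕ, OccursAt (substWord ω ν s n) x 0

/-- The renewal system `{ω,ν}^∞`: free concatenations of `ω` and `ν`, together with their shifts. -/
def renewal (ω ν : List Bool) : Set BinSeq :=
  {x | ∃ (s y : BinSeq) (k : ℕ), IsConcat ω ν s y ∧ x = shift^[k] y}

/-- `(α, β)` is renormalisable by `ω` and `ν`.  The last two conditions say
`0α = ω ν^{n₁} ω^{n₂} ν^{n₃} …` and `1β = ν ω^{m₁} ν^{m₂} ω^{m₃} …` with exponents in
`{1, 2, …} ∪ {∞}`. -/
def RenormalisableBy (ω ν : List Bool) (α β : BinSeq) : Prop :=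
  IsZeroMax ω ω ∧ IsOneMin ν ν ∧
  (∃ u, IsZeroMax u ν ∧ toLex (periodicSeq u) < toLex (periodicSeq ω)) ∧
  (∃ u, IsOneMin u ω ∧ toLex (periodicSeq ν) < toLex (periodicSeq u)) ∧
  3 ≤ (ω ++ ν).length ∧
  (∃ s : BinSeq, s 0 = false ∧ s 1 = true ∧ IsConcat ω ν s (prepend [false] α)) ∧
  (∃ t : BinSeq, t 0 = true ∧ t 1 = false ∧ IsConcat ω ν t (prepend [true] β))

/-- Renormalisable pairs of the lexicographic world. -/
def Renormalisable (α β : BinSeq) : Prop :=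
  LexWorld α β ∧ ∃ ω ν : List Bool, RenormalisableBy ω ν α β

/-- Periodic sequences. -/
def IsPeriodicSeq (x : BinSeq) : Prop := ∃ p : ℕ, 0 < p ∧ shift^[p] x = x

/-- Essential pairs. -/
def IsEssentialPair (α β : BinSeq) : Prop :=
  LexWorld α β ∧ ¬ Renormalisable α β ∧ IsPeriodicSeq α ∧ IsPeriodicSeq β

/-- `w` is the shortest word with `w^∞ = x`. -/
def IsShortestPeriod (w : List Bool) (x : BinSeq) : Prop :=
  w ≠ [] ∧ periodicSeq w = x ∧ ∀ v : List Bool, v ≠ [] → periodicSeq v = x → w.length ≤ v.length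

/-- `(ω, ν)` is the associated pair of some essential pair `(α', β')`, that is, `0α' = ω^∞` and
`1β' = ν^∞` with `ω` and `ν` as short as possible. -/
def IsEssentialWordPair (ω ν : List Bool) : Prop :=
  ∃ α' β' : BinSeq, IsEssentialPair α' β' ∧
    IsShortestPeriod ω (prepend [false] α') ∧ IsShortestPeriod ν (prepend [true] β')

/-- The renormalisation box `B⁰(ω,ν)`. -/
def renormBox (ω ν : List Bool) : Set (BinSeq × BinSeq) :=
  {p | LexWorld p.1 p.2 ∧
    toLex (prepend [false] p.1) ∈
      Icc (toLex (periodicSeq ω)) (toLex (prepend ω (periodicSeq ν))) ∧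
    toLex (prepend [true] p.2) ∈
      Icc (toLex (prepend ν (periodicSeq ω))) (toLex (periodicSeq ν))}

/-- The pair `(σ(ω^∞), σ(ν^∞))`. -/
def cornerPair (ω ν : List Bool) : BinSeq × BinSeq :=
  (shift (periodicSeq ω), shift (periodicSeq ν))

/-- The essential component `Σ_(σ(ω^∞), σ(ν^∞))`. -/
def essentialComponent (ω ν : List Bool) : Set BinSeq :=
  lexShift (cornerPair ω ν).1 (cornerPair ω ν).2

/-- Topological transitivity: any two words of the language are joined by a bridge. -/
def IsTransitive (A : Set BinSeq) : Prop :=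
  ∀ u ∈ language A, ∀ v ∈ language A, ∃ b ∈ language A, u ++ b ++ v ∈ language A

/-- Nonempty, closed sets `A ⊆ S` with `σ(A) = A` on which the shift is transitive. -/
def IsTransitiveSubsystem (S A : Set BinSeq) : Prop :=
  A ⊆ S ∧ A.Nonempty ∧ IsClosed A ∧ shift '' A = A ∧ IsTransitive A

/-- Transitive components of `S`: the maximal transitive subsystems. -/
def IsTransitiveComponent (S A : Set BinSeq) : Prop :=
  IsTransitiveSubsystem S A ∧ ∀ A' : Set BinSeq, IsTransitiveSubsystem S A' → A ⊆ A' → A' = A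

/-- The projection `π(x) = ∑ xᵢ 2⁻ⁱ`. -/
noncomputable def proj (x : BinSeq) : ℝ := ∑' i : ℕ, (if x i then (1 : ℝ) else 0) / 2 ^ (i + 1)

/-- The doubling map on the circle `ℝ/ℤ`. -/
noncomputable def doubling (x : UnitAddCircle) : UnitAddCircle := 2 • x

/-- The hole `(a,b)` in the circle. -/
def hole (a b : ℝ) : Set UnitAddCircle := (fun t : ℝ => (t : UnitAddCircle)) '' Ioo a b

/-- The exceptional set of the hole `(a,b)`. -/
def exceptionalSet (a b : ℝ) : Set UnitAddCircle :=
  {x | ∀ n : ℕ, doubling^[n] x ∉ hole a b}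

/-- The parameters of centred holes whose exceptional set has positive Hausdorff dimension. -/
def D₁ : Set (ℝ × ℝ) :=
  {p | p.1 ∈ Ioo (1 / 4 : ℝ) (1 / 2) ∧ p.2 ∈ Ioo (1 / 2 : ℝ) (3 / 4) ∧
    0 < dimH (exceptionalSet p.1 p.2)}

/-- The `n ≥ 3` for which every cycle of length `n` of the doubling map meets the hole. -/
def bad (a b : ℝ) : Set ℕ :=
  {n | 3 ≤ n ∧ ∀ x : UnitAddCircle, Function.minimalPeriod doubling x = n →
    ∃ k : ℕ, doubling^[k] x ∈ hole a b}

/-- The parameters in `D₁` with only finitely many bad cycle lengths. -/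
def D₂ : Set (ℝ × ℝ) := {p | p ∈ D₁ ∧ (bad p.1 p.2).Finite}

theorem words_finite (A : Set BinSeq) (n : ℕ) : (words A n).Finite :=
  (List.finite_length_eq Bool n).subset fun _ hw => hw.2

theorem words_nonempty {A : Set BinSeq} (hA : A.Nonempty) (n : ℕ) : (words A n).Nonempty := by
  obtain ⟨x, hx⟩ := hA
  refine ⟨(List.range n).map x, ⟨x, hx, 0, ?_⟩, by simp⟩
  intro i h
  simp

theorem words_add (A : Set BinSeq) (m n : ℕ) :
    (words A (m + n)).ncard ≤ (words A m).ncard * (words A n).ncard := by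
  rw [← Set.ncard_prod]
  refine Set.ncard_le_ncard_of_injOn (fun w => (w.take m, w.drop m)) ?_ ?_
    ((words_finite A m).prod (words_finite A n))
  · rintro w ⟨⟨x, hx, k, hk⟩, hl⟩
    refine ⟨⟨⟨x, hx, k, ?_⟩, by simp [hl]⟩, ⟨⟨x, hx, k + m, ?_⟩, by simp [hl]⟩⟩
    · intro i h
      have h' : i < w.length := by
        simp only [List.length_take] at h
        omega
      simpa using hk i h'
    · intro i h
      have h' : m + i < w.length := by
        simp only [List.length_drop] at h
        omega
      simpa [add_assoc] using hk (m + i) h'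
  · intro w _ w' _ h
    simp only [Prod.mk.injEq] at h
    rw [← List.take_append_drop m w, h.1, h.2, List.take_append_drop]

/-- For nonempty `A` the limit that defines the entropy exists. -/
theorem tendsto_entropy {A : Set BinSeq} (hA : A.Nonempty) :
    Tendsto (fun n : ℕ => Real.logb 2 ((words A n).ncard : ℝ) / n) atTop (𝓝 (entropy A)) := by
  have hpos : ∀ n, 1 ≤ (words A n).ncard := fun n =>
    (Set.ncard_pos (words_finite A n)).2 (words_nonempty hA n)
  have hpos' : ∀ n, (0 : ℝ) < (words A n).ncard := fun n => by exact_mod_cast hpos n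
  have hsub : Subadditive fun n : ℕ => Real.logb 2 ((words A n).ncard : ℝ) := by
    intro m n
    rw [← Real.logb_mul (hpos' m).ne' (hpos' n).ne']
    refine Real.logb_le_logb_of_le one_lt_two (hpos' _) ?_
    exact_mod_cast words_add A m n
  have hbdd : BddBelow (range fun n : ℕ => Real.logb 2 ((words A n).ncard : ℝ) / n) := by
    refine ⟨0, ?_⟩
    rintro _ ⟨n, rfl⟩
    refine div_nonneg (Real.logb_nonneg one_lt_two ?_) (Nat.cast_nonneg n)
    exact_mod_cast hpos n
  have h := hsub.tendsto_lim hbdd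
  have he : entropy A = hsub.lim := h.limsup_eq
  rw [he]
  exact h

end LexShift

open LexShift

/-!
All the dynamics of `Σ_(α,β)` beyond the corner `(σ(ω^∞), σ(ν^∞))` of the renormalisation box
consists of concatenations of `ω` and `ν`, and these are outweighed by the essential component
`A = Σ_(σ(ω^∞), σ(ν^∞))`, which is transitive because the corner is not renormalisable.

*Translation of the hypotheses.* In a subshift of finite type points can be glued along a long common
word, which forces `α` and `β` to be periodic (`Glues.exists_period`); two periodic bounds conversely
allow gluing. Membership in `D₂` provides cycles of lengths `n` and `n + 1`, whose frequencies of
ones differ. Hence `Σ_(α,β)` is `Unbalanced`: the numbers of ones in the prefixes of two points have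
an unbounded difference (`unbalanced_of_mem_D₂`). This is all that is used of `D₂`.

*The box.* If `(α, β)` is renormalisable, a renormalisation of smallest total length has a corner
that is not renormalisable, because a renormalisation of the corner would also renormalise `(α, β)`,
by shorter words (`RenormalisableBy.of_corner`). So `(α, β)` lies in the box of an essential pair
(`exists_isEssentialWordPair`).

*Transitivity.* Let the pair be unbalanced with periodic bounds, and let `w` be a word from which
some point is not reached. The set of points that are eventually reached from `w` is completely
invariant; its order component around the gap between `0α` and `1β` is a `ReturnInterval`: each half
is mapped into the interval by an iterate of the shift, across the gap. The return words of an
interval with minimal return times renormalise the pair (`ReturnInterval.renormalisable`). Their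
cyclic inequalities are obtained by an infinite descent on the position of a first difference
(`GapWords.shift_le`), and they are not cyclic permutations of each other since otherwise a shorter
return interval exists or the subshift is balanced (`FirstReturn.exists_shorter`). Therefore a
non-renormalisable pair has a transitive subshift (`isTransitive_lexShift`). It applies to the corner
as `A` inherits unbalancedness (`InBox.unbalanced`).

*Outside the essential component.* An orbit that is not in `A` visits the `excess`, the points
between `ω^∞` and `ν^∞`. Such a point starts with `ω` or `ν`, and removing this word leads to the
excess again (`InBox.strip`). It follows that `A` is backward invariant (`InBox.mem_of_shift_mem`),
hence maximal among the transitive sets, that a word of `Σ_(α,β)` is a word of `A` followed by a word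
of `{ω,ν}^∞` (`InBox.pre_decomposition`), and that another transitive component consists of
concatenations of `ω` and `ν` with a bounded number of consecutive `ω`
(`InBox.exists_bounded_runs`). If `(α, β)` is not the corner, the orbit of `α` or of `β` is not
contained in `A`, and Zorn's lemma extends it to another component.

*Entropy.* We have `h({ω,ν}^∞) = log₂ t⁻¹` for the solution of `t^|ω| + t^|ν| = 1`, and a bound on
the number of consecutive `ω` makes the entropy strictly smaller (`entropy_lt_of_bounded_runs`).
The inequality `h({ω,ν}^∞) ≤ h(A)` follows from two words no longer than `ω` and `ν` all of whose
concatenations lie in `A`. They are found by a Farey descent along the substitutions `0 ↦ 0`,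
`1 ↦ 10` and its mirror image (`exists_free_words`), which ends because `A` is unbalanced. With the
decomposition of words this gives `h(Σ_(α,β)) = h(A)`.
-/

namespace LexShift

/-! ### The lexicographic order on binary sequences -/

-- The lexicographic order lives on the type synonym `Lex`; these abbreviate comparisons in it.
notation:50 x:51 " ≤ₗ " y:51 => toLex x ≤ toLex y
notation:50 x:51 " <ₗ " y:51 => toLex x < toLex y

theorem lt_def {x y : BinSeq} :
    x <ₗ y ↔ ∃ i, (∀ j < i, x j = y j) ∧ x i = false ∧ y i = true := by
  have : x <ₗ y ↔ ∃ i, (∀ j < i, x j = y j) ∧ x i < y i := Iff.rfl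
  simp only [this, Bool.lt_iff]

theorem le_antisymm' {x y : BinSeq} (h : x ≤ₗ y) (h' : y ≤ₗ x) : x = y :=
  toLex_inj.1 (le_antisymm h h')

theorem shift_iterate (n : ℕ) (x : BinSeq) (i : ℕ) : shift^[n] x i = x (n + i) := by
  induction n generalizing x with
  | zero => simp
  | succ n ih =>
    rw [Function.iterate_succ_apply, ih]
    simp only [shift]
    congr 1; omega

theorem shift_shift (m n : ℕ) (x : BinSeq) : shift^[m] (shift^[n] x) = shift^[m + n] x :=
  (Function.iterate_add_apply _ _ _ _).symm

theorem lt_of_head {x y : BinSeq} (hx : x 0 = false) (hy : y 0 = true) : x <ₗ y :=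
  lt_def.2 ⟨0, by simp, hx, hy⟩

theorem head_of_le {x y : BinSeq} (h : x ≤ₗ y) (hx : x 0 = true) : y 0 = true := by
  by_contra hy
  exact absurd (lt_of_head (by simpa using hy) hx) (not_lt.2 h)

theorem head_of_le' {x y : BinSeq} (h : x ≤ₗ y) (hy : y 0 = false) : x 0 = false := by
  by_contra hx
  exact absurd (lt_of_head hy (by simpa using hx)) (not_lt.2 h)

theorem lt_iff_shift {x y : BinSeq} {n : ℕ} (h : ∀ i < n, x i = y i) :
    x <ₗ y ↔ shift^[n] x <ₗ shift^[n] y := by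
  simp only [lt_def, shift_iterate]
  constructor
  · rintro ⟨i, hi, h0, h1⟩
    have hn : n ≤ i := by
      by_contra hc
      have := h i (by omega)
      rw [h0, h1] at this
      exact absurd this (by simp)
    refine ⟨i - n, fun j hj => hi _ (by omega), ?_, ?_⟩ <;>
      rwa [Nat.add_sub_cancel' hn]
  · rintro ⟨i, hi, h0, h1⟩
    refine ⟨n + i, fun j hj => ?_, h0, h1⟩
    by_cases hjn : j < n
    · exact h j hjn
    · have := hi (j - n) (by omega)
      rwa [Nat.add_sub_cancel' (by omega)] at this

theorem le_iff_shift {x y : BinSeq} {n : ℕ} (h : ∀ i < n, x i = y i) :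
    x ≤ₗ y ↔ shift^[n] x ≤ₗ shift^[n] y := by
  exact not_lt.symm.trans ((not_congr (lt_iff_shift fun i hi => (h i hi).symm)).trans not_lt)

/-- A sequence between two sequences with a common prefix has the same prefix. -/
theorem agree_of_between {x y z : BinSeq} {n : ℕ} (h : ∀ i < n, x i = y i)
    (hxz : x ≤ₗ z) (hzy : z ≤ₗ y) : ∀ i < n, z i = x i := by
  intro i
  induction i using Nat.strong_induction_on with
  | _ i ih =>
    intro hi
    have hz : ∀ j < i, x j = z j := fun j hj => (ih j hj (by omega)).symm
    have hz' : ∀ j < i, z j = y j := fun j hj => by rw [ih j hj (by omega), h j (by omega)]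
    have h1 := (le_iff_shift hz).1 hxz
    have h2 := (le_iff_shift hz').1 hzy
    cases hx : x i
    · have := head_of_le' h2 (by simpa [shift_iterate, ← h i hi] using hx)
      simpa [shift_iterate] using this
    · have := head_of_le h1 (by simpa [shift_iterate] using hx)
      simpa [shift_iterate] using this

/-- If `x < y`, then the two sequences either differ among the first `n` digits in such a way that
every pair with the same first `n` digits is ordered in the same way, or agree there. -/
theorem lt_cases {x y : BinSeq} (h : x <ₗ y) (n : ℕ) :
    (∃ i < n, (∀ j < i, x j = y j) ∧ x i = false ∧ y i = true) ∨
      ((∀ i < n, x i = y i) ∧ shift^[n] x <ₗ shift^[n] y) := by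
  by_cases hn : ∀ i < n, x i = y i
  · exact Or.inr ⟨hn, (lt_iff_shift hn).1 h⟩
  · obtain ⟨i, hi, h0, h1⟩ := lt_def.1 h
    refine Or.inl ⟨i, ?_, hi, h0, h1⟩
    by_contra hin
    exact hn fun j hj => hi j (by omega)

theorem shift_mono {x y : BinSeq} (h : x ≤ₗ y) (h0 : x 0 = y 0) : shift x ≤ₗ shift y :=
  (le_iff_shift (n := 1) (by simpa using h0)).1 h

theorem mirror_mirror (x : BinSeq) : mirror (mirror x) = x := by
  funext n; simp [mirror]

theorem mirror_lt {x y : BinSeq} : mirror x <ₗ mirror y ↔ y <ₗ x := by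
  simp only [lt_def, mirror, Bool.not_eq_eq_eq_not, Bool.not_true, Bool.not_false, Bool.not_not]
  constructor
  · rintro ⟨i, hi, h0, h1⟩
    exact ⟨i, fun j hj => (hi j hj).symm, h1, h0⟩
  · rintro ⟨i, hi, h0, h1⟩
    exact ⟨i, fun j hj => (hi j hj).symm, h1, h0⟩

theorem mirror_le {x y : BinSeq} : mirror x ≤ₗ mirror y ↔ y ≤ₗ x := by
  exact not_lt.symm.trans ((not_congr mirror_lt).trans not_lt)

theorem shift_mirror (n : ℕ) (x : BinSeq) : shift^[n] (mirror x) = mirror (shift^[n] x) := by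
  funext i; simp [shift_iterate, mirror]

/-! ### Prepending words -/

theorem prepend_lt {w : List Bool} {x : BinSeq} {n : ℕ} (h : n < w.length) :
    prepend w x n = w[n] := by simp [prepend, h]

theorem prepend_ge {w : List Bool} {x : BinSeq} (n : ℕ) :
    prepend w x (w.length + n) = x n := by simp [prepend]

theorem shift_prepend (w : List Bool) (x : BinSeq) : shift^[w.length] (prepend w x) = x := by
  funext n; rw [shift_iterate, prepend_ge]

@[simp] theorem prepend_singleton_zero (b : Bool) (x : BinSeq) : prepend [b] x 0 = b := by
  simp [prepend]

@[simp] theorem prepend_singleton_succ (b : Bool) (x : BinSeq) (n : ℕ) :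
    prepend [b] x (n + 1) = x n := by simp [prepend]

@[simp] theorem shift_prepend_singleton (b : Bool) (x : BinSeq) : shift (prepend [b] x) = x := by
  funext n; simp [shift]

theorem prepend_head_shift (x : BinSeq) : prepend [x 0] (shift x) = x := by
  funext n; cases n <;> simp [shift]

theorem eq_prepend_of_head {x : BinSeq} {b : Bool} (h : x 0 = b) : x = prepend [b] (shift x) := by
  rw [← h, prepend_head_shift]

theorem prepend_append (u v : List Bool) (x : BinSeq) :
    prepend (u ++ v) x = prepend u (prepend v x) := by
  funext n
  rcases lt_or_ge n u.length with h | h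
  · rw [prepend_lt h, prepend_lt (by simp; omega), List.getElem_append_left h]
  · obtain ⟨m, rfl⟩ := Nat.exists_eq_add_of_le h
    rw [prepend_ge]
    rcases lt_or_ge m v.length with h' | h'
    · rw [prepend_lt h', prepend_lt (by simp; omega), List.getElem_append_right (by omega)]
      simp
    · obtain ⟨k, rfl⟩ := Nat.exists_eq_add_of_le h'
      rw [prepend_ge, ← Nat.add_assoc, ← List.length_append, prepend_ge]

theorem prepend_le_prepend {w : List Bool} {x y : BinSeq} :
    prepend w x ≤ₗ prepend w y ↔ x ≤ₗ y := by
  rw [le_iff_shift (n := w.length), shift_prepend, shift_prepend]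
  intro i hi
  rw [prepend_lt hi, prepend_lt hi]

theorem prepend_lt_prepend {w : List Bool} {x y : BinSeq} :
    prepend w x <ₗ prepend w y ↔ x <ₗ y := by
  exact not_le.symm.trans ((not_congr prepend_le_prepend).trans not_le)

theorem prepend_injective (w : List Bool) : Function.Injective (prepend w) := by
  intro x y h
  rw [← shift_prepend w x, ← shift_prepend w y, h]

theorem mirror_prepend (w : List Bool) (x : BinSeq) :
    mirror (prepend w x) = prepend (w.map not) (mirror x) := by
  funext n
  rcases lt_or_ge n w.length with h | h
  · rw [prepend_lt (by simpa using h)]; simp [mirror, prepend_lt h]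
  · obtain ⟨m, rfl⟩ := Nat.exists_eq_add_of_le h
    have := prepend_ge (w := w.map not) (x := mirror x) m
    rw [List.length_map] at this
    rw [this]; simp [mirror, prepend_ge]

/-- The word formed by the first `n` digits of `x`. -/
def pre (x : BinSeq) (n : ℕ) : List Bool := (List.range n).map x

@[simp] theorem length_pre (x : BinSeq) (n : ℕ) : (pre x n).length = n := by simp [pre]

@[simp] theorem getElem_pre (x : BinSeq) (n i : ℕ) (h : i < (pre x n).length) :
    (pre x n)[i] = x i := by simp [pre]

theorem prepend_pre_lt {x y : BinSeq} {n i : ℕ} (h : i < n) : prepend (pre x n) y i = x i := by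
  rw [prepend_lt (by simpa using h), getElem_pre]

theorem prepend_pre_ge {x y : BinSeq} {n : ℕ} (i : ℕ) : prepend (pre x n) y (n + i) = y i := by
  have := prepend_ge (w := pre x n) (x := y) i
  rwa [length_pre] at this

theorem shift_prepend_pre (x y : BinSeq) (n : ℕ) : shift^[n] (prepend (pre x n) y) = y := by
  have := shift_prepend (pre x n) y
  rwa [length_pre] at this

/-- Reassembling a sequence from a prefix and the remaining tail. -/
theorem prepend_pre_shift (x : BinSeq) (n : ℕ) : prepend (pre x n) (shift^[n] x) = x := by
  funext i
  rcases lt_or_ge i n with h | h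
  · exact prepend_pre_lt h
  · obtain ⟨m, rfl⟩ := Nat.exists_eq_add_of_le h
    rw [prepend_pre_ge, shift_iterate]

theorem shift_prepend_pre_of_le {x y : BinSeq} {n l : ℕ} (h : l ≤ n) :
    shift^[l] (prepend (pre x n) y) = prepend (pre (shift^[l] x) (n - l)) y := by
  funext i
  rw [shift_iterate]
  rcases lt_or_ge i (n - l) with h' | h'
  · rw [prepend_pre_lt h', prepend_pre_lt (by omega), shift_iterate]
  · obtain ⟨m, rfl⟩ := Nat.exists_eq_add_of_le h'
    rw [prepend_pre_ge, ← Nat.add_assoc, Nat.add_sub_cancel' h, prepend_pre_ge]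

theorem pre_congr {x y : BinSeq} {n : ℕ} (h : ∀ i < n, x i = y i) : pre x n = pre y n := by
  apply List.ext_getElem (by simp)
  intro i h1 _
  simpa using h i (by simpa using h1)

theorem occursAt_zero_iff {w : List Bool} {x : BinSeq} :
    OccursAt w x 0 ↔ pre x w.length = w := by
  constructor
  · intro h
    apply List.ext_getElem (by simp)
    intro i h1 h2
    simpa using h i h2
  · intro h i hi
    have : (pre x w.length)[i]'(by simpa using hi) = w[i] := by simp only [h]
    simpa using this

theorem occursAt_iff_shift {w : List Bool} {x : BinSeq} {k : ℕ} :
    OccursAt w x k ↔ OccursAt w (shift^[k] x) 0 := by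
  simp only [OccursAt, shift_iterate, Nat.zero_add]

theorem occursAt_zero_iff_prepend {w : List Bool} {x : BinSeq} :
    OccursAt w x 0 ↔ x = prepend w (shift^[w.length] x) := by
  constructor
  · intro h
    conv_lhs => rw [← prepend_pre_shift x w.length, occursAt_zero_iff.1 h]
  · intro h i hi
    rw [Nat.zero_add, h, prepend_lt hi]

/-! ### Periodic sequences -/

theorem periodicSeq_add_length (w : List Bool) (n : ℕ) :
    periodicSeq w (w.length + n) = periodicSeq w n := by simp [periodicSeq]

theorem shift_periodicSeq (w : List Bool) : shift^[w.length] (periodicSeq w) = periodicSeq w := by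
  funext n; rw [shift_iterate, periodicSeq_add_length]

theorem periodicSeq_lt {w : List Bool} {n : ℕ} (h : n < w.length) : periodicSeq w n = w[n] := by
  simp [periodicSeq, Nat.mod_eq_of_lt h, h]

theorem periodicSeq_eq_prepend {w : List Bool} : prepend w (periodicSeq w) = periodicSeq w := by
  funext n
  rcases lt_or_ge n w.length with h | h
  · rw [prepend_lt h, periodicSeq_lt h]
  · obtain ⟨m, rfl⟩ := Nat.exists_eq_add_of_le h
    rw [prepend_ge, periodicSeq_add_length]

theorem pre_periodicSeq (w : List Bool) : pre (periodicSeq w) w.length = w :=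
  occursAt_zero_iff.1 (occursAt_zero_iff_prepend.2 (by
    rw [shift_periodicSeq, periodicSeq_eq_prepend]))

theorem iterate_mul_period {x : BinSeq} {p : ℕ} (h : shift^[p] x = x) (k : ℕ) :
    shift^[p * k] x = x := by
  rw [Function.iterate_mul]
  exact Function.iterate_fixed h k

theorem period_mod {x : BinSeq} {p : ℕ} (h : shift^[p] x = x) (n : ℕ) :
    shift^[n] x = shift^[n % p] x := by
  conv_lhs => rw [← Nat.mod_add_div n p, ← shift_shift, iterate_mul_period h]

theorem periodicSeq_unique {w : List Bool} (hw : w ≠ []) {x : BinSeq}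
    (h : x = prepend w x) : x = periodicSeq w := by
  have hp : 0 < w.length := List.length_pos_iff.2 hw
  have h1 : shift^[w.length] x = x := by conv_lhs => rw [h, shift_prepend]
  funext n
  have h2 := congrFun (period_mod h1 n) 0
  have h3 := congrFun (period_mod (shift_periodicSeq w) n) 0
  rw [shift_iterate, shift_iterate] at h2 h3
  have hlt := Nat.mod_lt n hp
  simp only [Nat.add_zero] at h2 h3
  rw [h2, h3, h, prepend_lt hlt, periodicSeq_lt hlt]

theorem eq_periodicSeq_pre {x : BinSeq} {p : ℕ} (hp : 0 < p) (h : shift^[p] x = x) :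
    periodicSeq (pre x p) = x := by
  refine (periodicSeq_unique (List.ne_nil_of_length_pos (by simpa using hp)) ?_).symm
  conv_lhs => rw [← prepend_pre_shift x p, h]

/-- A multiple of a period brings every tail of a periodic sequence back to the sequence. -/
theorem exists_shift_return {x : BinSeq} {p : ℕ} (hp : 0 < p) (h : shift^[p] x = x) (n : ℕ) :
    ∃ t ≤ p, 0 < t ∧ shift^[t] (shift^[n] x) = x := by
  have hlt := Nat.mod_lt n hp
  refine ⟨p - n % p, by omega, by omega, ?_⟩
  rw [period_mod h n, shift_shift, Nat.sub_add_cancel hlt.le, h]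

theorem period_shift {x : BinSeq} {p : ℕ} (h : shift^[p] x = x) (n : ℕ) :
    shift^[p] (shift^[n] x) = shift^[n] x := by
  rw [shift_shift, Nat.add_comm, ← shift_shift, h]

/-! ### Lexicographic subshifts -/

section

variable {α β x y z : BinSeq}

theorem LexWorld.head_max (h : LexWorld α β) : α 0 = true := h.1.1

theorem LexWorld.head_min (h : LexWorld α β) : β 0 = false := by
  simpa [mirror] using h.2.1.1

theorem LexWorld.max_mem (h : LexWorld α β) : α ∈ lexShift α β :=
  fun n => ⟨(h.2.2 n).1, h.1.2 n⟩

theorem LexWorld.min_mem (h : LexWorld α β) : β ∈ lexShift α β :=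
  fun n => ⟨by simpa only [shift_mirror, mirror_le] using h.2.1.2 n, (h.2.2 n).2⟩

theorem lexWorld_iff :
    LexWorld α β ↔ α 0 = true ∧ β 0 = false ∧ α ∈ lexShift α β ∧ β ∈ lexShift α β := by
  constructor
  · exact fun h => ⟨h.head_max, h.head_min, h.max_mem, h.min_mem⟩
  · rintro ⟨h1, h2, h3, h4⟩
    refine ⟨⟨h1, fun n => (h3 n).2⟩, ⟨by simp [mirror, h2], fun n => ?_⟩,
      fun n => ⟨(h3 n).1, (h4 n).2⟩⟩
    rw [shift_mirror, mirror_le]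
    exact (h4 n).1

theorem shift_mem_lexShift (h : x ∈ lexShift α β) (n : ℕ) : shift^[n] x ∈ lexShift α β := by
  intro m
  rw [shift_shift]
  exact h _

theorem le_max (h : x ∈ lexShift α β) : x ≤ₗ α := (h 0).2

theorem min_le (h : x ∈ lexShift α β) : β ≤ₗ x := (h 0).1

theorem mirror_mem_lexShift :
    mirror x ∈ lexShift (mirror β) (mirror α) ↔ x ∈ lexShift α β := by
  refine forall_congr' fun n => ?_
  rw [shift_mirror, mirror_le, mirror_le, and_comm]

theorem LexWorld.mirror (h : LexWorld α β) : LexWorld (mirror β) (mirror α) := by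
  rw [lexWorld_iff]
  refine ⟨by simp [LexShift.mirror, h.head_min], by simp [LexShift.mirror, h.head_max], ?_, ?_⟩
  · exact mirror_mem_lexShift.2 h.min_mem
  · exact mirror_mem_lexShift.2 h.max_mem

theorem mirror_prepend_false (x : BinSeq) :
    mirror (prepend [false] x) = prepend [true] (mirror x) := mirror_prepend _ _

theorem mirror_prepend_true (x : BinSeq) :
    mirror (prepend [true] x) = prepend [false] (mirror x) := mirror_prepend _ _

theorem prepend_false_le (z : BinSeq) : prepend [false] z ≤ₗ z := by
  by_contra hc
  obtain ⟨i, hi, h0, h1⟩ := lt_def.1 (not_le.1 hc)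
  have hz : ∀ j < i, z j = false := by
    intro j
    induction j with
    | zero => intro hj; simpa using hi 0 hj
    | succ j ih => intro hj; rw [hi _ hj, prepend_singleton_succ]; exact ih (by omega)
  cases i with
  | zero => simp at h1
  | succ i => simp [hz i (by omega)] at h1

theorem le_prepend_true (z : BinSeq) : z ≤ₗ prepend [true] z := by
  rw [← mirror_le, mirror_prepend_true]
  exact prepend_false_le _

theorem le_shift_of_head (h : x 0 = false) : x ≤ₗ shift x := by
  conv_lhs => rw [eq_prepend_of_head h]
  exact prepend_false_le _

theorem shift_le_of_head (h : x 0 = true) : shift x ≤ₗ x := by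
  conv_rhs => rw [eq_prepend_of_head h]
  exact le_prepend_true _

theorem shift_succ (n : ℕ) (x : BinSeq) : shift^[n + 1] x = shift (shift^[n] x) :=
  Function.iterate_succ_apply' _ _ _

theorem le_zeroMax (h : x ∈ lexShift α β) (h0 : x 0 = false) : x ≤ₗ prepend [false] α := by
  rw [eq_prepend_of_head h0, prepend_le_prepend]
  exact (h 1).2

theorem oneMin_le (h : x ∈ lexShift α β) (h0 : x 0 = true) : prepend [true] β ≤ₗ x := by
  rw [eq_prepend_of_head h0, prepend_le_prepend]
  exact (h 1).1

/-- Besides the two outer bounds, only the tails that start with `0` have to be compared with `0α`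
and those that start with `1` with `1β`. -/
theorem mem_lexShift_of_tails (hβ : β ≤ₗ x) (hα : x ≤ₗ α)
    (h0 : ∀ n, shift^[n] x 0 = false → shift^[n] x ≤ₗ prepend [false] α)
    (h1 : ∀ n, shift^[n] x 0 = true → prepend [true] β ≤ₗ shift^[n] x) :
    x ∈ lexShift α β := by
  intro n
  induction n with
  | zero => exact ⟨hβ, hα⟩
  | succ n ih =>
    rw [shift_succ]
    cases hx : shift^[n] x 0
    · have := h0 n hx
      rw [eq_prepend_of_head hx, prepend_le_prepend] at this
      exact ⟨ih.1.trans (le_shift_of_head hx), this⟩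
    · have := h1 n hx
      rw [eq_prepend_of_head hx, prepend_le_prepend] at this
      exact ⟨this, (shift_le_of_head hx).trans ih.2⟩

theorem mem_of_shift_mem (h : shift x ∈ lexShift α β) (hβ : β ≤ₗ x) (hα : x ≤ₗ α) :
    x ∈ lexShift α β := by
  intro n
  cases n with
  | zero => exact ⟨hβ, hα⟩
  | succ n => exact h n

theorem prepend_false_mem (h : y ∈ lexShift α β) (hα : α 0 = true)
    (hy : β ≤ₗ prepend [false] y) : prepend [false] y ∈ lexShift α β :=
  mem_of_shift_mem (by simpa using h) hy (lt_of_head (by simp) hα).le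

theorem prepend_true_mem (h : y ∈ lexShift α β) (hβ : β 0 = false)
    (hy : prepend [true] y ≤ₗ α) : prepend [true] y ∈ lexShift α β :=
  mem_of_shift_mem (by simpa using h) (lt_of_head hβ (by simp)).le hy

theorem LexWorld.zeroMax_mem (h : LexWorld α β) : prepend [false] α ∈ lexShift α β := by
  refine prepend_false_mem h.max_mem h.head_max ?_
  rw [eq_prepend_of_head h.head_min, prepend_le_prepend]
  exact (h.min_mem 1).2

theorem LexWorld.oneMin_mem (h : LexWorld α β) : prepend [true] β ∈ lexShift α β := by
  refine prepend_true_mem h.min_mem h.head_min ?_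
  rw [eq_prepend_of_head h.head_max, prepend_le_prepend]
  exact (h.max_mem 1).1

theorem LexWorld.zeroMax_lt_oneMin : prepend [false] α <ₗ prepend [true] β :=
  lt_of_head (by simp) (by simp)

/-- The follower set of a word is order convex. -/
theorem prepend_pre_mem {n : ℕ} (hx : x ∈ lexShift α β) (hy : y ∈ lexShift α β)
    (hz : z ∈ lexShift α β) (h : ∀ i < n, x i = y i) (hxz : shift^[n] x ≤ₗ z)
    (hzy : z ≤ₗ shift^[n] y) : prepend (pre x n) z ∈ lexShift α β := by
  intro l
  rcases le_or_gt l n with hl | hl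
  · rw [shift_prepend_pre_of_le hl]
    constructor
    · refine (hx l).1.trans ?_
      rw [← prepend_pre_shift (shift^[l] x) (n - l), prepend_pre_shift _ (n - l)]
      conv_lhs => rw [← prepend_pre_shift (shift^[l] x) (n - l)]
      rw [prepend_le_prepend, shift_shift, Nat.sub_add_cancel hl]
      exact hxz
    · refine le_trans ?_ (hy l).2
      conv_rhs => rw [← prepend_pre_shift (shift^[l] y) (n - l)]
      rw [pre_congr (y := shift^[l] y) fun i hi => ?_, prepend_le_prepend, shift_shift,
        Nat.sub_add_cancel hl]
      · exact hzy
      · rw [shift_iterate, shift_iterate, h _ (by omega)]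
  · obtain ⟨m, rfl⟩ := Nat.exists_eq_add_of_lt hl
    rw [show n + m + 1 = (m + 1) + n by omega, ← shift_shift, shift_prepend_pre]
    exact hz _

/-- Closedness for the product topology: a set is closed as soon as it contains every sequence all
of whose prefixes occur as prefixes of its elements. -/
theorem isClosed_of_agree {C : Set BinSeq} (h : ∀ x, (∀ n, ∃ y ∈ C, ∀ i < n, x i = y i) → x ∈ C) :
    IsClosed C := by
  rw [← closure_subset_iff_isClosed]
  intro x hx
  refine h x fun n => ?_
  have hU : IsOpen {y : BinSeq | ∀ i < n, x i = y i} := by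
    have : {y : BinSeq | ∀ i < n, x i = y i} =
        ⋂ i ∈ Finset.range n, (fun y : BinSeq => y i) ⁻¹' {x i} := by
      ext y; simp [eq_comm]
    rw [this]
    exact isOpen_biInter_finset fun i _ => (isOpen_discrete _).preimage (continuous_apply i)
  obtain ⟨y, hy, hyC⟩ := mem_closure_iff.1 hx _ hU (fun i _ => rfl)
  exact ⟨y, hyC, hy⟩

/-- Converse of `isClosed_of_agree`. -/
theorem agree_of_isClosed {C : Set BinSeq} (hC : IsClosed C) {x : BinSeq}
    (h : ∀ n, ∃ y ∈ C, ∀ i < n, x i = y i) : x ∈ C := by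
  rw [← hC.closure_eq]
  choose y hy hxy using h
  refine mem_closure_of_tendsto (f := y) (b := atTop) ?_ (Eventually.of_forall hy)
  rw [tendsto_pi_nhds]
  intro i
  refine tendsto_const_nhds.congr' ?_
  filter_upwards [eventually_gt_atTop i] with n hn using hxy n i hn

theorem isClosed_lexShift : IsClosed (lexShift α β) := by
  refine isClosed_of_agree fun x h n => ⟨?_, ?_⟩
  all_goals
    by_contra hc
    obtain ⟨i, hi, h0, h1⟩ := lt_def.1 (not_le.1 hc)
    obtain ⟨y, hy, hxy⟩ := h (n + i + 1)
    have hxy' : ∀ j ≤ i, shift^[n] x j = shift^[n] y j := fun j hj => by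
      rw [shift_iterate, shift_iterate]; exact hxy _ (by omega)
  · refine absurd (hy n).1 (not_le.2 (lt_def.2 ⟨i, fun j hj => ?_, ?_, h1⟩))
    · rw [← hxy' j hj.le]; exact hi j hj
    · rw [← hxy' i le_rfl]; exact h0
  · refine absurd (hy n).2 (not_le.2 (lt_def.2 ⟨i, fun j hj => ?_, h0, ?_⟩))
    · rw [← hxy' j hj.le]; exact hi j hj
    · rw [← hxy' i le_rfl]; exact h1

/-! ### Frequencies of ones -/

/-- The number of ones among the first `n` digits of `x`. -/
def ones (x : BinSeq) (n : ℕ) : ℕ := ∑ i ∈ Finset.range n, (x i).toNat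

@[simp] theorem ones_zero (x : BinSeq) : ones x 0 = 0 := by simp [ones]

theorem ones_succ (x : BinSeq) (n : ℕ) : ones x (n + 1) = ones x n + (x n).toNat := by
  simp [ones, Finset.sum_range_succ]

theorem ones_add (x : BinSeq) (m n : ℕ) : ones x (m + n) = ones x m + ones (shift^[m] x) n := by
  simp [ones, Finset.sum_range_add, shift_iterate]

theorem ones_le (x : BinSeq) (n : ℕ) : ones x n ≤ n := by
  induction n with
  | zero => simp
  | succ n ih => rw [ones_succ]; have := Bool.toNat_le (x n); omega

theorem ones_mono (x : BinSeq) : Monotone (ones x) :=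
  monotone_nat_of_le_succ fun n => by rw [ones_succ]; omega

theorem ones_congr {x y : BinSeq} {n : ℕ} (h : ∀ i < n, x i = y i) : ones x n = ones y n :=
  Finset.sum_congr rfl fun i hi => by rw [h i (Finset.mem_range.1 hi)]

theorem ones_mirror (x : BinSeq) (n : ℕ) : ones (mirror x) n + ones x n = n := by
  induction n with
  | zero => simp
  | succ n ih => rw [ones_succ, ones_succ]; cases h : x n <;> simp [mirror, h] <;> omega

/-- Two points of `A` have an unbounded difference between their numbers of ones, so that `A` does
not have a single frequency of ones with bounded deviation. -/
def Unbalanced (A : Set BinSeq) : Prop :=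
  ∃ x ∈ A, ∃ y ∈ A, ∀ C : ℕ, ∃ n, ones y n + C < ones x n

theorem Unbalanced.mirror {α β : BinSeq} (h : Unbalanced (lexShift α β)) :
    Unbalanced (lexShift (mirror β) (mirror α)) := by
  obtain ⟨x, hx, y, hy, h⟩ := h
  refine ⟨_, mirror_mem_lexShift.2 hy, _, mirror_mem_lexShift.2 hx, fun C => ?_⟩
  obtain ⟨n, hn⟩ := h C
  refine ⟨n, ?_⟩
  have := ones_mirror x n
  have := ones_mirror y n
  omega

/-- The number of ones in every prefix of length `n` is `c/p * n` up to a bounded error. -/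
def HasFrequency (p c : ℕ) (x : BinSeq) : Prop :=
  ∃ C : ℕ, ∀ n, p * ones x n ≤ c * n + C ∧ c * n ≤ p * ones x n + C

theorem HasFrequency.of_shift {p c k : ℕ} {x : BinSeq} (h : HasFrequency p c (shift^[k] x)) :
    HasFrequency p c x := by
  obtain ⟨C, hC⟩ := h
  refine ⟨C + p * k + c * k, fun n => ?_⟩
  rcases le_total n k with hn | hn
  · have h1 := Nat.mul_le_mul_left p ((ones_le x n).trans hn)
    have h2 := Nat.mul_le_mul_left c hn
    omega
  · obtain ⟨m, rfl⟩ := Nat.exists_eq_add_of_le hn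
    have h1 := Nat.mul_le_mul_left p (ones_le x k)
    have h2 := hC m
    rw [ones_add, mul_add, mul_add]
    omega

/-- It suffices to count the ones in the prefixes whose lengths are multiples of `p`. -/
theorem hasFrequency_of_multiples {p c : ℕ} (hp : 0 < p) {x : BinSeq}
    (h : ∀ k, ones x (p * k) = c * k) : HasFrequency p c x := by
  refine ⟨p * p + c * p, fun n => ?_⟩
  have h1 := h (n / p)
  have h2 := Nat.div_add_mod n p
  have h3 := Nat.mod_lt n hp
  set k := n / p
  have h4 : ones x n = c * k + ones (shift^[p * k] x) (n % p) := by
    conv_lhs => rw [← h2]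
    rw [ones_add, h1]
  have h5 := ones_le (shift^[p * k] x) (n % p)
  have h6 : p * ones (shift^[p * k] x) (n % p) ≤ p * p := Nat.mul_le_mul_left p (by omega)
  have h7 : c * (n % p) ≤ c * p := Nat.mul_le_mul_left c h3.le
  have h8 : c * n = p * (c * k) + c * (n % p) := by
    conv_lhs => rw [← h2]
    ring
  rw [h4, h8, mul_add]
  omega

theorem not_unbalanced_of_hasFrequency {p c : ℕ} (hp : 0 < p) {A : Set BinSeq}
    (h : ∀ x ∈ A, HasFrequency p c x) : ¬ Unbalanced A := by
  rintro ⟨x, hx, y, hy, hxy⟩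
  obtain ⟨C, hC⟩ := h x hx
  obtain ⟨D, hD⟩ := h y hy
  obtain ⟨n, hn⟩ := hxy (C + D)
  have h1 := Nat.mul_le_mul_left p hn
  have h2 := (hC n).1
  have h3 := (hD n).2
  have h4 : C + D ≤ p * (C + D) := Nat.le_mul_of_pos_left _ hp
  simp only [Nat.succ_eq_add_one, mul_add] at h1 h4
  omega

/-- If `σ(α) < σ(β)`, then the shift respects the cyclic order on `Σ_(α,β)`, so that it lifts to an
increasing map of the line and all its points have the same rotation number. -/
theorem Unbalanced.shift_min_le_shift_max (hLW : LexWorld α β)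
    (h : Unbalanced (lexShift α β)) : shift β ≤ₗ shift α := by
  by_contra hc
  have hc := not_le.1 hc
  -- the prefixes of `x` and `y` differ by at most one digit `1`, and whenever `x` is one ahead its
  -- remaining tail is not larger; a new lead of `x` arises from tails starting with `1` and `0`,
  -- whose shifts are separated by `σ(α) < σ(β)`
  have key : ∀ x ∈ lexShift α β, ∀ y ∈ lexShift α β, ∀ n, ones x n < ones y n + 1 ∨
      (ones x n = ones y n + 1 ∧ shift^[n] x ≤ₗ shift^[n] y) := by
    intro x hx y hy n
    induction n with
    | zero => simp
    | succ n ih =>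
      rw [ones_succ, ones_succ, shift_succ, shift_succ]
      have hu := hx n
      have hv := hy n
      have hx0 : shift^[n] x 0 = x n := by rw [shift_iterate]; simp
      have hy0 : shift^[n] y 0 = y n := by rw [shift_iterate]; simp
      cases hxn : x n <;> cases hyn : y n <;> simp only [Bool.toNat_false, Bool.toNat_true]
      · rcases ih with ih | ih
        · left; omega
        · right
          exact ⟨by omega, shift_mono ih.2 (by rw [hx0, hy0, hxn, hyn])⟩
      · left; omega
      · rcases ih with ih | ih
        · rcases Nat.lt_or_ge (ones x n) (ones y n) with h' | h'
          · left; omega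
          · right
            refine ⟨by omega, ?_⟩
            have h1 : shift (shift^[n] x) ≤ₗ shift α :=
              shift_mono hu.2 (by rw [hx0, hxn, hLW.head_max])
            have h2 : shift β ≤ₗ shift (shift^[n] y) :=
              shift_mono hv.1 (by rw [hy0, hyn, hLW.head_min])
            exact h1.trans (hc.le.trans h2)
        · have := head_of_le ih.2 (by rw [hx0, hxn])
          rw [hy0, hyn] at this
          exact absurd this (by simp)
      · rcases ih with ih | ih
        · left; omega
        · right
          exact ⟨by omega, shift_mono ih.2 (by rw [hx0, hy0, hxn, hyn])⟩
  obtain ⟨x, hx, y, hy, hxy⟩ := h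
  obtain ⟨n, hn⟩ := hxy 1
  rcases key x hx y hy n with h | h <;> omega

/-- Every point of `Σ_(α,β)` has a preimage as soon as `σ(β) ≤ σ(α)`. -/
theorem exists_preimage (hLW : LexWorld α β) (h : shift β ≤ₗ shift α)
    (hy : y ∈ lexShift α β) : ∃ x ∈ lexShift α β, shift x = y := by
  rcases le_total (toLex (shift β)) (toLex y) with h1 | h1
  · refine ⟨prepend [false] y, prepend_false_mem hy hLW.head_max ?_, by simp⟩
    rw [eq_prepend_of_head hLW.head_min, prepend_le_prepend]
    exact h1
  · refine ⟨prepend [true] y, prepend_true_mem hy hLW.head_min ?_, by simp⟩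
    rw [eq_prepend_of_head hLW.head_max, prepend_le_prepend]
    exact h1.trans h

end

/-! ### Return intervals around the critical gap -/

section

variable {α β : BinSeq}

/-- `I` is an order convex subset of `A`. -/
def LexConvexIn (A I : Set BinSeq) : Prop :=
  I ⊆ A ∧ ∀ x ∈ I, ∀ y ∈ I, ∀ z ∈ A, x ≤ₗ z → z ≤ₗ y → z ∈ I

/-- A proper subset of `Σ_(α,β)` that contains `0α` and `1β` and is completely invariant. -/
structure IsSaturated (α β : BinSeq) (V : Set BinSeq) : Prop where
  subset : V ⊆ lexShift α β
  fwd : ∀ x ∈ V, shift x ∈ V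
  bwd : ∀ x ∈ lexShift α β, shift x ∈ V → x ∈ V
  left_mem : prepend [false] α ∈ V
  right_mem : prepend [true] β ∈ V
  proper : ∃ x ∈ lexShift α β, x ∉ V

/-- The order component of `V` around the gap between `0α` and `1β`. -/
def gapComponent (α β : BinSeq) (V : Set BinSeq) : Set BinSeq :=
  {x | x ∈ lexShift α β ∧
    (x 0 = false → ∀ z ∈ lexShift α β, x ≤ₗ z → z ≤ₗ prepend [false] α → z ∈ V) ∧
    (x 0 = true → ∀ z ∈ lexShift α β, prepend [true] β ≤ₗ z → z ≤ₗ x → z ∈ V)}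

/-- An order convex set around the gap between `0α` and `1β` whose left half is mapped into it by
`σⁿ` and whose right half is mapped into it by `σᵐ`, both across the gap, and which some orbit never
visits. -/
structure ReturnInterval (α β : BinSeq) (K : Set BinSeq) (n m : ℕ) : Prop where
  convex : LexConvexIn (lexShift α β) K
  left_mem : prepend [false] α ∈ K
  right_mem : prepend [true] β ∈ K
  left_return : ∀ x ∈ K, x 0 = false → shift^[n] x ∈ K
  right_return : ∀ x ∈ K, x 0 = true → shift^[m] x ∈ K
  left_cross : shift^[n] (prepend [false] α) 0 = true
  right_cross : shift^[m] (prepend [true] β) 0 = false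
  proper : ∃ x ∈ lexShift α β, ∀ k, shift^[k] x ∉ K

/-- A return interval that is the gap component of a completely invariant set, with `n` and `m`
the first return times of its halves. -/
structure FirstReturn (α β : BinSeq) (K : Set BinSeq) (n m : ℕ) : Prop
    extends ReturnInterval α β K n m where
  left_agree : ∀ y ∈ K, y 0 = false → ∀ i < n, y i = prepend [false] α i
  right_agree : ∀ y ∈ K, y 0 = true → ∀ i < m, y i = prepend [true] β i
  left_first : ∀ y ∈ K, y 0 = false → ∀ i, 0 < i → i < n → shift^[i] y ∉ K
  right_first : ∀ y ∈ K, y 0 = true → ∀ i, 0 < i → i < m → shift^[i] y ∉ K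
  left_sat : ∀ x ∈ lexShift α β, x 0 = false → (∀ i < n, x i = prepend [false] α i) →
    shift^[n] x ∈ K → x ∈ K
  right_sat : ∀ x ∈ lexShift α β, x 0 = true → (∀ i < m, x i = prepend [true] β i) →
    shift^[m] x ∈ K → x ∈ K
  max_notMem : α ∉ K
  min_notMem : β ∉ K

theorem IsSaturated.mirror {V : Set BinSeq} (h : IsSaturated α β V) :
    IsSaturated (mirror β) (mirror α) (mirror ⁻¹' V) where
  subset x hx := by
    rw [← mirror_mirror x, mirror_mem_lexShift]; exact h.subset hx
  fwd x hx := by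
    have := h.fwd _ hx
    rwa [show shift (LexShift.mirror x) = LexShift.mirror (shift x) from shift_mirror 1 x] at this
  bwd x hx hs := by
    rw [← mirror_mirror x, mirror_mem_lexShift] at hx
    exact h.bwd _ hx (by rwa [show shift (LexShift.mirror x) = LexShift.mirror (shift x)
      from shift_mirror 1 x])
  left_mem := by
    simpa [mem_preimage, mirror_prepend_false, mirror_mirror] using h.right_mem
  right_mem := by
    simpa [mem_preimage, mirror_prepend_true, mirror_mirror] using h.left_mem
  proper := by
    obtain ⟨x, hx, hV⟩ := h.proper
    exact ⟨LexShift.mirror x, mirror_mem_lexShift.2 hx, by simpa [mirror_mirror] using hV⟩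

theorem mirror_mem_gapComponent {V : Set BinSeq} {x : BinSeq} :
    mirror x ∈ gapComponent (mirror β) (mirror α) (mirror ⁻¹' V) ↔ x ∈ gapComponent α β V := by
  unfold gapComponent
  simp only [mem_ofPred_eq, mirror_mem_lexShift]
  have h0 : mirror x 0 = false ↔ x 0 = true := by simp [mirror]
  have h1 : mirror x 0 = true ↔ x 0 = false := by simp [mirror]
  rw [h0, h1, ← mirror_prepend_true, ← mirror_prepend_false]
  refine and_congr Iff.rfl ⟨fun ⟨h, h'⟩ => ⟨fun hx z hz hxz hza => ?_, fun hx z hz hxz hza => ?_⟩,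
    fun ⟨h, h'⟩ => ⟨fun hx z hz hxz hza => ?_, fun hx z hz hxz hza => ?_⟩⟩
  · have := h' hx (mirror z) (mirror_mem_lexShift.2 hz) (mirror_le.2 hza) (mirror_le.2 hxz)
    simpa [mirror_mirror] using this
  · have := h hx (mirror z) (mirror_mem_lexShift.2 hz) (mirror_le.2 hza) (mirror_le.2 hxz)
    simpa [mirror_mirror] using this
  · refine h' hx (mirror z) ?_ ?_ ?_
    · rwa [← mirror_mem_lexShift, mirror_mirror]
    · rwa [← mirror_le, mirror_mirror]
    · rwa [← mirror_le, mirror_mirror]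
  · refine h hx (mirror z) ?_ ?_ ?_
    · rwa [← mirror_mem_lexShift, mirror_mirror]
    · rwa [← mirror_le, mirror_mirror]
    · rwa [← mirror_le, mirror_mirror]

theorem IsSaturated.fwd_iterate {V : Set BinSeq} (h : IsSaturated α β V) {x : BinSeq} (hx : x ∈ V)
    (n : ℕ) : shift^[n] x ∈ V := by
  induction n with
  | zero => exact hx
  | succ n ih => rw [shift_succ]; exact h.fwd _ ih

theorem IsSaturated.bwd_iterate {V : Set BinSeq} (h : IsSaturated α β V) {x : BinSeq}
    (hx : x ∈ lexShift α β) (n : ℕ) (hn : shift^[n] x ∈ V) : x ∈ V := by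
  induction n with
  | zero => exact hn
  | succ n ih =>
    rw [shift_succ] at hn
    exact ih (h.bwd _ (shift_mem_lexShift hx n) hn)

section component

variable {V : Set BinSeq}

theorem gapComponent_subset : gapComponent α β V ⊆ V := by
  intro x ⟨hx, h0, h1⟩
  cases h : x 0
  · exact h0 h x hx le_rfl (le_zeroMax hx h)
  · exact h1 h x hx (oneMin_le hx h) le_rfl

theorem left_mem_gapComponent (hLW : LexWorld α β) (h : IsSaturated α β V) :
    prepend [false] α ∈ gapComponent α β V :=
  ⟨hLW.zeroMax_mem, fun _ z _ h1 h2 => le_antisymm' h1 h2 ▸ h.left_mem, fun h0 => by simp at h0⟩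

theorem right_mem_gapComponent (hLW : LexWorld α β) (h : IsSaturated α β V) :
    prepend [true] β ∈ gapComponent α β V :=
  ⟨hLW.oneMin_mem, fun h0 => by simp at h0, fun _ z _ h1 h2 => le_antisymm' h1 h2 ▸ h.right_mem⟩

/-- An order convex subset of `V` that meets the gap component is contained in it. -/
theorem LexConvexIn.subset_gapComponent {I : Set BinSeq} (hLW : LexWorld α β)
    (hI : LexConvexIn (lexShift α β) I) (hIV : I ⊆ V) {u : BinSeq} (hu : u ∈ I)
    (hu' : u ∈ gapComponent α β V) : I ⊆ gapComponent α β V := by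
  intro v hv
  have ha := hLW.zeroMax_mem
  have hb := hLW.oneMin_mem
  refine ⟨hI.1 hv, fun hv0 z hz hvz hza => ?_, fun hv0 z hz hbz hzv => ?_⟩
  · cases hu0 : u 0
    · rcases le_total (toLex z) (toLex u) with h | h
      · exact hIV (hI.2 _ hv _ hu z hz hvz h)
      · exact hu'.2.1 hu0 z hz h hza
    · exact hIV (hI.2 _ hv _ hu z hz hvz (hza.trans (lt_of_head (by simp) hu0).le))
  · cases hu0 : u 0
    · exact hIV (hI.2 _ hu _ hv z hz ((lt_of_head hu0 (by simp)).le.trans hbz) hzv)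
    · rcases le_total (toLex u) (toLex z) with h | h
      · exact hIV (hI.2 _ hu _ hv z hz h hzv)
      · exact hu'.2.2 hu0 z hz hbz h

theorem lexConvexIn_gapComponent :
    LexConvexIn (lexShift α β) (gapComponent α β V) := by
  refine ⟨fun x hx => hx.1, fun x hx y hy z hz hxz hzy => ⟨hz, fun h0 w hw hzw hwa => ?_,
    fun h0 w hw hbw hwz => ?_⟩⟩
  · exact hx.2.1 (head_of_le' hxz h0) w hw (hxz.trans hzw) hwa
  · exact hy.2.2 (head_of_le hzy h0) w hw hbw (hwz.trans hzy)

/-- The left half of the gap component returns to it for the first time as a whole. -/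
theorem exists_left_first_return (hLW : LexWorld α β) (h : IsSaturated α β V) {x : BinSeq}
    {n₀ : ℕ} (hx : x ∈ gapComponent α β V) (hx0 : x 0 = false)
    (hn₀ : shift^[n₀] x ∈ gapComponent α β V) (hn₀' : shift^[n₀] x 0 = true) :
    ∃ n ≤ n₀, shift^[n] (prepend [false] α) 0 = true ∧ ∀ y ∈ gapComponent α β V, y 0 = false →
      (∀ i < n, y i = prepend [false] α i) ∧ shift^[n] y ∈ gapComponent α β V ∧
      ∀ i, 0 < i → i < n → shift^[i] y ∉ gapComponent α β V := by
  classical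
  set K := gapComponent α β V with hK
  set a := prepend [false] α with ha
  have haK : a ∈ K := left_mem_gapComponent hLW h
  have hbK := right_mem_gapComponent hLW h
  have hKc : LexConvexIn (lexShift α β) K := lexConvexIn_gapComponent
  have hKV : K ⊆ V := gapComponent_subset
  have hle : ∀ y ∈ K, y 0 = false → y ≤ₗ a := fun y hy hy0 => le_zeroMax hy.1 hy0
  have hex : ∃ n, 0 < n ∧ ∃ y ∈ K, y 0 = false ∧ shift^[n] y ∈ K := by
    refine ⟨n₀, Nat.pos_of_ne_zero ?_, x, hx, hx0, hn₀⟩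
    rintro rfl
    rw [Function.iterate_zero, id, hx0] at hn₀'
    simp at hn₀'
  -- the least time at which some point of the left half returns
  set n := Nat.find hex with hn
  obtain ⟨hnpos, y₁, hy₁, hy₁0, hy₁n⟩ := Nat.find_spec hex
  have hmin : ∀ i, 0 < i → i < n → ∀ y ∈ K, y 0 = false → shift^[i] y ∉ K :=
    fun i hi hin y hy hy0 hyi => Nat.find_min hex hin ⟨hi, y, hy, hy0, hyi⟩
  -- as long as the left half shares a common prefix, its images are order convex
  have hconv : ∀ i, (∀ y ∈ K, y 0 = false → ∀ j < i, y j = a j) → 0 < i →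
      LexConvexIn (lexShift α β) {z | ∃ y ∈ K, y 0 = false ∧ shift^[i] y = z} := by
    intro i hi hi0
    refine ⟨?_, ?_⟩
    · rintro z ⟨y, hy, _, rfl⟩
      exact shift_mem_lexShift hy.1 i
    · rintro _ ⟨y, hy, hy0, rfl⟩ _ ⟨y', hy', hy'0, rfl⟩ z hz hyz hzy
      have hagree : ∀ j < i, y j = y' j := fun j hj => by rw [hi y hy hy0 j hj, hi y' hy' hy'0 j hj]
      have hmem := prepend_pre_mem hy.1 hy'.1 hz hagree hyz hzy
      refine ⟨prepend (pre y i) z, hKc.2 _ hy _ hy' _ hmem ?_ ?_, ?_, shift_prepend_pre _ _ _⟩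
      · conv_lhs => rw [← prepend_pre_shift y i]
        rwa [prepend_le_prepend]
      · conv_rhs => rw [← prepend_pre_shift y' i]
        rwa [pre_congr hagree, prepend_le_prepend]
      · rw [prepend_pre_lt hi0, hy0]
  -- at a first disagreement with `0α` at time `j < n`, the image of the left half would extend
  -- across the gap, so that it contains `0α`: an earlier return
  have hagree : ∀ i ≤ n, ∀ y ∈ K, y 0 = false → ∀ j < i, y j = a j := by
    intro i
    induction i with
    | zero => intro _ y _ _ j hj; omega
    | succ i ih =>
      intro hi y hy hy0 j hj
      have ih := ih (by omega)
      rcases Nat.lt_succ_iff_lt_or_eq.1 hj with hj | rfl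
      · exact ih y hy hy0 j hj
      · rcases Nat.eq_zero_or_pos j with rfl | hj0
        · simp [hy0, ha]
        · by_contra hne
          have hya := (le_iff_shift (ih y hy hy0)).1 (hle y hy hy0)
          have hyj : shift^[j] y 0 = false := by
            by_contra hc
            have := head_of_le hya (by simpa using hc)
            simp only [shift_iterate, Nat.add_zero, Bool.not_eq_false] at hc this
            exact hne (hc.trans this.symm)
          have haj : shift^[j] a 0 = true := by
            simp only [shift_iterate, Nat.add_zero] at hyj ⊢
            by_contra hc
            exact hne (hyj.trans (by simpa using hc : a j = false).symm)
          have := (hconv j ih hj0).2 _ ⟨y, hy, hy0, rfl⟩ _ ⟨a, haK, by simp [ha], rfl⟩ a haK.1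
            (le_zeroMax (shift_mem_lexShift hy.1 j) hyj) (lt_of_head (by simp [ha]) haj).le
          obtain ⟨y', hy', hy'0, hy'j⟩ := this
          exact hmin j hj0 (by omega) y' hy' hy'0 (hy'j ▸ haK)
  have hreturn : ∀ y ∈ K, y 0 = false → shift^[n] y ∈ K := by
    intro y hy hy0
    refine (hconv n (hagree n le_rfl) hnpos).subset_gapComponent hLW ?_
      (u := shift^[n] y₁) ⟨y₁, hy₁, hy₁0, rfl⟩ hy₁n ⟨y, hy, hy0, rfl⟩
    rintro _ ⟨z, hz, -, rfl⟩
    exact h.fwd_iterate (hKV hz) n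
  refine ⟨n, Nat.find_min' hex ⟨?_, x, hx, hx0, hn₀⟩, ?_, fun y hy hy0 =>
    ⟨hagree n le_rfl y hy hy0, hreturn y hy hy0, fun i hi hin => hmin i hi hin y hy hy0⟩⟩
  · refine Nat.pos_of_ne_zero ?_
    rintro rfl
    rw [Function.iterate_zero, id, hx0] at hn₀'
    simp at hn₀'
  · by_contra hc
    have hc : shift^[n] a 0 = false := by simpa using hc
    -- otherwise the left half is mapped into itself by `σⁿ` and never crosses the gap
    have hleft : ∀ y ∈ K, y 0 = false → shift^[n] y 0 = false := fun y hy hy0 =>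
      head_of_le' ((le_iff_shift (hagree n le_rfl y hy hy0)).1 (hle y hy hy0)) hc
    have hiter : ∀ k, shift^[n * k] x ∈ K ∧ shift^[n * k] x 0 = false := by
      intro k
      induction k with
      | zero => exact ⟨hx, hx0⟩
      | succ k ih =>
        rw [Nat.mul_succ, Nat.add_comm, ← shift_shift]
        exact ⟨hreturn _ ih.1 ih.2, hleft _ ih.1 ih.2⟩
    have hk := hiter (n₀ / n)
    rw [← Nat.div_add_mod n₀ n, Nat.add_comm, ← shift_shift] at hn₀ hn₀'
    rcases Nat.eq_zero_or_pos (n₀ % n) with h0 | h0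
    · rw [h0, Function.iterate_zero, id, hk.2] at hn₀'
      simp at hn₀'
    · exact hmin _ h0 (Nat.mod_lt _ hnpos) _ hk.1 hk.2 hn₀

/-- A point with the same return word as `0α` that is mapped into the gap component belongs to the
gap component: the points between it and `0α` are mapped between two points of the component. -/
theorem left_sat_gapComponent (h : IsSaturated α β V) {n : ℕ}
    (hn : shift^[n] (prepend [false] α) ∈ gapComponent α β V) {x : BinSeq} (hx : x ∈ lexShift α β)
    (hx0 : x 0 = false) (hagree : ∀ i < n, x i = prepend [false] α i)
    (hxn : shift^[n] x ∈ gapComponent α β V) : x ∈ gapComponent α β V := by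
  refine ⟨hx, fun _ z hz hxz hza => ?_, fun h1 => by simp [hx0] at h1⟩
  have hz' := agree_of_between hagree hxz hza
  refine h.bwd_iterate hz n (gapComponent_subset (α := α) (β := β) ?_)
  refine lexConvexIn_gapComponent.2 _ hxn _ hn _ (shift_mem_lexShift hz n) ?_ ?_
  · exact (le_iff_shift fun i hi => (hz' i hi).symm).1 hxz
  · exact (le_iff_shift fun i hi => by rw [hz' i hi, hagree i hi]).1 hza

/-- The gap component of a completely invariant proper set `V` does not reach up to `α`. Otherwise
`V` contains all points that start with `1`, and it grows along the orbit of `α` until it contains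
all points. -/
theorem max_notMem_gapComponent (hLW : LexWorld α β) (hs : shift β ≤ₗ shift α)
    {p : ℕ} (hp : 0 < p) (hαp : shift^[p] α = α) (h : IsSaturated α β V) :
    α ∉ gapComponent α β V := by
  classical
  intro hα
  have h1 : ∀ z ∈ lexShift α β, z 0 = true → z ∈ V := fun z hz hz0 =>
    hα.2.2 hLW.head_max z hz (oneMin_le hz hz0) (le_max hz)
  have hex : ∃ i, 0 < i ∧ shift^[i] α 0 = true := ⟨p, hp, by rw [hαp, hLW.head_max]⟩
  -- induction along the zeros that follow the first digit of `α`: every point below `σⁱ(α)` has a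
  -- preimage that starts with `1` or lies below `σⁱ⁻¹(α)`
  have key : ∀ i, 0 < i → i ≤ Nat.find hex → ∀ z ∈ lexShift α β, z ≤ₗ shift^[i] α → z ∈ V := by
    intro i hi0
    induction i, hi0 using Nat.le_induction with
    | base =>
      intro _ z hz hzα
      have := h1 (prepend [true] z) (prepend_true_mem hz hLW.head_min (by
        conv_rhs => rw [eq_prepend_of_head hLW.head_max]
        rw [prepend_le_prepend]; exact hzα)) (by simp)
      simpa using h.fwd _ this
    | succ i hi ih =>
      intro hle z hz hzα
      rcases le_total (toLex (shift β)) (toLex z) with hz' | hz'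
      · have hi0 : shift^[i] α 0 = false := by
          by_contra hc
          exact Nat.find_min hex (m := i) (by omega) ⟨hi, by simpa using hc⟩
        have := ih (by omega) (prepend [false] z) (prepend_false_mem hz hLW.head_max (by
          conv_lhs => rw [eq_prepend_of_head hLW.head_min]
          rwa [prepend_le_prepend])) (by
          rw [eq_prepend_of_head hi0, prepend_le_prepend, ← shift_succ]; exact hzα)
        simpa using h.fwd _ this
      · have := h1 (prepend [true] z) (prepend_true_mem hz hLW.head_min (by
          conv_rhs => rw [eq_prepend_of_head hLW.head_max]
          rw [prepend_le_prepend]; exact hz'.trans hs)) (by simp)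
        simpa using h.fwd _ this
  obtain ⟨x, hx, hxV⟩ := h.proper
  apply hxV
  cases hx0 : x 0
  · exact key _ (Nat.find_spec hex).1 le_rfl x hx (lt_of_head hx0 (Nat.find_spec hex).2).le
  · exact h1 x hx hx0

end component

theorem mirror_shift_head {x : BinSeq} {n : ℕ} :
    shift^[n] (mirror x) 0 = !(shift^[n] x 0) := by simp [shift_iterate, mirror]

/-- The gap component of a completely invariant set is a first return interval as soon as its two
halves come back across the gap. -/
theorem firstReturn_of_isSaturated {V : Set BinSeq} (hLW : LexWorld α β)
    (hs : shift β ≤ₗ shift α) {p q : ℕ} (hp : 0 < p) (hαp : shift^[p] α = α) (hq : 0 < q)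
    (hβq : shift^[q] β = β) (h : IsSaturated α β V) {x y : BinSeq} {n₀ m₀ : ℕ}
    (hx : x ∈ gapComponent α β V) (hx0 : x 0 = false)
    (hxn : shift^[n₀] x ∈ gapComponent α β V) (hxn' : shift^[n₀] x 0 = true)
    (hy : y ∈ gapComponent α β V) (hy0 : y 0 = true)
    (hym : shift^[m₀] y ∈ gapComponent α β V) (hym' : shift^[m₀] y 0 = false) :
    ∃ n ≤ n₀, ∃ m ≤ m₀, FirstReturn α β (gapComponent α β V) n m := by
  have mm : ∀ {z : BinSeq}, z ∈ gapComponent α β V →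
      mirror z ∈ gapComponent (mirror β) (mirror α) (mirror ⁻¹' V) :=
    fun hz => mirror_mem_gapComponent.2 hz
  obtain ⟨n, hn, hn1, hn2⟩ := exists_left_first_return hLW h hx hx0 hxn hxn'
  obtain ⟨m, hm, hm1, hm2⟩ := exists_left_first_return hLW.mirror h.mirror (x := mirror y)
    (n₀ := m₀) (mm hy) (by simp [mirror, hy0]) (by rw [shift_mirror]; exact mm hym)
    (by simp [mirror_shift_head, hym'])
  rw [← mirror_prepend_true, mirror_shift_head] at hm1
  have hm2' : ∀ z ∈ gapComponent α β V, z 0 = true →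
      (∀ i < m, z i = prepend [true] β i) ∧ shift^[m] z ∈ gapComponent α β V ∧
      ∀ i, 0 < i → i < m → shift^[i] z ∉ gapComponent α β V := by
    intro z hz hz0
    obtain ⟨h1, h2, h3⟩ := hm2 (mirror z) (mm hz) (by simp [mirror, hz0])
    rw [← mirror_prepend_true] at h1
    refine ⟨fun i hi => by simpa [mirror] using h1 i hi, ?_, fun i hi him hc => h3 i hi him ?_⟩
    · rw [shift_mirror] at h2
      exact mirror_mem_gapComponent.1 h2
    · rw [shift_mirror]; exact mm hc
  have ha := left_mem_gapComponent hLW h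
  have hb := right_mem_gapComponent hLW h
  refine ⟨n, hn, m, hm, ⟨⟨lexConvexIn_gapComponent, ha, hb, fun z hz hz0 => (hn2 z hz hz0).2.1,
    fun z hz hz0 => (hm2' z hz hz0).2.1, hn1, by simpa using hm1, ?_⟩,
    fun z hz hz0 => (hn2 z hz hz0).1, fun z hz hz0 => (hm2' z hz hz0).1,
    fun z hz hz0 => (hn2 z hz hz0).2.2, fun z hz hz0 => (hm2' z hz hz0).2.2,
    fun z hz hz0 => left_sat_gapComponent h (hn2 _ ha (by simp)).2.1 hz hz0, ?_,
    max_notMem_gapComponent hLW hs hp hαp h, ?_⟩⟩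
  · obtain ⟨z, hz, hzV⟩ := h.proper
    exact ⟨z, hz, fun k hk => hzV (h.bwd_iterate hz k (gapComponent_subset hk))⟩
  · intro z hz hz0 hagree hzm
    refine mirror_mem_gapComponent.1 (left_sat_gapComponent h.mirror (n := m) ?_
      (mirror_mem_lexShift.2 hz) (by simp [mirror, hz0]) ?_ ?_)
    · rw [← mirror_prepend_true, shift_mirror]
      exact mm (hm2' _ hb (by simp)).2.1
    · rw [← mirror_prepend_true]
      intro i hi
      simp [mirror, hagree i hi]
    · rw [shift_mirror]; exact mm hzm
  · intro hc
    refine max_notMem_gapComponent hLW.mirror ?_ hq ?_ h.mirror (mm hc)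
    · have h1 : shift (mirror α) = mirror (shift α) := shift_mirror 1 α
      have h2 : shift (mirror β) = mirror (shift β) := shift_mirror 1 β
      rw [h1, h2, mirror_le]; exact hs
    · rw [shift_mirror, hβq]

theorem ReturnInterval.pos_left {K : Set BinSeq} {n m : ℕ} (h : ReturnInterval α β K n m) :
    0 < n := by
  refine Nat.pos_of_ne_zero ?_
  rintro rfl
  simpa using h.left_cross

theorem ReturnInterval.pos_right {K : Set BinSeq} {n m : ℕ} (h : ReturnInterval α β K n m) :
    0 < m := by
  refine Nat.pos_of_ne_zero ?_
  rintro rfl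
  simpa using h.right_cross

/-- A return interval can be enlarged to a first return interval with no longer return times: the
gap component of the set of all points whose orbit visits the interval. -/
theorem ReturnInterval.exists_firstReturn {K : Set BinSeq} {n m : ℕ}
    (h : ReturnInterval α β K n m) (hLW : LexWorld α β)
    (hs : shift β ≤ₗ shift α) {p q : ℕ} (hp : 0 < p) (hαp : shift^[p] α = α) (hq : 0 < q)
    (hβq : shift^[q] β = β) :
    ∃ K', ∃ n' ≤ n, ∃ m' ≤ m, FirstReturn α β K' n' m' := by
  have hsat : IsSaturated α β {x | x ∈ lexShift α β ∧ ∃ k, shift^[k] x ∈ K} := by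
    refine ⟨fun x hx => hx.1, ?_, ?_, ?_, ?_, ?_⟩
    · rintro x ⟨hx, k, hk⟩
      refine ⟨shift_mem_lexShift hx 1, ?_⟩
      have : ∃ j, shift^[j + 1] x ∈ K := by
        cases k with
        | succ k => exact ⟨k, hk⟩
        | zero =>
          cases hx0 : x 0
          · exact ⟨n - 1, by rw [Nat.sub_add_cancel h.pos_left]; exact h.left_return x hk hx0⟩
          · exact ⟨m - 1, by rw [Nat.sub_add_cancel h.pos_right]; exact h.right_return x hk hx0⟩
      exact this
    · rintro x hx ⟨_, k, hk⟩
      exact ⟨hx, k + 1, hk⟩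
    · exact ⟨hLW.zeroMax_mem, 0, h.left_mem⟩
    · exact ⟨hLW.oneMin_mem, 0, h.right_mem⟩
    · obtain ⟨x, hx, hK⟩ := h.proper
      exact ⟨x, hx, fun hc => hc.2.elim fun k hk => hK k hk⟩
  have hsub := h.convex.subset_gapComponent hLW (V := {x | x ∈ lexShift α β ∧ ∃ k, shift^[k] x ∈ K})
    (fun x hx => ⟨h.convex.1 hx, 0, hx⟩) h.left_mem (left_mem_gapComponent hLW hsat)
  obtain ⟨n', hn, m', hm, hfr⟩ := firstReturn_of_isSaturated hLW hs hp hαp hq hβq hsat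
    (hsub h.left_mem) (by simp) (hsub (h.left_return _ h.left_mem (by simp))) h.left_cross
    (hsub h.right_mem) (by simp) (hsub (h.right_return _ h.right_mem (by simp))) h.right_cross
  exact ⟨_, n', hn, m', hm, hfr⟩

end

/-! ### The cyclic inequalities of the return words -/

section

variable {α β : BinSeq}

/-- A cyclic permutation of the first return word of `0α` that starts with `0` is smaller than that
word.  The inequality is strict, hence the word is primitive. -/
theorem shift_lt_of_cross {a A : BinSeq} {n : ℕ} (hmax : ∀ i, a i = false → shift^[i] a ≤ₗ a)
    (h0 : a 0 = false) (hA : ∀ i < n, A i = a i) (hAn : shift^[n] A = A) (hn : a n = true) {i : ℕ}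
    (hi : 0 < i) (hin : i < n) (hi0 : A i = false) : shift^[i] A <ₗ A := by
  have hle := hmax i (hA i hin ▸ hi0)
  have hdig : ∀ j, i + j < n → shift^[i] A j = shift^[i] a j := fun j hj => by
    rw [shift_iterate, shift_iterate, hA _ hj]
  by_cases hag : ∀ j < n - i, shift^[i] a j = a j
  · have h1 := (le_iff_shift hag).1 hle
    rw [shift_shift, Nat.sub_add_cancel hin.le] at h1
    have h2 := head_of_le h1 (by simpa [shift_iterate] using hn)
    rw [shift_iterate, Nat.add_zero] at h2
    refine lt_def.2 ⟨n - i, fun j hj => ?_, ?_, ?_⟩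
    · rw [hdig j (by omega), hag j hj, hA j (by omega)]
    · rw [shift_iterate, Nat.add_sub_cancel' hin.le]
      have := congrFun hAn 0
      rw [shift_iterate, Nat.add_zero] at this
      rw [this, hA 0 (by omega), h0]
    · rw [hA _ (by omega), h2]
  · have hne : shift^[i] a ≠ a := fun h => hag fun j _ => by rw [h]
    have hlt : shift^[i] a <ₗ a := lt_of_le_of_ne hle fun h => hne (toLex_inj.1 h)
    rcases lt_cases hlt (n - i) with ⟨d, hd, h1, h2, h3⟩ | ⟨h1, -⟩
    · refine lt_def.2 ⟨d, fun j hj => ?_, ?_, ?_⟩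
      · rw [hdig j (by omega), h1 j hj, hA j (by omega)]
      · rw [hdig d (by omega), h2]
      · rw [hA d (by omega), h3]
    · exact absurd h1 hag

/-- Order relations between the tails of `a = 0α` and `b = 1β` at positions inside their return
words, of lengths `n` and `m`. The last two fields say that neither return word is a proper suffix
of the other. -/
structure GapWords (a b : BinSeq) (n m : ℕ) : Prop where
  right_zero : ∀ i, 0 < i → i < m → b i = false → shift^[i] b <ₗ a
  left_one : ∀ i, 0 < i → i < n → a i = true → b <ₗ shift^[i] a
  right_one : ∀ i, 0 < i → i < m → b i = true → shift^[n] a <ₗ shift^[i] b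
  left_zero : ∀ i, 0 < i → i < n → a i = false → shift^[i] a <ₗ shift^[m] b
  right_ne : ∀ i, 0 < i → i + n = m → b i = false → ∃ j < n, b (i + j) ≠ a j
  left_ne : ∀ i, 0 < i → i + m = n → a i = true → ∃ j < m, a (i + j) ≠ b j

theorem GapWords.mirror {a b : BinSeq} {n m : ℕ} (h : GapWords a b n m) :
    GapWords (mirror b) (mirror a) m n where
  right_zero i hi hin h0 := by
    rw [shift_mirror, mirror_lt]; exact h.left_one i hi hin (by simpa [LexShift.mirror] using h0)
  left_one i hi hin h0 := by
    rw [shift_mirror, mirror_lt]; exact h.right_zero i hi hin (by simpa [LexShift.mirror] using h0)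
  right_one i hi hin h0 := by
    rw [shift_mirror, shift_mirror, mirror_lt]
    exact h.left_zero i hi hin (by simpa [LexShift.mirror] using h0)
  left_zero i hi hin h0 := by
    rw [shift_mirror, shift_mirror, mirror_lt]
    exact h.right_one i hi hin (by simpa [LexShift.mirror] using h0)
  right_ne i hi hin h0 := by
    simpa [LexShift.mirror] using h.left_ne i hi hin (by simpa [LexShift.mirror] using h0)
  left_ne i hi hin h0 := by
    simpa [LexShift.mirror] using h.right_ne i hi hin (by simpa [LexShift.mirror] using h0)

/-- `σⁱ(B)` exceeds `A`, and the first difference is at position `d`. -/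
def Exceeds (b A B : BinSeq) (m i d : ℕ) : Prop :=
  0 < i ∧ i < m ∧ b i = false ∧ (∀ j < d, shift^[i] B j = A j) ∧ shift^[i] B d = true ∧ A d = false

/-- Let `A` and `B` be the periodic sequences of the two return words. If a tail of `B` exceeds `A`,
then so does another one whose first difference comes earlier, for the pair or for its mirror image.
-/
theorem GapWords.descent {a b A B : BinSeq} {n m i d : ℕ} (h : GapWords a b n m) (hn : 0 < n)
    (hA : ∀ i < n, A i = a i) (hAn : shift^[n] A = A)
    (hB : ∀ i < m, B i = b i) (hBm : shift^[m] B = B) (hv : Exceeds b A B m i d) :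
    ∃ d' < d, (∃ i', Exceeds b A B m i' d') ∨
      ∃ i', Exceeds (LexShift.mirror a) (LexShift.mirror B) (LexShift.mirror A) n i' d' := by
  obtain ⟨hi, him, hi0, hag, hd1, hd0⟩ := hv
  have hlt := h.right_zero i hi him hi0
  have hdig : ∀ j, i + j < m → shift^[i] B j = shift^[i] b j := fun j hj => by
    rw [shift_iterate, shift_iterate, hB _ hj]
  -- the order of `a` and `b` forbids a first difference inside both words
  have hmin : n ≤ d ∨ m - i ≤ d := by
    by_contra! hc
    refine absurd hlt (lt_def.2 ⟨d, fun j hj => ?_, ?_, ?_⟩ : a <ₗ shift^[i] b).not_gt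
    · rw [← hdig j (by omega), hag j hj, hA j (by omega)]
    · rw [← hA d hc.1, hd0]
    · rw [← hdig d (by omega), hd1]
  rcases lt_trichotomy n (m - i) with hc | hc | hc
  · -- the word of `0α` is a prefix of the suffix of the word of `1β`: strip it
    have hagn : ∀ j < n, shift^[i] b j = a j := fun j hj => by
      rw [← hdig j (by omega), hag j (by omega), hA j hj]
    have hlt' := (lt_iff_shift hagn).1 hlt
    rw [shift_shift, Nat.add_comm] at hlt'
    have hhead : b (i + n) = false := by
      by_contra hc'
      exact lt_asymm hlt' (h.right_one (i + n) (by omega) (by omega) (by simpa using hc'))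
    refine ⟨d - n, by omega, Or.inl ⟨i + n, by omega, by omega, hhead, fun j hj => ?_, ?_, ?_⟩⟩
    · have := hag (n + j) (by omega)
      rw [← shift_iterate n A, hAn, shift_iterate] at this
      rw [shift_iterate, Nat.add_assoc, this]
    · rw [shift_iterate] at hd1 ⊢
      rw [Nat.add_assoc, Nat.add_sub_cancel' (by omega), hd1]
    · rw [← hAn, shift_iterate, Nat.add_sub_cancel' (by omega), hd0]
  · obtain ⟨j, hj, hne⟩ := h.right_ne i hi (by omega) hi0
    refine absurd ?_ hne
    rw [← hA j hj, ← hag j (by omega), shift_iterate, hB _ (by omega)]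
  · -- the suffix of the word of `1β` is a proper prefix of the word of `0α`: compare what follows
    set e := m - i with he
    have hage : ∀ j < e, shift^[i] b j = a j := fun j hj => by
      rw [← hdig j (by omega), hag j (by omega), hA j (by omega)]
    have hlt' := (lt_iff_shift hage).1 hlt
    rw [shift_shift, Nat.sub_add_cancel him.le] at hlt'
    have hhead : a e = true := by
      by_contra hc'
      exact lt_asymm hlt' (h.left_zero e (by omega) hc (by simpa using hc'))
    have hBe : shift^[e] (shift^[i] B) = B := by
      rw [shift_shift, Nat.sub_add_cancel him.le, hBm]
    refine ⟨d - e, by omega, Or.inr ⟨e, by omega, hc, by simp [LexShift.mirror, hhead],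
      fun j hj => ?_, ?_, ?_⟩⟩
    · rw [shift_iterate]
      simp only [LexShift.mirror]
      rw [← hag (e + j) (by omega), ← shift_iterate e (shift^[i] B), hBe]
    · rw [shift_iterate]
      simp only [LexShift.mirror]
      rw [Nat.add_sub_cancel' (by omega), hd0]; rfl
    · simp only [LexShift.mirror]
      rw [← hBe, shift_iterate e (shift^[i] B), Nat.add_sub_cancel' (by omega), hd1]; rfl

/-- The cyclic permutations of the word of `1β` that start with `0` are at most the word of `0α`, as
periodic sequences. -/
theorem GapWords.shift_le {a b A B : BinSeq} {n m : ℕ} (h : GapWords a b n m) (hn : 0 < n)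
    (hm : 0 < m) (hA : ∀ i < n, A i = a i) (hAn : shift^[n] A = A)
    (hB : ∀ i < m, B i = b i) (hBm : shift^[m] B = B) {i : ℕ} (hi : 0 < i) (him : i < m)
    (hi0 : b i = false) : shift^[i] B ≤ₗ A := by
  -- infinite descent on the position of the first difference
  have key : ∀ d, (¬ ∃ i, Exceeds b A B m i d) ∧
      ¬ ∃ i, Exceeds (LexShift.mirror a) (LexShift.mirror B) (LexShift.mirror A) n i d := by
    intro d
    induction d using Nat.strong_induction_on with
    | _ d ih =>
      constructor
      · rintro ⟨i, hv⟩
        obtain ⟨d', hd', hv' | hv'⟩ := h.descent hn hA hAn hB hBm hv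
        · exact (ih d' hd').1 hv'
        · exact (ih d' hd').2 hv'
      · rintro ⟨i, hv⟩
        obtain ⟨d', hd', hv' | hv'⟩ := h.mirror.descent hm (A := LexShift.mirror B)
          (B := LexShift.mirror A) (fun i hi => by simp [LexShift.mirror, hB i hi])
          (by rw [shift_mirror, hBm]) (fun i hi => by simp [LexShift.mirror, hA i hi])
          (by rw [shift_mirror, hAn]) hv
        · exact (ih d' hd').2 hv'
        · simp only [mirror_mirror] at hv'
          exact (ih d' hd').1 hv'
  by_contra hc
  obtain ⟨d, hd, h0, h1⟩ := lt_def.1 (not_le.1 hc)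
  exact (key d).1 ⟨i, hi, him, hi0, fun j hj => (hd j hj).symm, h1, h0⟩

section firstReturn

variable {K : Set BinSeq} {n m : ℕ}

/-- Points outside `K` that start with `0` lie below all of `K`. -/
theorem FirstReturn.lt_of_notMem (h : FirstReturn α β K n m) {z y : BinSeq}
    (hz : z ∈ lexShift α β) (hzK : z ∉ K) (hz0 : z 0 = false) (hy : y ∈ K) : z <ₗ y := by
  by_contra hc
  exact hzK (h.convex.2 _ hy _ h.left_mem _ hz (not_lt.1 hc) (le_zeroMax hz hz0))

/-- Points outside `K` that start with `1` lie above all of `K`. -/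
theorem FirstReturn.lt_of_notMem' (h : FirstReturn α β K n m) {z y : BinSeq}
    (hz : z ∈ lexShift α β) (hzK : z ∉ K) (hz0 : z 0 = true) (hy : y ∈ K) : y <ₗ z := by
  by_contra hc
  exact hzK (h.convex.2 _ h.right_mem _ hy _ hz (oneMin_le hz hz0) (not_lt.1 hc))

theorem FirstReturn.left_shift_mem (h : FirstReturn α β K n m) :
    shift^[n] (prepend [false] α) ∈ K := h.left_return _ h.left_mem (by simp)

theorem FirstReturn.right_shift_mem (h : FirstReturn α β K n m) :
    shift^[m] (prepend [true] β) ∈ K := h.right_return _ h.right_mem (by simp)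

theorem FirstReturn.one_lt_left (h : FirstReturn α β K n m) : 1 < n := by
  have := h.pos_left
  by_contra hc
  obtain rfl : n = 1 := by omega
  have := h.left_shift_mem
  simp only [Function.iterate_one, shift_prepend_singleton] at this
  exact h.max_notMem this

theorem FirstReturn.one_lt_right (h : FirstReturn α β K n m) : 1 < m := by
  have := h.pos_right
  by_contra hc
  obtain rfl : m = 1 := by omega
  have := h.right_shift_mem
  simp only [Function.iterate_one, shift_prepend_singleton] at this
  exact h.min_notMem this

/-- Before their first return, the orbits of `0α` and `1β` stay outside `K`, hence below it on the
left and above it on the right. -/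
theorem FirstReturn.gapWords (h : FirstReturn α β K n m) (hLW : LexWorld α β) :
    GapWords (prepend [false] α) (prepend [true] β) n m := by
  have ha := hLW.zeroMax_mem
  have hb := hLW.oneMin_mem
  have hl : ∀ i, 0 < i → i < n → shift^[i] (prepend [false] α) ∉ K :=
    h.left_first _ h.left_mem (by simp)
  have hr : ∀ i, 0 < i → i < m → shift^[i] (prepend [true] β) ∉ K :=
    h.right_first _ h.right_mem (by simp)
  have hd : ∀ (x : BinSeq) i, shift^[i] x 0 = x i := fun x i => by simp [shift_iterate]
  refine ⟨fun i h1 h2 h3 => ?_, fun i h1 h2 h3 => ?_, fun i h1 h2 h3 => ?_, fun i h1 h2 h3 => ?_,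
    fun i h1 h2 h3 => ?_, fun i h1 h2 h3 => ?_⟩
  · exact h.lt_of_notMem (shift_mem_lexShift hb i) (hr i h1 h2) (by rw [hd, h3]) h.left_mem
  · exact h.lt_of_notMem' (shift_mem_lexShift ha i) (hl i h1 h2) (by rw [hd, h3]) h.right_mem
  · exact h.lt_of_notMem' (shift_mem_lexShift hb i) (hr i h1 h2) (by rw [hd, h3]) h.left_shift_mem
  · exact h.lt_of_notMem (shift_mem_lexShift ha i) (hl i h1 h2) (by rw [hd, h3]) h.right_shift_mem
  · by_contra! hc
    have hn := h.pos_left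
    refine hr i h1 (by omega) (h.left_sat _ (shift_mem_lexShift hb i) (by rw [hd, h3])
      (fun j hj => by rw [shift_iterate, hc j hj]) ?_)
    rw [shift_shift, Nat.add_comm, h2]
    exact h.right_shift_mem
  · by_contra! hc
    have hm := h.pos_right
    refine hl i h1 (by omega) (h.right_sat _ (shift_mem_lexShift ha i) (by rw [hd, h3])
      (fun j hj => by rw [shift_iterate, hc j hj]) ?_)
    rw [shift_shift, Nat.add_comm, h2]
    exact h.left_shift_mem

end firstReturn

theorem ones_shift_period {x : BinSeq} {p : ℕ} (h : shift^[p] x = x) (i : ℕ) :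
    ones (shift^[i] x) p = ones x p := by
  have h1 := ones_add x i p
  have h2 := ones_add x p i
  rw [h] at h2
  rw [Nat.add_comm] at h2
  omega

/-- If the first return words are cyclic permutations of each other, then there is a larger return
interval with shorter return times, unless all points have the same frequency of ones. -/
theorem FirstReturn.exists_shorter {K : Set BinSeq} {n i : ℕ} (h : FirstReturn α β K n n)
    (hLW : LexWorld α β) (hU : Unbalanced (lexShift α β)) {A B : BinSeq}
    (hA : ∀ i < n, A i = prepend [false] α i)
    (hB : ∀ i < n, B i = prepend [true] β i) (hBn : shift^[n] B = B) (hi : 0 < i) (hin : i < n)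
    (hAB : shift^[i] B = A) : ∃ K', ReturnInterval α β K' (n - i) i := by
  set a := prepend [false] α with ha
  set b := prepend [true] β with hb
  have haX : a ∈ lexShift α β := hLW.zeroMax_mem
  have hbX : b ∈ lexShift α β := hLW.oneMin_mem
  have ha0 : a 0 = false := by simp [ha]
  have hb0 : b 0 = true := by simp [hb]
  obtain ⟨e, he⟩ : ∃ e, e = n - i := ⟨_, rfl⟩
  rw [← he]
  have hei : e + i = n := by omega
  have hie : i + e = n := by omega
  have hBA : shift^[e] A = B := by rw [← hAB, shift_shift, hei, hBn]
  have hagA : ∀ j < e, shift^[i] b j = a j := fun j hj => by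
    rw [shift_iterate, ← hB _ (by omega), ← shift_iterate i B, hAB, hA j (by omega)]
  have hagB : ∀ j < i, shift^[e] a j = b j := fun j hj => by
    rw [shift_iterate, ← hA _ (by omega), ← shift_iterate e A, hBA, hB j (by omega)]
  have hτ := h.left_shift_mem
  have hτ' := h.right_shift_mem
  rw [← ha] at hτ
  rw [← hb] at hτ'
  have hib0 : shift^[i] b 0 = false := by rw [hagA 0 (by omega), ha0]
  have hea1 : shift^[e] a 0 = true := by rw [hagB 0 (by omega), hb0]
  have hibK : shift^[i] b ∉ K := h.right_first _ h.right_mem (by simp) i hi hin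
  have heaK : shift^[e] a ∉ K := h.left_first _ h.left_mem (by simp) e (by omega) (by omega)
  have hlow : ∀ y ∈ K, shift^[i] b <ₗ y := fun y hy =>
    h.lt_of_notMem (shift_mem_lexShift hbX i) hibK hib0 hy
  have hupp : ∀ y ∈ K, y <ₗ shift^[e] a := fun y hy =>
    h.lt_of_notMem' (shift_mem_lexShift haX e) heaK hea1 hy
  -- the order interval from `σⁱ(1β)` to `σᵉ(0α)`: at its ends the orbits of `1β` and `0α` begin to
  -- run through the word of the other one
  set K' : Set BinSeq := {x | x ∈ lexShift α β ∧ shift^[i] b ≤ₗ x ∧ x ≤ₗ shift^[e] a} with hK'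
  have hKK' : K ⊆ K' := fun y hy => ⟨h.convex.1 hy, (hlow y hy).le, (hupp y hy).le⟩
  have left_ag : ∀ x ∈ K', x 0 = false → ∀ j < e, x j = a j := by
    intro x hx hx0 j hj
    rw [agree_of_between hagA hx.2.1 (le_zeroMax hx.1 hx0) j hj, hagA j hj]
  have right_ag : ∀ x ∈ K', x 0 = true → ∀ j < i, x j = b j := by
    intro x hx hx0 j hj
    exact agree_of_between (fun j hj => (hagB j hj).symm) (oneMin_le hx.1 hx0) hx.2.2 j hj
  have left_ret : ∀ x ∈ K', x 0 = false →
      shift^[n] b ≤ₗ shift^[e] x ∧ shift^[e] x ≤ₗ shift^[e] a := by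
    intro x hx hx0
    have hag := left_ag x hx hx0
    constructor
    · have := (le_iff_shift fun j hj => by rw [hagA j hj, hag j hj]).1 hx.2.1
      rwa [shift_shift, hei] at this
    · exact (le_iff_shift hag).1 (le_zeroMax hx.1 hx0)
  have right_ret : ∀ x ∈ K', x 0 = true →
      shift^[i] b ≤ₗ shift^[i] x ∧ shift^[i] x ≤ₗ shift^[n] a := by
    intro x hx hx0
    have hag := right_ag x hx hx0
    constructor
    · exact (le_iff_shift fun j hj => (hag j hj).symm).1 (oneMin_le hx.1 hx0)
    · have := (le_iff_shift fun j hj => by rw [hagB j hj, hag j hj]).1 hx.2.2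
      rwa [shift_shift, hie] at this
  by_cases hproper : ∃ x ∈ lexShift α β, ∀ k, shift^[k] x ∉ K'
  · refine ⟨K', ⟨fun x hx => hx.1, fun x hx y hy z hz hxz hzy =>
      ⟨hz, hx.2.1.trans hxz, hzy.trans hy.2.2⟩⟩, hKK' h.left_mem, hKK' h.right_mem,
      fun x hx hx0 => ?_, fun x hx hx0 => ?_, hea1, hib0, hproper⟩
    · obtain ⟨h1, h2⟩ := left_ret x hx hx0
      exact ⟨shift_mem_lexShift hx.1 e, (hlow _ hτ').le.trans h1, h2⟩
    · obtain ⟨h1, h2⟩ := right_ret x hx hx0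
      exact ⟨shift_mem_lexShift hx.1 i, h1, h2.trans (hupp _ hτ).le⟩
  -- otherwise every point eventually runs through the two return words
  exfalso
  push Not at hproper
  have hones : ones b n = ones a n := by
    rw [← ones_congr hA, ← ones_congr hB, ← hAB, ones_shift_period hBn]
  have hfreqK : ∀ x ∈ K, HasFrequency n (ones a n) x := by
    intro x hx
    refine hasFrequency_of_multiples h.pos_left fun k => ?_
    suffices hs : shift^[n * k] x ∈ K ∧ ones x (n * k) = ones a n * k from hs.2
    induction k with
    | zero => exact ⟨hx, by simp⟩
    | succ k ih =>
      have hstep : shift^[n] (shift^[n * k] x) ∈ K ∧ ones (shift^[n * k] x) n = ones a n := by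
        cases h0 : shift^[n * k] x 0
        · exact ⟨h.left_return _ ih.1 h0, ones_congr (h.left_agree _ ih.1 h0)⟩
        · exact ⟨h.right_return _ ih.1 h0, hones ▸ ones_congr (h.right_agree _ ih.1 h0)⟩
      rw [shift_shift, Nat.add_comm] at hstep
      rw [Nat.mul_succ, ones_add, hstep.2, ih.2]
      exact ⟨hstep.1, by ring⟩
  have hfreqL : ∀ x ∈ K', x 0 = false → HasFrequency n (ones a n) x := by
    intro x hx hx0
    by_cases hk : ∃ k, shift^[k] x ∈ K
    · obtain ⟨k, hk⟩ := hk
      exact (hfreqK _ hk).of_shift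
    push Not at hk
    refine hasFrequency_of_multiples h.pos_left fun k => ?_
    suffices hs : (shift^[n * k] x ∈ K' ∧ shift^[n * k] x 0 = false) ∧
      ones x (n * k) = ones a n * k from hs.2
    induction k with
    | zero => exact ⟨⟨hx, hx0⟩, by simp⟩
    | succ k ih =>
      obtain ⟨⟨hy, hy0⟩, hyo⟩ := ih
      set y := shift^[n * k] x with hydef
      have hyK : ∀ j, shift^[j] y ∉ K := fun j => by rw [hydef, shift_shift]; exact hk _
      obtain ⟨h1, h2⟩ := left_ret y hy hy0
      have hyX := shift_mem_lexShift hy.1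
      have hye1 : shift^[e] y 0 = true := by
        by_contra hc
        exact hyK e (h.convex.2 _ hτ' _ h.left_mem _ (hyX e) h1
          (le_zeroMax (hyX e) (by simpa using hc)))
      have hyeK' : shift^[e] y ∈ K' := ⟨hyX e, (hlow _ hτ').le.trans h1, h2⟩
      obtain ⟨h3, h4⟩ := right_ret _ hyeK' hye1
      rw [shift_shift, hie] at h3 h4
      have hyn0 : shift^[n] y 0 = false := by
        by_contra hc
        exact hyK n (h.convex.2 _ h.right_mem _ hτ _ (hyX n)
          (oneMin_le (hyX n) (by simpa using hc)) h4)
      have hag : ones y n = ones a n := by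
        refine ones_congr fun j hj => ?_
        rcases lt_or_ge j e with hj' | hj'
        · exact left_ag y hy hy0 j hj'
        · obtain ⟨l, rfl⟩ := Nat.exists_eq_add_of_le hj'
          rw [← shift_iterate e y, right_ag _ hyeK' hye1 l (by omega), ← hagB l (by omega),
            shift_iterate e a]
      rw [Nat.mul_succ, ones_add, hyo, ← hydef, hag, Nat.add_comm (n * k), ← shift_shift, ← hydef]
      exact ⟨⟨⟨hyX n, h3, h4.trans (hupp _ hτ).le⟩, hyn0⟩, by ring⟩
  refine not_unbalanced_of_hasFrequency (c := ones a n) h.pos_left (fun x hx => ?_) hU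
  obtain ⟨k, hk⟩ := hproper x hx
  refine HasFrequency.of_shift (k := k) ?_
  cases h0 : shift^[k] x 0
  · exact hfreqL _ hk h0
  · refine HasFrequency.of_shift (k := i) ?_
    obtain ⟨h1, h2⟩ := right_ret _ hk h0
    have hX := shift_mem_lexShift hk.1 i
    cases h0' : shift^[i] (shift^[k] x) 0
    · exact hfreqL _ ⟨hX, h1, h2.trans (hupp _ hτ).le⟩ h0'
    · exact hfreqK _ (h.convex.2 _ h.right_mem _ hτ _ hX (oneMin_le hX h0') h2)

end

/-! ### Infinite concatenations of two words -/

section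

variable {ω ν : List Bool} {s t x y : BinSeq}

/-- The word substituted for the digit `c`. -/
abbrev block (ω ν : List Bool) (c : Bool) : List Bool := if c then ν else ω

@[simp] theorem substWord_zero : substWord ω ν s 0 = [] := rfl

theorem substWord_succ (n : ℕ) :
    substWord ω ν s (n + 1) = substWord ω ν s n ++ block ω ν (s n) := by
  simp [substWord, List.range_succ]

theorem substWord_add (m n : ℕ) :
    substWord ω ν s (m + n) = substWord ω ν s m ++ substWord ω ν (shift^[m] s) n := by
  induction n with
  | zero => simp
  | succ n ih =>
    rw [← Nat.add_assoc, substWord_succ, ih, substWord_succ, List.append_assoc, shift_iterate]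

theorem substWord_one : substWord ω ν s 1 = block ω ν (s 0) := by
  simp [substWord_succ]

theorem substWord_succ' (n : ℕ) :
    substWord ω ν s (n + 1) = block ω ν (s 0) ++ substWord ω ν (shift s) n := by
  rw [Nat.add_comm, substWord_add, substWord_one]; rfl

theorem substWord_congr {n : ℕ} (h : ∀ i < n, s i = t i) :
    substWord ω ν s n = substWord ω ν t n := by
  induction n with
  | zero => rfl
  | succ n ih => rw [substWord_succ, substWord_succ, ih fun i hi => h i (by omega), h n (by omega)]

theorem block_pos (hω : ω ≠ []) (hν : ν ≠ []) (c : Bool) : 0 < (block ω ν c).length := by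
  cases c <;> simpa [block, List.length_pos_iff]

theorem le_length_substWord (hω : ω ≠ []) (hν : ν ≠ []) (n : ℕ) :
    n ≤ (substWord ω ν s n).length := by
  induction n with
  | zero => simp
  | succ n ih =>
    rw [substWord_succ, List.length_append]
    have := block_pos hω hν (s n)
    omega

theorem IsConcat.eq_prepend (h : IsConcat ω ν s x) (n : ℕ) :
    x = prepend (substWord ω ν s n) (shift^[(substWord ω ν s n).length] x) :=
  occursAt_zero_iff_prepend.1 (h n)

theorem occursAt_append {u v : List Bool} :
    OccursAt (u ++ v) x 0 ↔ OccursAt u x 0 ∧ OccursAt v (shift^[u.length] x) 0 := by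
  constructor
  · intro h
    refine ⟨fun i hi => ?_, fun i hi => ?_⟩
    · rw [h i (by simp; omega), List.getElem_append_left hi]
    · have := h (u.length + i) (by simp; omega)
      rw [List.getElem_append_right (by omega)] at this
      simpa [shift_iterate] using this
  · rintro ⟨h1, h2⟩ i hi
    rcases lt_or_ge i u.length with h | h
    · rw [h1 i h, List.getElem_append_left h]
    · rw [List.getElem_append_right h, ← h2 (i - u.length) (by simp at hi; omega)]
      rw [shift_iterate]; congr 1; omega

theorem IsConcat.shift (h : IsConcat ω ν s x) (n : ℕ) :
    IsConcat ω ν (shift^[n] s) (shift^[(substWord ω ν s n).length] x) := by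
  intro k
  have := h (n + k)
  rw [substWord_add, occursAt_append] at this
  exact this.2

/-- Coinduction principle for infinite concatenations. -/
theorem isConcat_of_step (Q : BinSeq → BinSeq → Prop)
    (hQ : ∀ s x, Q s x → OccursAt (block ω ν (s 0)) x 0 ∧
      Q (LexShift.shift s) (LexShift.shift^[(block ω ν (s 0)).length] x)) (h : Q s x) :
    IsConcat ω ν s x := by
  intro n
  induction n generalizing s x with
  | zero => intro i hi; simp at hi
  | succ n ih =>
    rw [substWord_succ', occursAt_append]
    exact ⟨(hQ s x h).1, ih (hQ s x h).2⟩

/-- If every element of `Q` starts with `ω` or `ν`, according to its first digit, and stays in `Q`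
when this word is removed, then the elements of `Q` are concatenations of `ω` and `ν`. -/
theorem exists_isConcat (Q : Set BinSeq)
    (hQ : ∀ x ∈ Q, OccursAt (block ω ν (x 0)) x 0 ∧
      LexShift.shift^[(block ω ν (x 0)).length] x ∈ Q) (hx : x ∈ Q) :
    ∃ s, s 0 = x 0 ∧ IsConcat ω ν s x := by
  let f : BinSeq → BinSeq := fun x => LexShift.shift^[(block ω ν (x 0)).length] x
  refine ⟨fun k => f^[k] x 0, rfl,
    isConcat_of_step (fun s x => x ∈ Q ∧ ∀ k, s k = f^[k] x 0) ?_ ⟨hx, fun k => rfl⟩⟩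
  rintro s x ⟨hx, hs⟩
  have h0 : s 0 = x 0 := hs 0
  rw [h0]
  exact ⟨(hQ x hx).1, (hQ x hx).2, fun k => hs (k + 1)⟩

theorem block_getElem_zero (hω : periodicSeq ω 0 = false) (hν : periodicSeq ν 0 = true) (c : Bool)
    (hc : 0 < (block ω ν c).length) : (block ω ν c)[0] = c := by
  rw [← periodicSeq_lt hc]
  cases c
  · exact hω
  · exact hν

theorem IsConcat.head (hω : periodicSeq ω 0 = false) (hω' : ω ≠ []) (hν : periodicSeq ν 0 = true)
    (h : IsConcat ω ν s x) : x 0 = s 0 := by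
  have hν' : ν ≠ [] := by rintro rfl; simp [periodicSeq] at hν
  have h1 := h 1 0 (by rw [substWord_one]; exact block_pos hω' hν' _)
  simp only [substWord_one, Nat.zero_add] at h1
  rw [h1, block_getElem_zero hω hν]

/-- Substituting a word that starts with `0` for `0` and a word that starts with `1` for `1`
preserves the order. -/
theorem IsConcat.lt (hω : periodicSeq ω 0 = false) (hω' : ω ≠ []) (hν : periodicSeq ν 0 = true)
    (h : IsConcat ω ν s x) (h' : IsConcat ω ν t y) (hst : s <ₗ t) : x <ₗ y := by
  obtain ⟨i, hi, h0, h1⟩ := lt_def.1 hst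
  have hw : substWord ω ν s i = substWord ω ν t i := substWord_congr hi
  have hx := h.eq_prepend i
  have hy := h'.eq_prepend i
  rw [hx, hy, hw, prepend_lt_prepend]
  refine lt_of_head ?_ ?_
  · rw [← hw, (h.shift i).head hω hω' hν, shift_iterate]; simpa using h0
  · rw [(h'.shift i).head hω hω' hν, shift_iterate]; simpa using h1

theorem IsConcat.unique (hω : ω ≠ []) (hν : ν ≠ []) (h : IsConcat ω ν s x)
    (h' : IsConcat ω ν s y) : x = y := by
  funext i
  have hl := le_length_substWord (s := s) hω hν (i + 1)
  have h1 := h (i + 1) i (by omega)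
  have h2 := h' (i + 1) i (by omega)
  simp only [Nat.zero_add] at h1 h2
  rw [h1, h2]

theorem IsConcat.le (hω : periodicSeq ω 0 = false) (hω' : ω ≠ []) (hν : periodicSeq ν 0 = true)
    (h : IsConcat ω ν s x) (h' : IsConcat ω ν t y) (hst : s ≤ₗ t) : x ≤ₗ y := by
  have hν' : ν ≠ [] := by rintro rfl; simp [periodicSeq] at hν
  rcases hst.lt_or_eq with h1 | h1
  · exact (h.lt hω hω' hν h' h1).le
  · obtain rfl := toLex_inj.1 h1
    rw [h.unique hω' hν' h']

theorem isConcat_periodicSeq (c : Bool) :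
    IsConcat ω ν (fun _ => c) (periodicSeq (block ω ν c)) := by
  refine isConcat_of_step (fun s x => s = (fun _ => c) ∧ x = periodicSeq (block ω ν c)) ?_
    ⟨rfl, rfl⟩
  rintro s x ⟨rfl, rfl⟩
  refine ⟨?_, rfl, shift_periodicSeq _⟩
  rw [occursAt_zero_iff_prepend, shift_periodicSeq, periodicSeq_eq_prepend]

theorem false_le (s : BinSeq) : (fun _ => false) ≤ₗ s := by
  by_contra hc
  obtain ⟨i, -, -, h⟩ := lt_def.1 (not_le.1 hc)
  simp at h

theorem le_true (s : BinSeq) : s ≤ₗ fun _ => true := by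
  by_contra hc
  obtain ⟨i, -, h, -⟩ := lt_def.1 (not_le.1 hc)
  simp at h

theorem IsConcat.left_le (hω : periodicSeq ω 0 = false) (hω' : ω ≠ [])
    (hν : periodicSeq ν 0 = true) (h : IsConcat ω ν s x) : periodicSeq ω ≤ₗ x :=
  (isConcat_periodicSeq false).le hω hω' hν h (false_le s)

theorem IsConcat.le_right (hω : periodicSeq ω 0 = false) (hω' : ω ≠ [])
    (hν : periodicSeq ν 0 = true) (h : IsConcat ω ν s x) : x ≤ₗ periodicSeq ν :=
  h.le hω hω' hν (isConcat_periodicSeq true) (le_true s)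

/-- Every position lies in one of the blocks. -/
theorem exists_block (hω : ω ≠ []) (hν : ν ≠ []) (s : BinSeq) (N : ℕ) :
    ∃ k r, N = (substWord ω ν s k).length + r ∧ r < (block ω ν (s k)).length := by
  classical
  have hex : ∃ k, N < (substWord ω ν s k).length :=
    ⟨N + 1, le_length_substWord hω hν _⟩
  obtain ⟨k, hk⟩ : ∃ k, Nat.find hex = k + 1 := by
    refine Nat.exists_eq_succ_of_ne_zero fun h0 => ?_
    have := Nat.find_spec hex
    rw [h0] at this
    simp at this
  have h1 := Nat.find_min hex (m := k) (by omega)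
  have h2 := Nat.find_spec hex
  rw [hk, substWord_succ, List.length_append] at h2
  exact ⟨k, N - (substWord ω ν s k).length, by omega, by omega⟩

theorem isConcat_cons (h : IsConcat ω ν s x) (c : Bool) :
    IsConcat ω ν (prepend [c] s) (prepend (block ω ν c) x) := by
  intro n
  cases n with
  | zero => intro i hi; simp at hi
  | succ n =>
    rw [substWord_succ', occursAt_append]
    simp only [prepend_singleton_zero, shift_prepend_singleton, shift_prepend]
    exact ⟨fun i hi => by rw [Nat.zero_add, prepend_lt hi], h n⟩

theorem substWord_getElem {m n i : ℕ} (hmn : m ≤ n) (hi : i < (substWord ω ν s m).length) :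
    (substWord ω ν s n)[i]'(by
      obtain ⟨k, rfl⟩ := Nat.exists_eq_add_of_le hmn
      rw [substWord_add, List.length_append]; omega) = (substWord ω ν s m)[i] := by
  obtain ⟨k, rfl⟩ := Nat.exists_eq_add_of_le hmn
  simp only [substWord_add]
  rw [List.getElem_append_left hi]

/-- The infinite concatenation of `ω` and `ν` in the order prescribed by `s`. -/
def concat (ω ν : List Bool) (s : BinSeq) : BinSeq :=
  fun n => (substWord ω ν s (n + 1)).getD n false

theorem isConcat_concat (hω : ω ≠ []) (hν : ν ≠ []) (s : BinSeq) :
    IsConcat ω ν s (concat ω ν s) := by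
  intro n i hi
  have h1 := le_length_substWord (s := s) hω hν (i + 1)
  simp only [Nat.zero_add, concat]
  rw [List.getD_eq_getElem _ _ (by omega)]
  rcases le_total n (i + 1) with h | h
  · exact substWord_getElem h hi
  · exact (substWord_getElem h (by omega)).symm

/-! ### Cyclic permutations -/

theorem periodicSeq_rotate (w : List Bool) (n : ℕ) :
    periodicSeq (w.rotate n) = LexShift.shift^[n] (periodicSeq w) := by
  funext k
  rw [shift_iterate]
  rcases Nat.eq_zero_or_pos w.length with h | h
  · obtain rfl := List.length_eq_zero_iff.1 h
    simp [periodicSeq]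
  · have h1 := Nat.mod_lt k h
    have h2 := Nat.mod_lt (n + k) h
    simp only [periodicSeq, List.length_rotate]
    rw [List.getD_eq_getElem _ _ (by simpa using h1), List.getD_eq_getElem _ _ h2,
      List.getElem_rotate]
    congr 1
    rw [Nat.mod_add_mod, Nat.add_comm]

theorem periodicSeq_lt_of_lt {u v : List Bool} (h : u.length = v.length) (huv : u < v) :
    periodicSeq u <ₗ periodicSeq v := by
  rcases List.lt_iff_exists.1 huv with ⟨-, h'⟩ | ⟨i, h1, h2, h3, h4⟩
  · omega
  · refine lt_def.2 ⟨i, fun j hj => ?_, ?_, ?_⟩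
    · rw [periodicSeq_lt (by omega), periodicSeq_lt (by omega)]
      exact h3 j hj
    all_goals rw [periodicSeq_lt (by assumption)]; simp only [Bool.lt_iff] at h4
    exacts [h4.1, h4.2]

/-- Cyclic permutations of a word can be compared as periodic sequences, where they are tails of a
single sequence. -/
theorem le_iff_periodicSeq_le {u v : List Bool} (h : u.length = v.length) :
    u ≤ v ↔ periodicSeq u ≤ₗ periodicSeq v := by
  constructor
  · intro huv
    rcases huv.lt_or_eq with h1 | rfl
    · exact (periodicSeq_lt_of_lt h h1).le
    · exact le_rfl
  · intro huv
    by_contra hc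
    exact absurd (periodicSeq_lt_of_lt h.symm (not_le.1 hc)) (not_lt.2 huv)

theorem head?_eq_some_iff {w : List Bool} {b : Bool} :
    w.head? = some b ↔ w ≠ [] ∧ periodicSeq w 0 = b := by
  cases w <;> simp [periodicSeq]

theorem exists_rotation_iff {w : List Bool} {v : List Bool} :
    v ~r w ↔ ∃ n, w.rotate n = v := by
  rw [List.isRotated_comm]; rfl

theorem IsZeroMax.le {u w : List Bool} (h : IsZeroMax u w) {i : ℕ}
    (hi : LexShift.shift^[i] (periodicSeq w) 0 = false) :
    LexShift.shift^[i] (periodicSeq w) ≤ₗ periodicSeq u := by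
  have hw : w ≠ [] := by
    rintro rfl
    have := List.isRotated_nil_iff.1 h.1
    exact (head?_eq_some_iff.1 h.2.1).1 this
  rw [← periodicSeq_rotate] at hi ⊢
  rw [← le_iff_periodicSeq_le (by rw [List.length_rotate, h.1.perm.length_eq])]
  exact h.2.2 _ (exists_rotation_iff.2 ⟨i, rfl⟩)
    (head?_eq_some_iff.2 ⟨by simpa [List.rotate_eq_nil_iff] using hw, hi⟩)

theorem IsOneMin.le {u w : List Bool} (h : IsOneMin u w) {i : ℕ}
    (hi : LexShift.shift^[i] (periodicSeq w) 0 = true) :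
    periodicSeq u ≤ₗ LexShift.shift^[i] (periodicSeq w) := by
  have hw : w ≠ [] := by
    rintro rfl
    simp [shift_iterate, periodicSeq] at hi
  rw [← periodicSeq_rotate] at hi ⊢
  rw [← le_iff_periodicSeq_le (by rw [List.length_rotate, h.1.perm.length_eq])]
  exact h.2.2 _ (exists_rotation_iff.2 ⟨i, rfl⟩)
    (head?_eq_some_iff.2 ⟨by simpa [List.rotate_eq_nil_iff] using hw, hi⟩)

theorem isZeroMax_self_iff {w : List Bool} :
    IsZeroMax w w ↔ w ≠ [] ∧ periodicSeq w 0 = false ∧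
      ∀ i, LexShift.shift^[i] (periodicSeq w) 0 = false →
        LexShift.shift^[i] (periodicSeq w) ≤ₗ periodicSeq w := by
  constructor
  · intro h
    have h1 := head?_eq_some_iff.1 h.2.1
    exact ⟨h1.1, h1.2, fun i hi => h.le hi⟩
  · rintro ⟨h0, h1, h2⟩
    refine ⟨List.IsRotated.refl w, head?_eq_some_iff.2 ⟨h0, h1⟩, fun v hv hv0 => ?_⟩
    obtain ⟨n, rfl⟩ := exists_rotation_iff.1 hv
    rw [le_iff_periodicSeq_le (by simp), periodicSeq_rotate]
    exact h2 n (by rw [← periodicSeq_rotate]; exact (head?_eq_some_iff.1 hv0).2)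

theorem isOneMin_self_iff {w : List Bool} :
    IsOneMin w w ↔ periodicSeq w 0 = true ∧
      ∀ i, LexShift.shift^[i] (periodicSeq w) 0 = true →
        periodicSeq w ≤ₗ LexShift.shift^[i] (periodicSeq w) := by
  constructor
  · intro h
    have h1 := head?_eq_some_iff.1 h.2.1
    exact ⟨h1.2, fun i hi => h.le hi⟩
  · rintro ⟨h1, h2⟩
    have h0 : w ≠ [] := by rintro rfl; simp [periodicSeq] at h1
    refine ⟨List.IsRotated.refl w, head?_eq_some_iff.2 ⟨h0, h1⟩, fun v hv hv0 => ?_⟩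
    obtain ⟨n, rfl⟩ := exists_rotation_iff.1 hv
    rw [le_iff_periodicSeq_le (by simp), periodicSeq_rotate]
    exact h2 n (by rw [← periodicSeq_rotate]; exact (head?_eq_some_iff.1 hv0).2)

theorem finite_rotations (w : List Bool) (b : Bool) :
    {v : List Bool | v ~r w ∧ v.head? = some b}.Finite :=
  (List.finite_length_eq Bool w.length).subset fun _ hv => hv.1.perm.length_eq

theorem exists_isZeroMax_iff {w : List Bool} (hw : w ≠ []) {z : BinSeq} :
    (∃ u, IsZeroMax u w ∧ periodicSeq u <ₗ z) ↔
      (∃ i, LexShift.shift^[i] (periodicSeq w) 0 = false) ∧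
      ∀ i, LexShift.shift^[i] (periodicSeq w) 0 = false →
        LexShift.shift^[i] (periodicSeq w) <ₗ z := by
  constructor
  · rintro ⟨u, hu, huz⟩
    obtain ⟨n, rfl⟩ := exists_rotation_iff.1 hu.1
    refine ⟨⟨n, ?_⟩, fun i hi => (hu.le hi).trans_lt huz⟩
    rw [← periodicSeq_rotate]
    exact (head?_eq_some_iff.1 hu.2.1).2
  · rintro ⟨⟨i, hi⟩, h⟩
    obtain ⟨u, hu, hmax⟩ := Set.exists_max_image _ id (finite_rotations w false)
      ⟨w.rotate i, exists_rotation_iff.2 ⟨i, rfl⟩, head?_eq_some_iff.2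
        ⟨by simpa [List.rotate_eq_nil_iff] using hw, by rw [periodicSeq_rotate]; exact hi⟩⟩
    refine ⟨u, ⟨hu.1, hu.2, fun v hv hv0 => hmax v ⟨hv, hv0⟩⟩, ?_⟩
    obtain ⟨n, rfl⟩ := exists_rotation_iff.1 hu.1
    rw [periodicSeq_rotate]
    exact h n (by rw [← periodicSeq_rotate]; exact (head?_eq_some_iff.1 hu.2).2)

theorem exists_isOneMin_iff {w : List Bool} (hw : w ≠ []) {z : BinSeq} :
    (∃ u, IsOneMin u w ∧ z <ₗ periodicSeq u) ↔
      (∃ i, LexShift.shift^[i] (periodicSeq w) 0 = true) ∧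
      ∀ i, LexShift.shift^[i] (periodicSeq w) 0 = true →
        z <ₗ LexShift.shift^[i] (periodicSeq w) := by
  constructor
  · rintro ⟨u, hu, huz⟩
    obtain ⟨n, rfl⟩ := exists_rotation_iff.1 hu.1
    refine ⟨⟨n, ?_⟩, fun i hi => huz.trans_le (hu.le hi)⟩
    rw [← periodicSeq_rotate]
    exact (head?_eq_some_iff.1 hu.2.1).2
  · rintro ⟨⟨i, hi⟩, h⟩
    obtain ⟨u, hu, hmin⟩ := Set.exists_min_image _ id (finite_rotations w true)
      ⟨w.rotate i, exists_rotation_iff.2 ⟨i, rfl⟩, head?_eq_some_iff.2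
        ⟨by simpa [List.rotate_eq_nil_iff] using hw, by rw [periodicSeq_rotate]; exact hi⟩⟩
    refine ⟨u, ⟨hu.1, hu.2, fun v hv hv0 => hmin v ⟨hv, hv0⟩⟩, ?_⟩
    obtain ⟨n, rfl⟩ := exists_rotation_iff.1 hu.1
    rw [periodicSeq_rotate]
    exact h n (by rw [← periodicSeq_rotate]; exact (head?_eq_some_iff.1 hu.2).2)

/-- The conditions on the two words of a renormalisation, in terms of the periodic sequences `ω^∞`
and `ν^∞`. -/
structure RenormWords (ω ν : List Bool) : Prop where
  left_ne : ω ≠ []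
  left_head : periodicSeq ω 0 = false
  right_head : periodicSeq ν 0 = true
  left_max : ∀ i, LexShift.shift^[i] (periodicSeq ω) 0 = false →
    LexShift.shift^[i] (periodicSeq ω) ≤ₗ periodicSeq ω
  right_min : ∀ i, LexShift.shift^[i] (periodicSeq ν) 0 = true →
    periodicSeq ν ≤ₗ LexShift.shift^[i] (periodicSeq ν)
  exists_zero : ∃ i, LexShift.shift^[i] (periodicSeq ν) 0 = false
  right_lt : ∀ i, LexShift.shift^[i] (periodicSeq ν) 0 = false →
    LexShift.shift^[i] (periodicSeq ν) <ₗ periodicSeq ω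
  exists_one : ∃ i, LexShift.shift^[i] (periodicSeq ω) 0 = true
  lt_left : ∀ i, LexShift.shift^[i] (periodicSeq ω) 0 = true →
    periodicSeq ν <ₗ LexShift.shift^[i] (periodicSeq ω)

theorem RenormWords.right_ne (h : RenormWords ω ν) : ν ≠ [] := by
  rintro rfl
  simpa [periodicSeq] using h.right_head

theorem RenormWords.one_lt_left (h : RenormWords ω ν) : 1 < ω.length := by
  obtain ⟨i, hi⟩ := h.exists_one
  have h0 := h.left_head
  have hpos := List.length_pos_iff.2 h.left_ne
  by_contra hc
  have hl : ω.length = 1 := by omega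
  have := shift_periodicSeq ω
  rw [hl] at this
  rw [period_mod this, Nat.mod_one] at hi
  simp [h0] at hi

/-- Renormalisability in terms of tails of periodic sequences. The condition on the total length of
the words is redundant, because both letters occur in each of them. -/
theorem renormalisableBy_iff {α β : BinSeq} : RenormalisableBy ω ν α β ↔ RenormWords ω ν ∧
    (∃ s : BinSeq, s 0 = false ∧ s 1 = true ∧ IsConcat ω ν s (prepend [false] α)) ∧
    (∃ t : BinSeq, t 0 = true ∧ t 1 = false ∧ IsConcat ω ν t (prepend [true] β)) := by
  constructor
  · rintro ⟨h1, h2, h3, h4, -, h6, h7⟩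
    rw [isZeroMax_self_iff] at h1
    rw [isOneMin_self_iff] at h2
    have hν : ν ≠ [] := by rintro rfl; simp [periodicSeq] at h2
    rw [exists_isZeroMax_iff hν] at h3
    rw [exists_isOneMin_iff h1.1] at h4
    exact ⟨⟨h1.1, h1.2.1, h2.1, h1.2.2, h2.2, h3.1, h3.2, h4.1, h4.2⟩, h6, h7⟩
  · rintro ⟨h, h6, h7⟩
    refine ⟨isZeroMax_self_iff.2 ⟨h.left_ne, h.left_head, h.left_max⟩,
      isOneMin_self_iff.2 ⟨h.right_head, h.right_min⟩,
      (exists_isZeroMax_iff h.right_ne).2 ⟨h.exists_zero, h.right_lt⟩,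
      (exists_isOneMin_iff h.left_ne).2 ⟨h.exists_one, h.lt_left⟩, ?_, h6, h7⟩
    have h8 := h.one_lt_left
    have h9 := List.length_pos_iff.2 h.right_ne
    simp; omega

end

/-! ### Gluing -/

section

variable {α β : BinSeq}

/-- Points of `A` that share a sufficiently long word can be glued along that word. -/
def Glues (A : Set BinSeq) : Prop :=
  ∃ N, ∀ x ∈ A, ∀ y ∈ A, ∀ i j, (∀ k < N, x (i + k) = y (j + k)) →
    prepend (pre x i) (shift^[j] y) ∈ A

theorem IsSFT.glues {A : Set BinSeq} (h : IsSFT A) : Glues A := by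
  obtain ⟨F, hF, rfl⟩ := h
  obtain ⟨N, hN⟩ := (hF.image List.length).bddAbove
  refine ⟨N, fun x hx y hy i j hxy w hw ⟨k, hk⟩ => ?_⟩
  have hwN : w.length ≤ N := hN ⟨w, hw, rfl⟩
  rcases lt_or_ge k i with hki | hki
  · refine hx w hw ⟨k, fun l hl => ?_⟩
    rw [← hk l hl]
    rcases lt_or_ge (k + l) i with h | h
    · rw [prepend_pre_lt h]
    · obtain ⟨r, hr⟩ := Nat.exists_eq_add_of_le h
      rw [hr, prepend_pre_ge, shift_iterate, hxy r (by omega)]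
  · obtain ⟨r, rfl⟩ := Nat.exists_eq_add_of_le hki
    refine hy w hw ⟨j + r, fun l hl => ?_⟩
    rw [← hk l hl, show i + r + l = i + (r + l) by omega, prepend_pre_ge, shift_iterate,
      Nat.add_assoc]

/-- Gluing along a word at least as long as the period of `α` respects the bound `α`: a violation
beyond the common word would be one of the second point, because the prefix of `α` matched by then
can be continued to a multiple of the period. -/
theorem prepend_pre_le_of_periodic {p N : ℕ} (hp : 0 < p) (hα : shift^[p] α = α) (hN : p ≤ N)
    {x y : BinSeq} (hx : ∀ n, shift^[n] x ≤ₗ α) (hy : ∀ n, shift^[n] y ≤ₗ α) {i j : ℕ}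
    (hxy : ∀ k < N, x (i + k) = y (j + k)) (l : ℕ) :
    shift^[l] (prepend (pre x i) (shift^[j] y)) ≤ₗ α := by
  rcases le_or_gt i l with hl | hl
  · obtain ⟨r, rfl⟩ := Nat.exists_eq_add_of_le hl
    rw [Nat.add_comm, ← shift_shift, shift_prepend_pre, shift_shift]
    exact hy _
  set z := shift^[l] (prepend (pre x i) (shift^[j] y)) with hz
  have hzx : ∀ k < i - l + N, z k = shift^[l] x k := by
    intro k hk
    rw [hz, shift_iterate, shift_iterate]
    rcases lt_or_ge (l + k) i with h | h
    · rw [prepend_pre_lt h]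
    · obtain ⟨r, hr⟩ := Nat.exists_eq_add_of_le h
      rw [hr, prepend_pre_ge, shift_iterate, hxy r (by omega)]
  by_contra hc
  rcases lt_cases (not_le.1 hc) (i - l + N) with ⟨d, hd, h1, h2, h3⟩ | ⟨h1, -⟩
  · refine absurd (hx l) (not_le.2 (lt_def.2 ⟨d, fun k hk => ?_, h2, ?_⟩))
    · rw [h1 k hk, hzx k (by omega)]
    · rw [← hzx d hd, h3]
  · obtain ⟨t, htp, -, ht⟩ := exists_shift_return hp hα (i - l)
    have h4 := (lt_iff_shift (n := i - l + t) fun k hk => h1 k (by omega)).1 (not_le.1 hc)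
    rw [shift_shift, Nat.add_comm t] at ht
    rw [ht, hz, shift_shift, show i - l + t + l = t + i by omega, ← shift_shift,
      shift_prepend_pre, shift_shift] at h4
    exact absurd (hy _) (not_le.2 h4)

theorem mirror_pre (x : BinSeq) (n : ℕ) : (pre x n).map not = pre (mirror x) n := by
  simp [pre, mirror, Function.comp_def]

theorem glues_lexShift {p q : ℕ} (hp : 0 < p) (hα : shift^[p] α = α) (hq : 0 < q)
    (hβ : shift^[q] β = β) : Glues (lexShift α β) := by
  refine ⟨p + q, fun x hx y hy i j hxy n => ⟨?_, ?_⟩⟩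
  · have := prepend_pre_le_of_periodic (α := mirror β) (x := mirror x) (y := mirror y) (N := p + q)
      (i := i) (j := j) hq (by rw [shift_mirror, hβ]) (by omega)
      (fun n => by rw [shift_mirror, mirror_le]; exact (hx n).1)
      (fun n => by rw [shift_mirror, mirror_le]; exact (hy n).1)
      (fun k hk => by simp [mirror, hxy k hk]) n
    rwa [shift_mirror, ← mirror_pre, ← mirror_prepend, shift_mirror, mirror_le] at this
  · exact prepend_pre_le_of_periodic hp hα (by omega) (fun n => (hx n).2) (fun n => (hy n).2) hxy n

/-! ### Points reached from a word -/

/-- The points that can follow an extension of `w` in `Σ_(α,β)`. -/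
def reach (α β : BinSeq) (w : List Bool) : Set BinSeq :=
  {y | y ∈ lexShift α β ∧ ∃ b, prepend (w ++ b) y ∈ lexShift α β}

variable {w : List Bool}

theorem shift_mem_reach {y : BinSeq} (h : y ∈ reach α β w) : shift y ∈ reach α β w := by
  obtain ⟨hy, b, hb⟩ := h
  refine ⟨shift_mem_lexShift hy 1, b ++ [y 0], ?_⟩
  rwa [← List.append_assoc, prepend_append, prepend_head_shift]

theorem mirror_mem_reach {y : BinSeq} (h : y ∈ reach α β w) :
    mirror y ∈ reach (mirror β) (mirror α) (w.map not) := by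
  obtain ⟨hy, b, hb⟩ := h
  refine ⟨mirror_mem_lexShift.2 hy, b.map not, ?_⟩
  rw [← List.map_append, ← mirror_prepend]
  exact mirror_mem_lexShift.2 hb

/-- The set of points reached from `w` is a union of order intervals whose left ends are tails
of `β`. -/
theorem exists_shift_min_le_of_mem_reach {y : BinSeq} (h : y ∈ reach α β w) :
    ∃ i, shift^[i] β ≤ₗ y ∧
      ∀ z ∈ lexShift α β, shift^[i] β ≤ₗ z → z ≤ₗ y → z ∈ reach α β w := by
  classical
  obtain ⟨hy, b, hb⟩ := h
  set v := w ++ b with hv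
  set x := prepend v y with hx
  set n := v.length with hn
  have hxv : pre x n = v := by
    rw [hn, ← occursAt_zero_iff]
    intro i hi
    rw [Nat.zero_add, hx, prepend_lt hi]
  have hxn : shift^[n] x = y := shift_prepend _ _
  set S := (Finset.range (n + 1)).filter fun l => ∀ k < l, x (n - l + k) = β k with hS
  -- among the prefixes of `β` that are suffixes of the word before `y`, take the one that leaves
  -- the largest tail of `β`: this is the strongest lower bound for what may follow
  obtain ⟨l, hl, hmax⟩ := S.exists_max_image (fun l => toLex (shift^[l] β)) ⟨0, by simp [hS]⟩
  simp only [hS, Finset.mem_filter, Finset.mem_range] at hl hmax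
  refine ⟨l, ?_, fun z hz hlz hzy => ⟨hz, b, ?_⟩⟩
  · have := (le_iff_shift (x := β) (y := shift^[n - l] x) (n := l) fun k hk => by
      rw [shift_iterate, hl.2 k hk]).1 (hb _).1
    rwa [shift_shift, show l + (n - l) = n by omega, hxn] at this
  · rw [← hv, ← hxv]
    intro r
    rcases le_or_gt n r with hr | hr
    · obtain ⟨t, rfl⟩ := Nat.exists_eq_add_of_le hr
      rw [Nat.add_comm, ← shift_shift, shift_prepend_pre]
      exact hz t
    · rw [shift_prepend_pre_of_le hr.le]
      have hxr : shift^[r] x = prepend (pre (shift^[r] x) (n - r)) y := by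
        conv_lhs => rw [← prepend_pre_shift (shift^[r] x) (n - r)]
        rw [shift_shift, Nat.sub_add_cancel hr.le, hxn]
      constructor
      · by_cases hβ : ∀ k < n - r, shift^[r] x k = β k
        · have := hmax (n - r) ⟨by omega, fun k hk => by
            rw [← hβ k hk, shift_iterate]; congr 1; omega⟩
          rw [pre_congr hβ]
          conv_lhs => rw [← prepend_pre_shift β (n - r)]
          rw [prepend_le_prepend]
          exact this.trans hlz
        · have hle := (hb r).1
          rcases hle.lt_or_eq with hlt | heq
          · rcases lt_cases hlt (n - r) with ⟨d, hd, h1, h2, h3⟩ | ⟨h1, -⟩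
            · refine (lt_def.2 ⟨d, fun k hk => ?_, h2, ?_⟩).le
              · rw [prepend_pre_lt (by omega), h1 k hk]
              · rw [prepend_pre_lt hd, h3]
            · exact absurd (fun k hk => (h1 k hk).symm) hβ
          · exact absurd (fun k _ => by rw [← toLex_inj.1 heq]) hβ
      · refine le_trans ?_ (hb r).2
        have h1 : prepend (pre (shift^[r] x) (n - r)) z ≤ₗ prepend (pre (shift^[r] x) (n - r)) y :=
          prepend_le_prepend.2 hzy
        rwa [← hxr] at h1

end

/-! ### Renormalisation from a return interval -/

section

variable {α β : BinSeq} {w : List Bool}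

/-- A return interval yields a renormalisation. For a return interval with `n + m` minimal the words
are the prefixes of `0α` and `1β` of lengths `n` and `m`. The orbit of every point of the interval
runs through it along these words, and minimality excludes that the words are cyclic permutations of
each other. -/
theorem ReturnInterval.renormalisable {K₀ : Set BinSeq} {n₀ m₀ : ℕ}
    (h₀ : ReturnInterval α β K₀ n₀ m₀) (hLW : LexWorld α β) (hU : Unbalanced (lexShift α β))
    {p q : ℕ} (hp : 0 < p) (hαp : shift^[p] α = α) (hq : 0 < q) (hβq : shift^[q] β = β) :
    Renormalisable α β := by
  classical
  -- a return interval with minimal sum of the return times, enlarged to a first return interval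
  have hs := hU.shift_min_le_shift_max hLW
  have hex : ∃ l, ∃ K n m, n + m = l ∧ ReturnInterval α β K n m := ⟨_, K₀, n₀, m₀, rfl, h₀⟩
  obtain ⟨K₁, n₁, m₁, hl, h₁⟩ := Nat.find_spec hex
  have hmin : ∀ K n m, ReturnInterval α β K n m → n₁ + m₁ ≤ n + m := fun K n m h =>
    hl ▸ Nat.find_min' hex ⟨K, n, m, rfl, h⟩
  obtain ⟨K, n, hn, m, hm, h⟩ := h₁.exists_firstReturn hLW hs hp hαp hq hβq
  have hmin : ∀ K' n' m', ReturnInterval α β K' n' m' → n + m ≤ n' + m' := fun K' n' m' h' =>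
    (Nat.add_le_add hn hm).trans (hmin _ _ _ h')
  have hg := h.gapWords hLW
  have hn0 := h.pos_left
  have hm0 := h.pos_right
  have hn1 := h.one_lt_left
  have hm1 := h.one_lt_right
  set a := prepend [false] α with ha
  set b := prepend [true] β with hb
  have ha0 : a 0 = false := by simp [ha]
  have hb0 : b 0 = true := by simp [hb]
  have hωne : pre a n ≠ [] := List.ne_nil_of_length_pos (by simpa using hn0)
  have hνne : pre b m ≠ [] := List.ne_nil_of_length_pos (by simpa using hm0)
  set A := periodicSeq (pre a n) with hAdef
  set B := periodicSeq (pre b m) with hBdef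
  have hA : ∀ i < n, A i = a i := fun i hi => by
    rw [hAdef, periodicSeq_lt (by simpa using hi), getElem_pre]
  have hB : ∀ i < m, B i = b i := fun i hi => by
    rw [hBdef, periodicSeq_lt (by simpa using hi), getElem_pre]
  have hAn : shift^[n] A = A := by
    have := shift_periodicSeq (pre a n); rwa [length_pre] at this
  have hBm : shift^[m] B = B := by
    have := shift_periodicSeq (pre b m); rwa [length_pre] at this
  have hhead : ∀ (x : BinSeq) i, shift^[i] x 0 = x i := fun x i => by simp [shift_iterate]
  have hmaxA : ∀ i, 0 < i → i < n → A i = false → shift^[i] A <ₗ A := fun i h1 h2 h3 =>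
    shift_lt_of_cross (fun j hj => le_zeroMax (shift_mem_lexShift hLW.zeroMax_mem j)
      (by rw [hhead, hj])) ha0 hA hAn ((hhead a n).symm.trans h.left_cross) h1 h2 h3
  have hminB : ∀ i, 0 < i → i < m → B i = true → B <ₗ shift^[i] B := fun i h1 h2 h3 => by
    rw [← mirror_lt, ← shift_mirror]
    refine shift_lt_of_cross (a := mirror b) (n := m) (fun j hj => ?_) (by simp [mirror, hb0])
      (fun i hi => by simp [mirror, hB i hi]) (by rw [shift_mirror, hBm]) ?_ h1 h2
      (by simp [mirror, h3])
    · rw [shift_mirror, mirror_le]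
      exact oneMin_le (shift_mem_lexShift hLW.oneMin_mem j) (by
        rw [hhead]; simpa [mirror] using hj)
    · have := h.right_cross
      rw [← hb, hhead] at this
      simp [mirror, this]
  have hBA : ∀ i, 0 < i → i < m → B i = false → shift^[i] B ≤ₗ A := fun i h1 h2 h3 =>
    hg.shift_le hn0 hm0 hA hAn hB hBm h1 h2 (hB i h2 ▸ h3)
  have hAB : ∀ i, 0 < i → i < n → A i = true → B ≤ₗ shift^[i] A := fun i h1 h2 h3 => by
    rw [← mirror_le, ← shift_mirror]
    refine hg.mirror.shift_le hm0 hn0 (fun i hi => by simp [mirror, hB i hi])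
      (by rw [shift_mirror, hBm]) (fun i hi => by simp [mirror, hA i hi])
      (by rw [shift_mirror, hAn]) h1 h2 ?_
    simp [mirror, ← hA i h2, h3]
  have hprimA : ∀ k, shift^[k] A = A → n ∣ k := by
    intro k hk
    by_contra hnk
    have hr : 0 < k % n := Nat.pos_of_ne_zero fun h0 => hnk (Nat.dvd_of_mod_eq_zero h0)
    rw [period_mod hAn k] at hk
    refine absurd (hmaxA _ hr (Nat.mod_lt _ hn0) ?_) (by rw [hk]; exact lt_irrefl _)
    rw [← hhead A, hk, hA 0 hn0, ha0]
  have hprimB : ∀ k, shift^[k] B = B → m ∣ k := by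
    intro k hk
    by_contra hnk
    have hr : 0 < k % m := Nat.pos_of_ne_zero fun h0 => hnk (Nat.dvd_of_mod_eq_zero h0)
    rw [period_mod hBm k] at hk
    refine absurd (hminB _ hr (Nat.mod_lt _ hm0) ?_) (by rw [hk]; exact lt_irrefl _)
    rw [← hhead B, hk, hB 0 hm0, hb0]
  -- the two return words are not cyclic permutations of each other
  have hne : ∀ i, shift^[i] B ≠ A := by
    intro i hi
    rw [period_mod hBm i] at hi
    have him := Nat.mod_lt i hm0
    set r := i % m
    have hr0 : 0 < r := by
      refine Nat.pos_of_ne_zero fun h0 => ?_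
      rw [h0] at hi
      have := congrFun hi 0
      rw [Function.iterate_zero, id, hA 0 hn0, hB 0 hm0, ha0, hb0] at this
      simp at this
    have h1 : n ∣ m := hprimA m (by rw [← hi, period_shift hBm])
    have h2 : m ∣ n := hprimB n (by
      have : B = shift^[m - r] A := by
        rw [← hi, shift_shift, Nat.sub_add_cancel him.le, hBm]
      rw [this, period_shift hAn])
    obtain rfl : n = m := Nat.dvd_antisymm h1 h2
    obtain ⟨K', hK'⟩ := h.exists_shorter hLW hU hA hB hBm hr0 him hi
    have := hmin _ _ _ hK'
    omega
  have hperA : ∀ i, shift^[i] A = A ∨ ∃ r, 0 < r ∧ r < n ∧ shift^[i] A = shift^[r] A := by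
    intro i
    rcases Nat.eq_zero_or_pos (i % n) with h0 | h0
    · left; rw [period_mod hAn, h0]; rfl
    · exact Or.inr ⟨_, h0, Nat.mod_lt _ hn0, period_mod hAn i⟩
  have hperB : ∀ i, shift^[i] B = B ∨ ∃ r, 0 < r ∧ r < m ∧ shift^[i] B = shift^[r] B := by
    intro i
    rcases Nat.eq_zero_or_pos (i % m) with h0 | h0
    · left; rw [period_mod hBm, h0]; rfl
    · exact Or.inr ⟨_, h0, Nat.mod_lt _ hm0, period_mod hBm i⟩
  have hA0 : A 0 = false := (hA 0 hn0).trans ha0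
  have hB0 : B 0 = true := (hB 0 hm0).trans hb0
  refine ⟨hLW, pre a n, pre b m, renormalisableBy_iff.2 ⟨⟨hωne, hA0, hB0, fun i hi => ?_,
    fun i hi => ?_, ⟨1, ?_⟩, fun i hi => ?_, ⟨1, ?_⟩, fun i hi => ?_⟩, ?_, ?_⟩⟩
  · change shift^[i] A ≤ₗ A
    change shift^[i] A 0 = false at hi
    rcases hperA i with h1 | ⟨r, h1, h2, h3⟩
    · rw [h1]
    · rw [h3]; exact (hmaxA r h1 h2 (by rw [h3, hhead] at hi; exact hi)).le
  · change B ≤ₗ shift^[i] B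
    change shift^[i] B 0 = true at hi
    rcases hperB i with h1 | ⟨r, h1, h2, h3⟩
    · rw [h1]
    · rw [h3]; exact (hminB r h1 h2 (by rw [h3, hhead] at hi; exact hi)).le
  · change shift^[1] B 0 = false
    rw [hhead, hB 1 hm1, hb, prepend_singleton_succ, hLW.head_min]
  · change shift^[i] B <ₗ A
    change shift^[i] B 0 = false at hi
    refine lt_of_le_of_ne ?_ fun hc => hne i (toLex_inj.1 hc)
    rcases hperB i with h1 | ⟨r, h1, h2, h3⟩
    · rw [h1, hB0] at hi; simp at hi
    · rw [h3]; exact hBA r h1 h2 (by rw [h3, hhead] at hi; exact hi)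
  · change shift^[1] A 0 = true
    rw [hhead, hA 1 hn1, ha, prepend_singleton_succ, hLW.head_max]
  · change B <ₗ shift^[i] A
    change shift^[i] A 0 = true at hi
    refine lt_of_le_of_ne ?_ fun hc => ?_
    · rcases hperA i with h1 | ⟨r, h1, h2, h3⟩
      · rw [h1, hA0] at hi; simp at hi
      · rw [h3]; exact hAB r h1 h2 (by rw [h3, hhead] at hi; exact hi)
    · obtain ⟨t, -, -, ht⟩ := exists_shift_return hn0 hAn i
      exact hne t (by rw [toLex_inj.1 hc, ht])
  all_goals
    -- the points of `K` start with one of the two words and return to `K` when it is removed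
    have hstep : ∀ x ∈ K, OccursAt (block (pre a n) (pre b m) (x 0)) x 0 ∧
        shift^[(block (pre a n) (pre b m) (x 0)).length] x ∈ K := by
      intro x hx
      cases hx0 : x 0
      · refine ⟨occursAt_zero_iff.2 ?_, ?_⟩
        · simp only [block, length_pre, Bool.false_eq_true, if_false]
          exact pre_congr (h.left_agree x hx hx0)
        · simpa [block] using h.left_return x hx hx0
      · refine ⟨occursAt_zero_iff.2 ?_, ?_⟩
        · simp only [block, length_pre, if_true]
          exact pre_congr (h.right_agree x hx hx0)
        · simpa [block] using h.right_return x hx hx0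
  · obtain ⟨s, hs0, hsc⟩ := exists_isConcat K hstep h.left_mem
    rw [← ha, ha0] at hs0
    refine ⟨s, hs0, ?_, hsc⟩
    have h1 := (hsc.shift 1).head hA0 hωne hB0
    rw [substWord_one, hs0, hhead s] at h1
    simp only [block, length_pre, Bool.false_eq_true, if_false] at h1
    rw [← h1, ← h.left_cross]
  · obtain ⟨s, hs0, hsc⟩ := exists_isConcat K hstep h.right_mem
    rw [← hb, hb0] at hs0
    refine ⟨s, hs0, ?_, hsc⟩
    have h1 := (hsc.shift 1).head hA0 hωne hB0
    rw [substWord_one, hs0, hhead s] at h1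
    simp only [block, length_pre, if_true] at h1
    rw [← h1, ← h.right_cross]

/-! ### Transitivity of non-renormalisable lexicographic subshifts -/

theorem mem_language_iff {A : Set BinSeq} (hA : ∀ x ∈ A, shift x ∈ A) :
    w ∈ language A ↔ ∃ y, prepend w y ∈ A := by
  constructor
  · rintro ⟨x, hx, k, hk⟩
    have hk' : shift^[k] x ∈ A := by
      clear hk
      induction k with
      | zero => exact hx
      | succ k ih => rw [shift_succ]; exact hA _ ih
    rw [occursAt_iff_shift, occursAt_zero_iff_prepend] at hk
    exact ⟨_, hk ▸ hk'⟩
  · rintro ⟨y, hy⟩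
    exact ⟨_, hy, 0, fun i hi => by rw [Nat.zero_add, prepend_lt hi]⟩

theorem reach_subset : reach α β w ⊆ lexShift α β := fun _ h => h.1

theorem shift_iterate_mem_reach {y : BinSeq} (h : y ∈ reach α β w) (n : ℕ) :
    shift^[n] y ∈ reach α β w := by
  induction n with
  | zero => exact h
  | succ n ih => rw [shift_succ]; exact shift_mem_reach ih

/-- Membership in `reach α β w` depends on finitely many digits, by gluing. -/
theorem exists_agree_reach (hG : Glues (lexShift α β)) :
    ∃ N, ∀ y ∈ reach α β w, ∀ z ∈ lexShift α β, (∀ k < N, y k = z k) → z ∈ reach α β w := by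
  obtain ⟨N, hN⟩ := hG
  refine ⟨N, fun y ⟨hy, b, hb⟩ z hz hyz => ⟨hz, b, ?_⟩⟩
  have := hN _ hb z hz (w ++ b).length 0 fun k hk => by
    rw [prepend_ge, Nat.zero_add, hyz k hk]
  have h1 : pre (prepend (w ++ b) y) (w ++ b).length = w ++ b := by
    rw [← occursAt_zero_iff]
    intro i hi
    rw [Nat.zero_add, prepend_lt hi]
  rwa [h1] at this

/-- A nonempty set of reached points contains the whole orbit of the periodic sequence `β`: the left
end of one of its intervals is a tail of `β`. -/
theorem min_mem_reach (hLW : LexWorld α β) {q : ℕ} (hq : 0 < q)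
    (hβ : shift^[q] β = β) {y : BinSeq} (hy : y ∈ reach α β w) (i : ℕ) :
    shift^[i] β ∈ reach α β w := by
  obtain ⟨j, hj, hj'⟩ := exists_shift_min_le_of_mem_reach hy
  have h1 := hj' _ (shift_mem_lexShift hLW.min_mem j) le_rfl hj
  obtain ⟨t, -, -, ht⟩ := exists_shift_return hq hβ j
  have h2 := shift_iterate_mem_reach h1 t
  rw [ht] at h2
  exact shift_iterate_mem_reach h2 i

theorem max_mem_reach (hLW : LexWorld α β) {p : ℕ} (hp : 0 < p)
    (hα : shift^[p] α = α) {y : BinSeq} (hy : y ∈ reach α β w) (i : ℕ) :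
    shift^[i] α ∈ reach α β w := by
  have := mirror_mem_reach (min_mem_reach hLW.mirror hp (by rw [shift_mirror, hα])
    (mirror_mem_reach hy) i)
  simpa [mirror_mirror, shift_mirror, Function.comp_def] using this

/-- If some point is not reached from `w`, then some orbit is never reached from `w`: none of the
iterated preimages of that point is reached, and a limit of them is such an orbit by compactness. -/
theorem exists_orbit_avoiding_reach (hLW : LexWorld α β) (hG : Glues (lexShift α β))
    (hs : shift β ≤ₗ shift α) {x₁ : BinSeq} (hx₁ : x₁ ∈ lexShift α β) (hx₁' : x₁ ∉ reach α β w) :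
    ∃ x ∈ lexShift α β, ∀ n, shift^[n] x ∉ reach α β w := by
  obtain ⟨N, hN⟩ := exists_agree_reach (w := w) hG
  let C : ℕ → Set BinSeq := fun n => {x | x ∈ lexShift α β ∧ ∀ i ≤ n, shift^[i] x ∉ reach α β w}
  have hpre : ∀ n, ∃ y ∈ lexShift α β, shift^[n] y = x₁ := by
    intro n
    induction n with
    | zero => exact ⟨x₁, hx₁, rfl⟩
    | succ n ih =>
      obtain ⟨y, hy, hyn⟩ := ih
      obtain ⟨z, hz, hzy⟩ := exists_preimage hLW hs hy
      exact ⟨z, hz, by rw [Function.iterate_succ_apply, hzy, hyn]⟩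
  have hclosed : ∀ n, IsClosed (C n) := by
    intro n
    refine isClosed_of_agree fun x hx => ⟨?_, fun i hi hxi => ?_⟩
    · exact agree_of_isClosed isClosed_lexShift fun k =>
        let ⟨y, hy, hxy⟩ := hx k; ⟨y, hy.1, hxy⟩
    · obtain ⟨y, hy, hxy⟩ := hx (i + N)
      refine hy.2 i hi (hN _ hxi _ (shift_mem_lexShift hy.1 i) fun k hk => ?_)
      rw [shift_iterate, shift_iterate, hxy _ (by omega)]
  have hne : ∀ n, (C n).Nonempty := by
    intro n
    obtain ⟨y, hy, hyn⟩ := hpre n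
    refine ⟨y, hy, fun i hi hyi => hx₁' ?_⟩
    have := shift_iterate_mem_reach hyi (n - i)
    rwa [shift_shift, Nat.sub_add_cancel hi, hyn] at this
  obtain ⟨x, hx⟩ := IsCompact.nonempty_iInter_of_sequence_nonempty_isCompact_isClosed C
    (fun n x hx => ⟨hx.1, fun i hi => hx.2 i (by omega)⟩) hne ((hclosed 0).isCompact) hclosed
  rw [mem_iInter] at hx
  exact ⟨x, (hx 0).1, fun n => (hx n).2 n le_rfl⟩

/-- In a non-renormalisable subshift every point is reached from every word `w`. Otherwise the
points that are eventually reached form a completely invariant proper set whose gap component has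
ends among the tails of `β` and `α`; these tails come back to `1β` and `0α`, across the gap, so that
the component is a return interval. -/
theorem reach_eq (hLW : LexWorld α β) {p q : ℕ} (hp : 0 < p)
    (hα : shift^[p] (prepend [false] α) = prepend [false] α) (hq : 0 < q)
    (hβ : shift^[q] (prepend [true] β) = prepend [true] β) (hU : Unbalanced (lexShift α β))
    (hR : ¬ Renormalisable α β) (hw : w ∈ language (lexShift α β)) :
    reach α β w = lexShift α β := by
  have hαp : shift^[p] α = α := by
    have := period_shift hα 1; simpa using this
  have hβq : shift^[q] β = β := by
    have := period_shift hβ 1; simpa using this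
  have hs := hU.shift_min_le_shift_max hLW
  have hG : Glues (lexShift α β) := glues_lexShift hp hαp hq hβq
  refine reach_subset.antisymm fun x₁ hx₁ => ?_
  by_contra hx₁'
  obtain ⟨x, hx, hxW⟩ := exists_orbit_avoiding_reach hLW hG hs hx₁ hx₁'
  obtain ⟨y₀, hy₀⟩ := (mem_language_iff fun x hx => shift_mem_lexShift hx 1).1 hw
  have hy : y₀ ∈ reach α β w := by
    refine ⟨?_, [], by simpa using hy₀⟩
    have := shift_mem_lexShift hy₀ w.length
    rwa [shift_prepend] at this
  have hbβ : ∀ i, ∃ t, shift^[t] (shift^[i] β) = prepend [true] β := by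
    intro i
    obtain ⟨t, -, -, ht⟩ := exists_shift_return hq hβ (i + 1)
    refine ⟨t, ?_⟩
    rwa [Function.iterate_succ_apply, shift_prepend_singleton] at ht
  have haα : ∀ i, ∃ t, shift^[t] (shift^[i] α) = prepend [false] α := by
    intro i
    obtain ⟨t, -, -, ht⟩ := exists_shift_return hp hα (i + 1)
    refine ⟨t, ?_⟩
    rwa [Function.iterate_succ_apply, shift_prepend_singleton] at ht
  have hbW : prepend [true] β ∈ reach α β w := by
    obtain ⟨t, ht⟩ := hbβ 0
    rw [← ht]
    exact shift_iterate_mem_reach (min_mem_reach hLW hq hβq hy 0) t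
  have haW : prepend [false] α ∈ reach α β w := by
    obtain ⟨t, ht⟩ := haα 0
    rw [← ht]
    exact shift_iterate_mem_reach (max_mem_reach hLW hp hαp hy 0) t
  have hsat : IsSaturated α β {x | x ∈ lexShift α β ∧ ∃ n, shift^[n] x ∈ reach α β w} := by
    refine ⟨fun x hx => hx.1, ?_, ?_, ⟨hLW.zeroMax_mem, 0, haW⟩, ⟨hLW.oneMin_mem, 0, hbW⟩,
      x, hx, fun hc => hc.2.elim fun n hn => hxW n hn⟩
    · rintro z ⟨hz, n, hn⟩
      refine ⟨shift_mem_lexShift hz 1, n, ?_⟩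
      have := shift_mem_reach hn
      rwa [← shift_succ, Function.iterate_succ_apply] at this
    · rintro z hz ⟨-, n, hn⟩
      exact ⟨hz, n + 1, hn⟩
  -- the ends `σⁱ(β)` and `σʲ(α)` of the intervals of reached points at `0α` and `1β`
  obtain ⟨i, hi, hi'⟩ := exists_shift_min_le_of_mem_reach haW
  obtain ⟨j, hj, hj'⟩ := exists_shift_min_le_of_mem_reach (mirror_mem_reach hbW)
  have hi0 := head_of_le' hi (by simp)
  rw [shift_mirror, mirror_le] at hj
  have hj0 := head_of_le hj (by simp)
  have hbK := right_mem_gapComponent hLW hsat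
  have haK := left_mem_gapComponent hLW hsat
  have hαK : ∀ z ∈ lexShift α β, prepend [true] β ≤ₗ z → z ≤ₗ shift^[j] α →
      z ∈ reach α β w := by
    intro z hz h1 h2
    have := mirror_mem_reach (hj' (mirror z) (mirror_mem_lexShift.2 hz)
      (by rw [shift_mirror, mirror_le]; exact h2) (mirror_le.2 h1))
    simpa [mirror_mirror, Function.comp_def] using this
  obtain ⟨n₀, hn₀⟩ := hbβ i
  obtain ⟨m₀, hm₀⟩ := haα j
  obtain ⟨n, -, m, -, hfr⟩ := firstReturn_of_isSaturated (n₀ := n₀) (m₀ := m₀) hLW hs hp hαp hq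
    hβq hsat (x := shift^[i] β) (y := shift^[j] α)
    ⟨shift_mem_lexShift hLW.min_mem i, fun _ z hz h1 h2 => ⟨hz, 0, hi' z hz h1 h2⟩,
      fun h1 => by simp [hi0] at h1⟩ hi0 (by rw [hn₀]; exact hbK) (by rw [hn₀]; simp)
    ⟨shift_mem_lexShift hLW.max_mem j, fun h1 => by simp [hj0] at h1, fun _ z hz h1 h2 =>
      ⟨hz, 0, hαK z hz h1 h2⟩⟩ hj0 (by rw [hm₀]; exact haK) (by rw [hm₀]; simp)
  exact hR (hfr.toReturnInterval.renormalisable hLW hU hp hαp hq hβq)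

/-- A non-renormalisable lexicographic subshift with periodic bounds is transitive. -/
theorem isTransitive_lexShift (hLW : LexWorld α β) {p q : ℕ} (hp : 0 < p)
    (hα : shift^[p] (prepend [false] α) = prepend [false] α) (hq : 0 < q)
    (hβ : shift^[q] (prepend [true] β) = prepend [true] β) (hU : Unbalanced (lexShift α β))
    (hR : ¬ Renormalisable α β) : IsTransitive (lexShift α β) := by
  have hinv : ∀ x ∈ lexShift α β, shift x ∈ lexShift α β := fun x hx => shift_mem_lexShift hx 1
  intro u hu v hv
  obtain ⟨y, hy⟩ := (mem_language_iff hinv).1 hv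
  rw [← reach_eq hLW hp hα hq hβ hU hR hu] at hy
  obtain ⟨-, b, hb⟩ := hy
  refine ⟨b, (mem_language_iff hinv).2 ⟨prepend v y, ?_⟩, (mem_language_iff hinv).2 ⟨y, ?_⟩⟩
  · rw [prepend_append] at hb
    have := shift_mem_lexShift hb u.length
    rwa [shift_prepend] at this
  · rwa [← prepend_append] at hb

end

/-! ### Periodicity of the bounds of a subshift of finite type -/

section

variable {α β : BinSeq}

theorem Glues.mirror (h : Glues (lexShift α β)) :
    Glues (lexShift (mirror β) (mirror α)) := by
  obtain ⟨N, hN⟩ := h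
  refine ⟨N, fun x hx y hy i j hxy => ?_⟩
  rw [← mirror_mirror x, mirror_mem_lexShift] at hx
  rw [← mirror_mirror y, mirror_mem_lexShift] at hy
  have := hN _ hx _ hy i j fun k hk => by simp [LexShift.mirror, hxy k hk]
  rw [← mirror_mem_lexShift, mirror_prepend, mirror_pre, ← shift_mirror] at this
  simpa only [mirror_mirror] using this

/-- In the presence of gluing, the maximal sequence is preperiodic. -/
theorem Glues.exists_shift_eq (hG : Glues (lexShift α β)) (hLW : LexWorld α β) :
    ∃ i p, 0 < p ∧ shift^[i + p] α = shift^[i] α := by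
  obtain ⟨N, hN⟩ := hG
  obtain ⟨i, j, hij, h⟩ := Finite.exists_ne_map_eq_of_infinite
    fun (i : ℕ) (k : Fin N) => α (i + k)
  have key : ∀ i j, (∀ k < N, α (i + k) = α (j + k)) → shift^[j] α ≤ₗ shift^[i] α := by
    intro i j h
    have := le_max (hN _ hLW.max_mem _ hLW.max_mem i j h)
    conv_rhs at this => rw [← prepend_pre_shift α i]
    rwa [prepend_le_prepend] at this
  have h' : ∀ k < N, α (i + k) = α (j + k) := fun k hk => congrFun h ⟨k, hk⟩
  have heq := le_antisymm' (key i j h') (key j i fun k hk => (h' k hk).symm)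
  rcases lt_or_gt_of_ne hij with hlt | hlt
  · exact ⟨i, j - i, by omega, by rw [Nat.add_sub_cancel' hlt.le]; exact heq⟩
  · exact ⟨j, i - j, by omega, by rw [Nat.add_sub_cancel' hlt.le]; exact heq.symm⟩

/-- If `z < α` has period `n` and `α` is the maximal sequence, then `z` and `α` differ
among the first `n` digits. -/
theorem exists_lt_period_ne (hLW : LexWorld α β) {z : BinSeq} (hz : z <ₗ α) {n : ℕ} (hn : 0 < n)
    (hzn : shift^[n] z = z) : ∃ d < n, z d ≠ α d := by
  obtain ⟨d, hd, h0, h1⟩ := lt_def.1 hz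
  refine ⟨d, ?_, by simp [h0, h1]⟩
  by_contra hc
  have hmod := period_mod hzn
  have hz' : ∀ i, z (n * (d / n) + i) = z i := fun i => by
    rw [← shift_iterate (n * (d / n)) z, iterate_mul_period hzn]
  have hd' := Nat.div_add_mod d n
  have hlt := Nat.mod_lt d hn
  refine absurd ((hLW.max_mem (n * (d / n))).2)
    (not_le.2 (lt_def.2 ⟨d % n, fun j hj => ?_, ?_, ?_⟩))
  · rw [shift_iterate, ← hd _ (by omega), ← hd _ (by omega), hz']
  · rw [← hd _ (by omega), ← hz', hd', h0]
  · rw [shift_iterate, hd', h1]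

/-- In the presence of gluing, the maximal sequence is periodic. If the largest tail `z` of its
periodic part were smaller than `α`, then many periods of `z` followed by `α` would form a point of
`Σ_(α,β)`; glued to the initial part of `α` it would exceed `α`. -/
theorem Glues.exists_period (hG : Glues (lexShift α β)) (hLW : LexWorld α β) :
    ∃ p, 0 < p ∧ shift^[p] α = α := by
  obtain ⟨i, p, hp, hip⟩ := hG.exists_shift_eq hLW
  have hper : shift^[p] (shift^[i] α) = shift^[i] α := by rw [shift_shift, Nat.add_comm, hip]
  -- the largest tail `z` of the periodic part
  obtain ⟨l, -, hl⟩ := (Finset.range p).exists_max_image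
    (fun l => toLex (shift^[l] (shift^[i] α))) ⟨0, by simpa using hp⟩
  set z := shift^[l] (shift^[i] α) with hz
  have hzp : shift^[p] z = z := period_shift hper l
  have hzmax : ∀ k, shift^[k] z ≤ₗ z := by
    intro k
    rw [hz, shift_shift, period_mod hper]
    exact hl _ (Finset.mem_range.2 (Nat.mod_lt _ hp))
  have hzα : z = shift^[l + i] α := by rw [hz, shift_shift]
  have hzX : z ∈ lexShift α β := hzα ▸ shift_mem_lexShift hLW.max_mem _
  rcases (le_max hzX).lt_or_eq with hlt | heq
  swap
  · exact ⟨p, hp, by rw [← toLex_inj.1 heq, hzp]⟩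
  exfalso
  obtain ⟨N, hN⟩ := hG
  have hPN : shift^[p * N] z = z := iterate_mul_period hzp N
  have hNle : N ≤ p * N := Nat.le_mul_of_pos_left N hp
  -- the point `z₁ ⋯ z_{pN} α`
  have hy : prepend (pre z (p * N)) α ∈ lexShift α β := by
    intro k
    rcases le_or_gt (p * N) k with hk | hk
    · obtain ⟨t, rfl⟩ := Nat.exists_eq_add_of_le hk
      rw [Nat.add_comm, ← shift_shift, shift_prepend_pre]
      exact hLW.max_mem t
    rw [shift_prepend_pre_of_le hk.le]
    set n := p * N - k with hn
    have hzk : shift^[n] (shift^[k] z) = z := by rw [shift_shift, Nat.sub_add_cancel hk.le, hPN]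
    constructor
    · refine ((hzX k).1).trans ?_
      conv_lhs => rw [← prepend_pre_shift (shift^[k] z) n, hzk]
      rw [prepend_le_prepend]
      exact hlt.le
    · by_contra hc
      rcases lt_cases (not_le.1 hc) n with ⟨e, he, h1, h2, h3⟩ | ⟨h1, h2⟩
      · refine absurd ((hzmax k).trans hlt.le) (not_le.2 (lt_def.2 ⟨e, fun j hj => ?_, h2, ?_⟩))
        · rw [h1 j hj, prepend_pre_lt (by omega)]
        · rw [← h3, prepend_pre_lt he]
      · have h1' : ∀ j < n, shift^[k] z j = α j := fun j hj => by
          rw [h1 j hj, prepend_pre_lt hj]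
        have h3 := agree_of_between h1' (hzmax k) hlt.le
        have h4 := (le_iff_shift fun j hj => (h3 j hj).symm).1 (hzmax k)
        rw [hzk] at h4
        obtain ⟨d, hd, hne⟩ := exists_lt_period_ne hLW hlt (by omega)
          (le_antisymm' (hzmax n) h4)
        exact hne (by rw [h3 d hd, h1' d hd])
  have h1 := le_max (hN _ hLW.max_mem _ hy (l + i) 0 fun k hk => by
    rw [← shift_iterate (l + i) α, ← hzα, Nat.zero_add, prepend_pre_lt (by omega)])
  conv_rhs at h1 => rw [← prepend_pre_shift α (l + i), ← hzα]
  rw [Function.iterate_zero, id, prepend_le_prepend] at h1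
  conv_rhs at h1 => rw [← prepend_pre_shift z (p * N), hPN]
  rw [prepend_le_prepend] at h1
  exact absurd hlt (not_lt.2 h1)

/-- If the maximal sequence `α ≠ 1^∞` has period `p`, then so does `0α`. -/
theorem period_zeroMax (hLW : LexWorld α β) {p : ℕ} (hp : 0 < p) (hα : shift^[p] α = α)
    (hne : α ≠ fun _ => true) : shift^[p] (prepend [false] α) = prepend [false] α := by
  obtain ⟨r, rfl⟩ : ∃ r, p = r + 1 := ⟨p - 1, by omega⟩
  rw [Function.iterate_succ_apply, shift_prepend_singleton]
  rw [shift_succ] at hα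
  cases h : shift^[r] α 0
  · conv_lhs => rw [eq_prepend_of_head h, hα]
  · exfalso
    have h1 := le_max (shift_mem_lexShift hLW.max_mem r)
    rw [eq_prepend_of_head h, hα] at h1
    conv_rhs at h1 => rw [eq_prepend_of_head hLW.head_max]
    rw [prepend_le_prepend] at h1
    have h2 := le_antisymm' h1 (shift_le_of_head hLW.head_max)
    refine hne (funext fun n => ?_)
    induction n with
    | zero => exact hLW.head_max
    | succ n ih => rw [h2] at ih; exact ih

theorem period_oneMin (hLW : LexWorld α β) {q : ℕ} (hq : 0 < q) (hβ : shift^[q] β = β)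
    (hne : β ≠ fun _ => false) : shift^[q] (prepend [true] β) = prepend [true] β := by
  have := period_zeroMax hLW.mirror hq (by rw [shift_mirror, hβ]) (fun hc => hne (by
    rw [← mirror_mirror β, hc]; rfl))
  rw [← mirror_prepend_true, shift_mirror] at this
  rw [← mirror_mirror (shift^[q] (prepend [true] β)), this, mirror_mirror]

theorem exists_isShortestPeriod {x : BinSeq} (hx : IsPeriodicSeq x) :
    ∃ w, IsShortestPeriod w x := by
  classical
  obtain ⟨h1, h2⟩ := Nat.find_spec hx
  refine ⟨pre x (Nat.find hx), List.ne_nil_of_length_pos (by simpa using h1),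
    eq_periodicSeq_pre h1 h2, fun v hv hvx => ?_⟩
  rw [length_pre]
  exact Nat.find_min' hx ⟨List.length_pos_iff.2 hv, hvx ▸ shift_periodicSeq v⟩

/-! ### Composition of substitutions -/

variable {ω ν ω' ν' : List Bool}

theorem substWord_eq_flatMap (s : BinSeq) (n : ℕ) :
    substWord ω ν s n = (pre s n).flatMap (block ω ν) := by
  rw [substWord, pre, List.flatMap_map]

/-- A concatenation of words which themselves are concatenations of `ω` and `ν` is a concatenation
of `ω` and `ν`. -/
theorem IsConcat.comp {u v : List Bool} {s t x : BinSeq} (hu : u ≠ []) (hv : v ≠ [])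
    (hs : IsConcat u v s t) (h : IsConcat (u.flatMap (block ω ν)) (v.flatMap (block ω ν)) s x) :
    IsConcat ω ν t x := by
  intro n
  obtain ⟨k, hk⟩ := Nat.exists_eq_add_of_le (le_length_substWord (s := s) hu hv n)
  have h1 : substWord (u.flatMap (block ω ν)) (v.flatMap (block ω ν)) s n =
      substWord ω ν t (n + k) := by
    rw [substWord_eq_flatMap, substWord_eq_flatMap (ω := ω) (ν := ν), ← hk,
      occursAt_zero_iff.1 (hs n), substWord_eq_flatMap, List.flatMap_assoc]
    congr 1
    funext c
    cases c <;> simp [block]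
  have h2 := h n
  rw [h1, substWord_add, occursAt_append] at h2
  exact h2.1

/-! ### Synchronisation -/

/-- A tail of a concatenation that starts with `0` at a position which is not the beginning of a
block is smaller than `ω^∞`. -/
theorem RenormWords.shift_lt_of_not_cut (h : RenormWords ω ν)
    (hprim : ∀ r, 0 < r → r < ω.length → LexShift.shift^[r] (periodicSeq ω) ≠ periodicSeq ω)
    {s x : BinSeq} (hx : IsConcat ω ν s x) {N : ℕ} (hN : ∀ k, N ≠ (substWord ω ν s k).length)
    (hN0 : x N = false) : shift^[N] x <ₗ periodicSeq ω := by
  obtain ⟨k, r, rfl, hr⟩ := exists_block h.left_ne h.right_ne s N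
  set w := block ω ν (s k) with hw
  set P := periodicSeq w with hP
  have hr0 : 0 < r := by
    refine Nat.pos_of_ne_zero ?_
    rintro rfl
    exact hN k rfl
  have hy := hx.shift k
  set y := shift^[(substWord ω ν s k).length] x with hydef
  have hs0 : shift^[k] s 0 = s k := by simp [shift_iterate]
  have hyw : ∀ i < w.length, y i = P i := by
    have h1 := hy 1
    rw [substWord_one, hs0] at h1
    intro i hi
    have := h1 i hi
    rw [Nat.zero_add] at this
    rw [this, hP, periodicSeq_lt hi]
  -- compare with the periodic continuation of the block: what follows the block is at most `ν^∞`
  have hnext : shift^[w.length] y ≤ₗ periodicSeq ν := by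
    have h1 := (hy.shift 1).le_right h.left_head h.left_ne h.right_head
    rwa [substWord_one, hs0] at h1
  have hP0 : shift^[r] P 0 = false := by
    rw [shift_iterate, Nat.add_zero, ← hyw r hr, hydef, shift_iterate, hN0]
  have hPlt : shift^[r] P <ₗ periodicSeq ω := by
    rw [hP, hw] at hP0 ⊢
    cases hk : s k
    · rw [hk] at hP0
      refine lt_of_le_of_ne (h.left_max r hP0) fun hc => hprim r hr0 ?_ (toLex_inj.1 hc)
      rw [hw, hk] at hr
      simpa [block] using hr
    · rw [hk] at hP0
      exact h.right_lt r hP0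
  rw [show (substWord ω ν s k).length + r = r + (substWord ω ν s k).length by omega,
    ← shift_shift, ← hydef]
  have hdig : ∀ j < w.length - r, shift^[r] y j = shift^[r] P j := fun j hj => by
    rw [shift_iterate, shift_iterate, hyw _ (by omega)]
  rcases lt_cases hPlt (w.length - r) with ⟨d, hd, h1, h2, h3⟩ | ⟨h1, h2⟩
  · refine lt_def.2 ⟨d, fun j hj => ?_, ?_, h3⟩
    · rw [hdig j (by omega), h1 j hj]
    · rw [hdig d hd, h2]
  · refine (lt_iff_shift fun j hj => (hdig j hj).trans (h1 j hj)).2 ?_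
    rw [shift_shift, Nat.sub_add_cancel hr.le] at h2 ⊢
    rw [hP, shift_periodicSeq] at h2
    refine hnext.trans_lt ?_
    by_cases hc : shift^[w.length - r] (periodicSeq ω) 0 = true
    · exact h.lt_left _ hc
    · exfalso
      have hc : shift^[w.length - r] (periodicSeq ω) 0 = false := by simpa using hc
      have hlt := h2.trans_le (h.left_max _ hc)
      rw [hw] at hlt h2
      cases hk : s k
      · rw [hk] at hlt; exact lt_irrefl _ hlt
      · rw [hk] at hlt
        exact absurd hlt (lt_of_head h.left_head h.right_head).not_gt

end

/-! ### Essential pairs -/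

section

variable {α β : BinSeq} {ω ν : List Bool} {s x : BinSeq}

theorem periodicSeq_map_not {w : List Bool} (hw : w ≠ []) :
    periodicSeq (w.map not) = mirror (periodicSeq w) := by
  symm
  refine periodicSeq_unique (by simpa using hw) ?_
  rw [← mirror_prepend, periodicSeq_eq_prepend]

theorem block_map_not (c : Bool) :
    block (ν.map not) (ω.map not) (!c) = (block ω ν c).map not := by
  cases c <;> simp [block]

theorem substWord_map_not (n : ℕ) :
    substWord (ν.map not) (ω.map not) (mirror s) n = (substWord ω ν s n).map not := by
  induction n with
  | zero => rfl
  | succ n ih => rw [substWord_succ, substWord_succ, ih, List.map_append, mirror, block_map_not]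

/-- The mirror image exchanges the roles of the two words. -/
theorem IsConcat.mirror (h : IsConcat ω ν s x) :
    IsConcat (ν.map not) (ω.map not) (mirror s) (mirror x) := by
  intro n
  rw [substWord_map_not]
  intro i hi
  simp only [List.getElem_map, ← h n i (by simpa using hi)]
  rfl

theorem RenormWords.mirror (h : RenormWords ω ν) : RenormWords (ν.map not) (ω.map not) := by
  have hω := periodicSeq_map_not h.left_ne
  have hν := periodicSeq_map_not h.right_ne
  have h0 : ∀ x : BinSeq, LexShift.mirror x 0 = false ↔ x 0 = true := fun x => by
    simp [LexShift.mirror]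
  have h1 : ∀ x : BinSeq, LexShift.mirror x 0 = true ↔ x 0 = false := fun x => by
    simp [LexShift.mirror]
  constructor
  · simpa using h.right_ne
  · rw [hν, h0]; exact h.right_head
  · rw [hω, h1]; exact h.left_head
  · intro i; rw [hν, shift_mirror, h0, mirror_le]; exact h.right_min i
  · intro i; rw [hω, shift_mirror, h1, mirror_le]; exact h.left_max i
  · simp only [hω, shift_mirror, h0]; exact h.exists_one
  · intro i; rw [hω, hν, shift_mirror, h0, mirror_lt]; exact h.lt_left i
  · simp only [hν, shift_mirror, h1]; exact h.exists_zero
  · intro i; rw [hω, hν, shift_mirror, h1, mirror_lt]; exact h.right_lt i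

theorem shift_iterate_zero (n : ℕ) (x : BinSeq) : shift^[n] x 0 = x n := by
  rw [shift_iterate, Nat.add_zero]

theorem prefix_of_isConcat {c : Bool} (h : IsConcat ω ν s x) (hs : s 0 = c) :
    OccursAt (block ω ν c) x 0 := by
  have := h 1
  rwa [substWord_one, hs] at this

theorem IsConcat.tail {c : Bool} (h : IsConcat ω ν s x) (hs : s 0 = c) :
    IsConcat ω ν (LexShift.shift s) (LexShift.shift^[(block ω ν c).length] x) := by
  have := h.shift 1
  rwa [substWord_one, hs] at this

/-- The left word of a renormalisation of a pair in the lexicographic world is primitive. -/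
theorem RenormWords.left_primitive (h : RenormWords ω ν) (hLW : LexWorld α β)
    (hs0 : s 0 = false) (hs1 : s 1 = true) (hs : IsConcat ω ν s (prepend [false] α)) {r : ℕ}
    (hr : 0 < r) (hrω : r < ω.length) : LexShift.shift^[r] (periodicSeq ω) ≠ periodicSeq ω := by
  intro hc
  have h1 : prepend [false] α ω.length = true := by
    have := (hs.tail hs0).head h.left_head h.left_ne h.right_head
    rw [shift_iterate_zero] at this
    exact this.trans hs1
  refine absurd (shift_lt_of_cross (a := prepend [false] α) (A := periodicSeq ω) (n := ω.length)
    (fun i hi => le_zeroMax (shift_mem_lexShift hLW.zeroMax_mem i) ?_) (by simp) (fun i hi => ?_)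
    (shift_periodicSeq ω) h1 hr hrω ?_) ?_
  · rw [shift_iterate_zero, hi]
  · rw [periodicSeq_lt hi]
    have := prefix_of_isConcat hs hs0 i hi
    rw [Nat.zero_add] at this
    exact this.symm
  · rw [← shift_iterate_zero r (periodicSeq ω), hc, h.left_head]
  · rw [hc]; exact lt_irrefl _

/-- A period of a concatenation that starts with `0` ends at the end of a block. -/
theorem RenormWords.exists_pre_eq (h : RenormWords ω ν)
    (hprim : ∀ r, 0 < r → r < ω.length → LexShift.shift^[r] (periodicSeq ω) ≠ periodicSeq ω)
    (hx : IsConcat ω ν s x) (hx0 : x 0 = false) {p : ℕ} (hp : LexShift.shift^[p] x = x) :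
    ∃ k, p = (substWord ω ν s k).length ∧ pre x p = (pre s k).flatMap (block ω ν) := by
  by_cases hc : ∃ k, p = (substWord ω ν s k).length
  · obtain ⟨k, hk⟩ := hc
    refine ⟨k, hk, ?_⟩
    rw [hk, occursAt_zero_iff.1 (hx k), substWord_eq_flatMap]
  · push Not at hc
    have := h.shift_lt_of_not_cut hprim hx hc (by rw [← shift_iterate_zero p x, hp, hx0])
    rw [hp] at this
    exact absurd this (hx.left_le h.left_head h.left_ne h.right_head).not_gt

/-- A sequence that starts with `0` and is not exceeded by its shift is `0^∞`. -/
theorem shift_eq_self_of_le {x : BinSeq} (h : shift x ≤ₗ x) (h0 : x 0 = false) (n : ℕ) :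
    shift^[n] x 0 = false := by
  have h1 : shift x = x := le_antisymm' h (le_shift_of_head h0)
  rw [Function.iterate_fixed h1, h0]

theorem RenormWords.left_second (h : RenormWords ω ν) : periodicSeq ω 1 = true := by
  by_contra hc
  obtain ⟨i, hi⟩ := h.exists_one
  have := shift_eq_self_of_le (h.left_max 1 (by rw [shift_iterate_zero]; simpa using hc))
    h.left_head i
  simp [hi] at this

theorem RenormWords.right_second (h : RenormWords ω ν) : periodicSeq ν 1 = false := by
  have := h.mirror.left_second
  rw [periodicSeq_map_not h.right_ne] at this
  simpa [LexShift.mirror] using this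

/-- The corner of the renormalisation box belongs to the lexicographic world. -/
theorem RenormWords.lexWorld (h : RenormWords ω ν) :
    LexWorld (shift (periodicSeq ω)) (shift (periodicSeq ν)) := by
  have hω := eq_prepend_of_head h.left_head
  have hν := eq_prepend_of_head h.right_head
  have h1 : shift (periodicSeq ω) 0 = true := h.left_second
  have h2 : shift (periodicSeq ν) 0 = false := h.right_second
  refine lexWorld_iff.2 ⟨h1, h2, mem_lexShift_of_tails (lt_of_head h2 h1).le le_rfl ?_ ?_,
    mem_lexShift_of_tails le_rfl (lt_of_head h2 h1).le ?_ ?_⟩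
  all_goals
    intro n hn
    rw [← Function.iterate_succ_apply] at hn ⊢
  · rw [← hω]; exact h.left_max _ hn
  · rw [← hν]; exact (h.lt_left _ hn).le
  · rw [← hω]; exact (h.right_lt _ hn).le
  · rw [← hν]; exact h.right_min _ hn

theorem isShortestPeriod_of_primitive {w : List Bool} (hw : w ≠ [])
    (h : ∀ r, 0 < r → r < w.length → shift^[r] (periodicSeq w) ≠ periodicSeq w) :
    IsShortestPeriod w (periodicSeq w) :=
  ⟨hw, rfl, fun v hv hvw => not_lt.1 fun hc =>
    h _ (List.length_pos_iff.2 hv) hc (hvw ▸ shift_periodicSeq v)⟩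

/-- Mirror image of `RenormWords.left_primitive`. -/
theorem RenormWords.right_primitive (h : RenormWords ω ν) (hLW : LexWorld α β)
    (hs0 : s 0 = true) (hs1 : s 1 = false) (hs : IsConcat ω ν s (prepend [true] β)) {r : ℕ}
    (hr : 0 < r) (hrν : r < ν.length) : LexShift.shift^[r] (periodicSeq ν) ≠ periodicSeq ν := by
  have hs' := hs.mirror
  rw [mirror_prepend_true] at hs'
  have := h.mirror.left_primitive hLW.mirror (by simp [LexShift.mirror, hs0])
    (by simp [LexShift.mirror, hs1]) hs' hr (by simpa using hrν)
  rw [periodicSeq_map_not h.right_ne, shift_mirror] at this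
  exact fun hc => this (by rw [hc])

/-- Mirror image of `RenormWords.exists_pre_eq`. -/
theorem RenormWords.exists_pre_eq' (h : RenormWords ω ν)
    (hprim : ∀ r, 0 < r → r < ν.length → LexShift.shift^[r] (periodicSeq ν) ≠ periodicSeq ν)
    (hx : IsConcat ω ν s x) (hx0 : x 0 = true) {p : ℕ} (hp : LexShift.shift^[p] x = x) :
    ∃ k, p = (substWord ω ν s k).length ∧ pre x p = (pre s k).flatMap (block ω ν) := by
  obtain ⟨k, hk, -⟩ := h.mirror.exists_pre_eq (fun r hr hrν => by
      rw [periodicSeq_map_not h.right_ne, shift_mirror]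
      intro hc
      refine hprim r hr (by simpa using hrν) ?_
      rw [← mirror_mirror (LexShift.shift^[r] _), hc, mirror_mirror]) hx.mirror
    (by simp [LexShift.mirror, hx0]) (p := p) (by rw [shift_mirror, hp])
  rw [substWord_map_not, List.length_map] at hk
  exact ⟨k, hk, by rw [hk, occursAt_zero_iff.1 (hx k), substWord_eq_flatMap]⟩

/-- A renormalisation of the corner of the box of `(ω, ν)` also renormalises `(α, β)`, and its words
are shorter than `ω` and `ν`. -/
theorem RenormalisableBy.of_corner {ω' ν' : List Bool}
    (h : RenormalisableBy ω ν α β)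
    (h' : RenormalisableBy ω' ν' (shift (periodicSeq ω)) (shift (periodicSeq ν))) :
    RenormalisableBy ω' ν' α β ∧ ω'.length + ν'.length < ω.length + ν.length := by
  obtain ⟨hW, ⟨s, hs0, hs1, hs⟩, ⟨t, ht0, ht1, ht⟩⟩ := renormalisableBy_iff.1 h
  obtain ⟨hW', ⟨s', hs0', hs1', hs'⟩, ⟨t', ht0', ht1', ht'⟩⟩ := renormalisableBy_iff.1 h'
  have hLW' := hW.lexWorld
  -- by synchronisation `ω` and `ν` are themselves concatenations of `ω'` and `ν'`
  have hpl : ∀ r, 0 < r → r < ω'.length → _ := fun r =>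
    hW'.left_primitive hLW' hs0' hs1' hs' (r := r)
  have hpr : ∀ r, 0 < r → r < ν'.length → _ := fun r =>
    hW'.right_primitive hLW' ht0' ht1' ht' (r := r)
  rw [← eq_prepend_of_head hW.left_head] at hs'
  rw [← eq_prepend_of_head hW.right_head] at ht'
  obtain ⟨k, hk, hk'⟩ := hW'.exists_pre_eq hpl hs' hW.left_head (shift_periodicSeq ω)
  obtain ⟨l, hl, hl'⟩ := hW'.exists_pre_eq' hpr ht' hW.right_head (shift_periodicSeq ν)
  rw [pre_periodicSeq] at hk' hl'
  have hωpos := List.length_pos_iff.2 hW.left_ne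
  have hνpos := List.length_pos_iff.2 hW.right_ne
  have hk0 : k ≠ 0 := by rintro rfl; simp [substWord_zero] at hk; exact hW.left_ne hk
  have hl0 : l ≠ 0 := by rintro rfl; simp [substWord_zero] at hl; exact hW.right_ne hl
  obtain ⟨k, rfl⟩ := Nat.exists_eq_succ_of_ne_zero hk0
  obtain ⟨l, rfl⟩ := Nat.exists_eq_succ_of_ne_zero hl0
  have hune : pre s' (k + 1) ≠ [] := List.ne_nil_of_length_pos (by simp)
  have hvne : pre t' (l + 1) ≠ [] := List.ne_nil_of_length_pos (by simp)
  rw [Nat.succ_eq_add_one, substWord_succ', List.length_append, hs0'] at hk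
  rw [Nat.succ_eq_add_one, substWord_succ', List.length_append, ht0'] at hl
  have hb0 : block ω' ν' false = ω' := rfl
  have hb1 : block ω' ν' true = ν' := rfl
  rw [hb0] at hk
  rw [hb1] at hl
  -- the digit after the first block distinguishes `ω` from `ω'`
  have hω1 : periodicSeq ω ω'.length = true := by
    have := (hs'.tail hs0').head hW'.left_head hW'.left_ne hW'.right_head
    rw [shift_iterate_zero] at this
    exact this.trans hs1'
  have hν1 : periodicSeq ν ν'.length = false := by
    have := (ht'.tail ht0').head hW'.left_head hW'.left_ne hW'.right_head
    rw [shift_iterate_zero] at this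
    exact this.trans ht1'
  have hltω : ω'.length < ω.length := by
    refine lt_of_le_of_ne (by omega) fun hc => ?_
    rw [hc, ← Nat.add_zero ω.length, periodicSeq_add_length, hW.left_head] at hω1
    simp at hω1
  have hltν : ν'.length < ν.length := by
    refine lt_of_le_of_ne (by omega) fun hc => ?_
    rw [hc, ← Nat.add_zero ν.length, periodicSeq_add_length, hW.right_head] at hν1
    simp at hν1
  have hcomp : ∀ {σ x : BinSeq}, IsConcat ω ν σ x →
      ∃ τ, IsConcat ω' ν' τ x := fun {σ x} hσ => by
    refine ⟨_, IsConcat.comp hune hvne (isConcat_concat hune hvne σ) (x := x) ?_⟩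
    rwa [← Nat.succ_eq_add_one, ← Nat.succ_eq_add_one, ← hk', ← hl']
  refine ⟨renormalisableBy_iff.2 ⟨hW', ?_, ?_⟩, by omega⟩
  · obtain ⟨τ, hτ⟩ := hcomp hs
    have h0 := hτ.head hW'.left_head hW'.left_ne hW'.right_head
    rw [prepend_singleton_zero] at h0
    refine ⟨τ, h0.symm, ?_, hτ⟩
    have h1 := (hτ.tail h0.symm).head hW'.left_head hW'.left_ne hW'.right_head
    rw [shift_iterate_zero] at h1
    refine h1.symm.trans ?_
    have := prefix_of_isConcat hs hs0 ω'.length hltω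
    rw [Nat.zero_add] at this
    rw [hb0, this, ← hω1, periodicSeq_lt hltω]
    rfl
  · obtain ⟨τ, hτ⟩ := hcomp ht
    have h0 := hτ.head hW'.left_head hW'.left_ne hW'.right_head
    rw [prepend_singleton_zero] at h0
    refine ⟨τ, h0.symm, ?_, hτ⟩
    have h1 := (hτ.tail h0.symm).head hW'.left_head hW'.left_ne hW'.right_head
    rw [shift_iterate_zero] at h1
    refine h1.symm.trans ?_
    have := prefix_of_isConcat ht ht0 ν'.length hltν
    rw [Nat.zero_add] at this
    rw [hb1, this, ← hν1, periodicSeq_lt hltν]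
    rfl

theorem isPeriodicSeq_periodicSeq {w : List Bool} (hw : w ≠ []) : IsPeriodicSeq (periodicSeq w) :=
  ⟨_, List.length_pos_iff.2 hw, shift_periodicSeq w⟩

theorem IsPeriodicSeq.shift {x : BinSeq} (h : IsPeriodicSeq x) : IsPeriodicSeq (shift x) := by
  obtain ⟨p, hp, hx⟩ := h
  exact ⟨p, hp, period_shift hx 1⟩

/-- Every pair in the lexicographic world with periodic bounds lies in the renormalisation box of
an essential pair, namely of the corner of its shortest renormalisation. -/
theorem exists_isEssentialWordPair (hLW : LexWorld α β)
    (hα : IsPeriodicSeq (prepend [false] α)) (hβ : IsPeriodicSeq (prepend [true] β)) :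
    ∃ ω ν, IsEssentialWordPair ω ν ∧ (α, β) ∈ renormBox ω ν := by
  classical
  by_cases hR : Renormalisable α β
  swap
  · obtain ⟨ω, hω⟩ := exists_isShortestPeriod hα
    obtain ⟨ν, hν⟩ := exists_isShortestPeriod hβ
    refine ⟨ω, ν, ⟨α, β, ⟨hLW, hR, ?_, ?_⟩, hω, hν⟩, hLW, ⟨?_, ?_⟩, ?_, ?_⟩
    · simpa using hα.shift
    · simpa using hβ.shift
    · rw [hω.2.1]
    · conv_lhs => rw [← hω.2.1, ← periodicSeq_eq_prepend, hω.2.1]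
      rw [prepend_le_prepend, hν.2.1]
      exact LexWorld.zeroMax_lt_oneMin.le
    · change prepend ν (periodicSeq ω) ≤ₗ prepend [true] β
      conv_rhs => rw [← hν.2.1, ← periodicSeq_eq_prepend, hν.2.1]
      rw [prepend_le_prepend, hω.2.1]
      exact LexWorld.zeroMax_lt_oneMin.le
    · rw [hν.2.1]
  -- the renormalisation with the smallest total length of its words
  have hex : ∃ n, ∃ ω ν, RenormalisableBy ω ν α β ∧ ω.length + ν.length = n := by
    obtain ⟨-, ω, ν, h⟩ := hR
    exact ⟨_, ω, ν, h, rfl⟩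
  obtain ⟨ω, ν, h, hn⟩ := Nat.find_spec hex
  obtain ⟨hW, ⟨s, hs0, hs1, hs⟩, ⟨t, ht0, ht1, ht⟩⟩ := renormalisableBy_iff.1 h
  have hω := eq_prepend_of_head hW.left_head
  have hν := eq_prepend_of_head hW.right_head
  refine ⟨ω, ν, ⟨shift (periodicSeq ω), shift (periodicSeq ν), ⟨hW.lexWorld, ?_,
    (isPeriodicSeq_periodicSeq hW.left_ne).shift, (isPeriodicSeq_periodicSeq hW.right_ne).shift⟩,
    ?_, ?_⟩, hLW, ⟨?_, ?_⟩, ?_, ?_⟩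
  · rintro ⟨-, ω', ν', h'⟩
    obtain ⟨h1, h2⟩ := h.of_corner h'
    have := Nat.find_min' hex ⟨ω', ν', h1, rfl⟩
    omega
  · rw [← hω]
    exact isShortestPeriod_of_primitive hW.left_ne fun r => hW.left_primitive hLW hs0 hs1 hs
  · rw [← hν]
    exact isShortestPeriod_of_primitive hW.right_ne fun r => hW.right_primitive hLW ht0 ht1 ht
  · exact hs.left_le hW.left_head hW.left_ne hW.right_head
  · change prepend [false] α ≤ₗ prepend ω (periodicSeq ν)
    rw [occursAt_zero_iff_prepend.1 (prefix_of_isConcat hs hs0)]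
    change prepend ω _ ≤ₗ prepend ω _
    rw [prepend_le_prepend]
    exact (hs.tail hs0).le_right hW.left_head hW.left_ne hW.right_head
  · change prepend ν (periodicSeq ω) ≤ₗ prepend [true] β
    rw [occursAt_zero_iff_prepend.1 (prefix_of_isConcat ht ht0)]
    change prepend ν _ ≤ₗ prepend ν _
    rw [prepend_le_prepend]
    exact (ht.tail ht0).left_le hW.left_head hW.left_ne hW.right_head
  · exact ht.le_right hW.left_head hW.left_ne hW.right_head

end

/-! ### Points of a renormalisation box -/

section

variable {α β : BinSeq} {ω ν : List Bool} {s x y : BinSeq}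

/-- The order relations between `0α`, `1β` and the periodic sequences `ω^∞`, `ν^∞` when `(α, β)`
lies in the box of `(ω, ν)`, with strict inequalities at the far ends of the box. -/
structure InBox (α β : BinSeq) (ω ν : List Bool) : Prop where
  lexWorld : LexWorld α β
  corner : LexWorld (shift (periodicSeq ω)) (shift (periodicSeq ν))
  left_ne : ω ≠ []
  left_head : periodicSeq ω 0 = false
  right_head : periodicSeq ν 0 = true
  left_le : periodicSeq ω ≤ₗ prepend [false] α
  left_lt : prepend [false] α <ₗ prepend ω (periodicSeq ν)
  right_lt : prepend ν (periodicSeq ω) <ₗ prepend [true] β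
  right_le : prepend [true] β ≤ₗ periodicSeq ν

/-- The points outside the essential component, up to their first digit: those that lie strictly
between `ω^∞` and `ν^∞`. -/
def excess (α β : BinSeq) (ω ν : List Bool) : Set BinSeq :=
  {y | shift y ∈ lexShift α β ∧
    ((y 0 = false ∧ periodicSeq ω <ₗ y ∧ y ≤ₗ prepend [false] α) ∨
      (y 0 = true ∧ prepend [true] β ≤ₗ y ∧ y <ₗ periodicSeq ν))}

theorem essentialComponent_eq :
    essentialComponent ω ν = lexShift (shift (periodicSeq ω)) (shift (periodicSeq ν)) := rfl

theorem right_ne_of_head (h : periodicSeq ν 0 = true) : ν ≠ [] := by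
  rintro rfl
  simp [periodicSeq] at h

theorem shift_mirror_one (x : BinSeq) : shift (mirror x) = mirror (shift x) := shift_mirror 1 x

section mirror

theorem mirror_essentialComponent (hω : ω ≠ []) (hν : ν ≠ []) :
    mirror x ∈ essentialComponent (ν.map not) (ω.map not) ↔ x ∈ essentialComponent ω ν := by
  rw [essentialComponent_eq, essentialComponent_eq, periodicSeq_map_not hν, periodicSeq_map_not hω,
    shift_mirror_one, shift_mirror_one, mirror_mem_lexShift]

theorem mirror_mem_excess (hω : ω ≠ []) (hν : ν ≠ []) :
    mirror y ∈ excess (mirror β) (mirror α) (ν.map not) (ω.map not) ↔ y ∈ excess α β ω ν := by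
  have h0 : mirror y 0 = false ↔ y 0 = true := by simp [mirror]
  have h1 : mirror y 0 = true ↔ y 0 = false := by simp [mirror]
  simp only [excess, mem_ofPred_eq, h0, h1, shift_mirror_one, mirror_mem_lexShift,
    periodicSeq_map_not hν, periodicSeq_map_not hω, ← mirror_prepend_true, ← mirror_prepend_false,
    mirror_lt, mirror_le]
  tauto

theorem InBox.right_ne (h : InBox α β ω ν) : ν ≠ [] := right_ne_of_head h.right_head

theorem InBox.mirror (h : InBox α β ω ν) :
    InBox (mirror β) (mirror α) (ν.map not) (ω.map not) := by
  have hω := periodicSeq_map_not h.left_ne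
  have hν := periodicSeq_map_not h.right_ne
  refine ⟨h.lexWorld.mirror, ?_, by simpa using h.right_ne, ?_, ?_, ?_, ?_, ?_, ?_⟩
  · rw [hω, hν, shift_mirror_one, shift_mirror_one]; exact h.corner.mirror
  · simp [hν, LexShift.mirror, h.right_head]
  · simp [hω, LexShift.mirror, h.left_head]
  · rw [hν, ← mirror_prepend_true, mirror_le]; exact h.right_le
  · rw [hω, ← mirror_prepend_true, ← mirror_prepend, mirror_lt]; exact h.right_lt
  · rw [hν, ← mirror_prepend_false, ← mirror_prepend, mirror_lt]; exact h.left_lt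
  · rw [hω, ← mirror_prepend_false, mirror_le]; exact h.left_le

end mirror

/-- If `0α` were both periodic and equal to `ων^∞`, then it would be a tail of `ν^∞`, hence a point
of the essential component above its maximum `ω^∞` among the points that start with `0`. -/
theorem ne_of_periodic_of_corner (hC : LexWorld (shift (periodicSeq ω)) (shift (periodicSeq ν)))
    (hω0 : periodicSeq ω 0 = false) (hν0 : periodicSeq ν 0 = true)
    (hle : periodicSeq ω ≤ₗ prepend [false] α) (hα : IsPeriodicSeq (prepend [false] α)) :
    prepend [false] α ≠ prepend ω (periodicSeq ν) := by
  intro hc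
  obtain ⟨p, hp, hper⟩ := hα
  have h1 := iterate_mul_period hper ω.length
  have h2 : ω.length ≤ p * ω.length := Nat.le_mul_of_pos_left _ hp
  rw [← Nat.sub_add_cancel h2, ← shift_shift, hc, shift_prepend, ← hc] at h1
  have h3 : prepend [false] α ∈ lexShift (shift (periodicSeq ω)) (shift (periodicSeq ν)) := by
    rw [← h1]
    refine shift_mem_lexShift ?_ _
    rw [eq_prepend_of_head hν0]
    exact hC.oneMin_mem
  have h4 := le_zeroMax h3 (by simp)
  rw [← eq_prepend_of_head hω0] at h4
  have h5 := le_antisymm' h4 hle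
  rw [hc] at h5
  conv_rhs at h5 => rw [← periodicSeq_eq_prepend]
  have h6 := prepend_injective ω h5
  rw [h6, hω0] at hν0
  simp at hν0

/-- A pair with periodic bounds in the box of an essential pair avoids the far ends of the box. -/
theorem inBox_of_mem_renormBox (hE : IsEssentialWordPair ω ν) (hB : (α, β) ∈ renormBox ω ν)
    (hα : IsPeriodicSeq (prepend [false] α)) (hβ : IsPeriodicSeq (prepend [true] β)) :
    InBox α β ω ν := by
  obtain ⟨α', β', ⟨hLW', -, -, -⟩, hω, hν⟩ := hE
  obtain ⟨hLW, ⟨h1, h2⟩, h3, h4⟩ := hB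
  have hα' : shift (periodicSeq ω) = α' := by rw [hω.2.1, shift_prepend_singleton]
  have hβ' : shift (periodicSeq ν) = β' := by rw [hν.2.1, shift_prepend_singleton]
  have hω0 : periodicSeq ω 0 = false := by rw [hω.2.1]; simp
  have hν0 : periodicSeq ν 0 = true := by rw [hν.2.1]; simp
  have hC : LexWorld (shift (periodicSeq ω)) (shift (periodicSeq ν)) := by rwa [hα', hβ']
  refine ⟨hLW, hC, hω.1, hω0, hν0, h1, lt_of_le_of_ne h2 fun hc => ?_,
    lt_of_le_of_ne h3 fun hc => ?_, h4⟩
  · exact ne_of_periodic_of_corner hC hω0 hν0 h1 hα (toLex_inj.1 hc)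
  · refine ne_of_periodic_of_corner (ω := ν.map not) (ν := ω.map not) (α := mirror β) ?_
      (by simp [periodicSeq_map_not hν.1, mirror, hν0])
      (by simp [periodicSeq_map_not hω.1, mirror, hω0]) ?_ ?_ ?_
    · rw [periodicSeq_map_not hω.1, periodicSeq_map_not hν.1, shift_mirror_one, shift_mirror_one]
      exact hC.mirror
    · rw [periodicSeq_map_not hν.1, ← mirror_prepend_true, mirror_le]; exact h4
    · obtain ⟨q, hq, hper⟩ := hβ
      exact ⟨q, hq, by rw [← mirror_prepend_true, shift_mirror, hper]⟩
    · rw [periodicSeq_map_not hω.1, ← mirror_prepend_true, ← mirror_prepend, ← toLex_inj.1 hc]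

namespace InBox

theorem left_eq (h : InBox α β ω ν) : prepend [false] (shift (periodicSeq ω)) = periodicSeq ω :=
  (eq_prepend_of_head h.left_head).symm

theorem right_eq (h : InBox α β ω ν) : prepend [true] (shift (periodicSeq ν)) = periodicSeq ν :=
  (eq_prepend_of_head h.right_head).symm

theorem left_mem (h : InBox α β ω ν) : periodicSeq ω ∈ essentialComponent ω ν := by
  rw [← h.left_eq]; exact h.corner.zeroMax_mem

theorem right_mem (h : InBox α β ω ν) : periodicSeq ν ∈ essentialComponent ω ν := by
  rw [← h.right_eq]; exact h.corner.oneMin_mem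

theorem corner_le (h : InBox α β ω ν) : shift (periodicSeq ω) ≤ₗ α := by
  have := h.left_le
  rwa [← h.left_eq, prepend_le_prepend] at this

theorem le_corner (h : InBox α β ω ν) : β ≤ₗ shift (periodicSeq ν) := by
  have := h.right_le
  rwa [← h.right_eq, prepend_le_prepend] at this

theorem essentialComponent_subset (h : InBox α β ω ν) :
    essentialComponent ω ν ⊆ lexShift α β := fun _ hx n =>
  ⟨h.le_corner.trans (hx n).1, (hx n).2.trans h.corner_le⟩

/-- A point of the excess lies between `ωω^∞` and `ων^∞`, so that it starts with `ω`; removing this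
word leads to the excess again. -/
theorem strip_left (h : InBox α β ω ν) (hy : y ∈ excess α β ω ν) (hy0 : y 0 = false) :
    OccursAt ω y 0 ∧ shift^[ω.length] y ∈ excess α β ω ν := by
  obtain ⟨hyX, ⟨-, h1, h2⟩ | ⟨hy1, -⟩⟩ := hy
  swap
  · simp [hy0] at hy1
  have h3 := h2.trans_lt h.left_lt
  rw [← periodicSeq_eq_prepend] at h1
  have hocc : OccursAt ω y 0 := fun i hi => by
    rw [Nat.zero_add, agree_of_between (n := ω.length) (fun i hi => by
      rw [prepend_lt hi, prepend_lt hi]) h1.le h3.le i hi, prepend_lt hi]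
  refine ⟨hocc, ?_⟩
  rw [occursAt_zero_iff_prepend.1 hocc] at h1 h3
  replace h1 := prepend_lt_prepend.1 h1
  replace h3 := prepend_lt_prepend.1 h3
  obtain ⟨n, hn⟩ := Nat.exists_eq_succ_of_ne_zero (List.length_pos_iff.2 h.left_ne).ne'
  rw [hn] at h1 h3 ⊢
  have hX : shift^[n.succ] y ∈ lexShift α β := by
    rw [Function.iterate_succ_apply]; exact shift_mem_lexShift hyX n
  refine ⟨shift_mem_lexShift hX 1, ?_⟩
  cases h0 : shift^[n.succ] y 0
  · exact Or.inl ⟨rfl, h1, le_zeroMax hX h0⟩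
  · exact Or.inr ⟨rfl, oneMin_le hX h0, h3⟩

/-- A point of the excess starts with `ω` or `ν`, and removing this word leads to the excess again.
-/
theorem strip (h : InBox α β ω ν) (hy : y ∈ excess α β ω ν) :
    OccursAt (block ω ν (y 0)) y 0 ∧ shift^[(block ω ν (y 0)).length] y ∈ excess α β ω ν := by
  cases hy0 : y 0
  · exact h.strip_left hy hy0
  · have h1 := h.mirror.strip_left ((mirror_mem_excess h.left_ne h.right_ne).2 hy)
      (by simp [LexShift.mirror, hy0])
    rw [List.length_map, shift_mirror, mirror_mem_excess h.left_ne h.right_ne] at h1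
    refine ⟨fun i hi => ?_, h1.2⟩
    have := h1.1 i (by simpa [block] using hi)
    simpa [LexShift.mirror, block] using this

/-- The points of the excess are concatenations of `ω` and `ν`. -/
theorem exists_concat (h : InBox α β ω ν) (hy : y ∈ excess α β ω ν) :
    ∃ s, s 0 = y 0 ∧ IsConcat ω ν s y :=
  exists_isConcat (excess α β ω ν) (fun _ hx => h.strip hx) hy

/-- The excess is disjoint from the essential component. As stripping leads back to the excess, the
orbit of one of its points never enters the essential component. -/
theorem notMem_excess (h : InBox α β ω ν) (hx : x ∈ essentialComponent ω ν) :
    x ∉ excess α β ω ν := by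
  rintro ⟨-, ⟨h0, h1, -⟩ | ⟨h0, -, h1⟩⟩
  · have := le_zeroMax hx h0
    rw [cornerPair, h.left_eq] at this
    exact absurd h1 this.not_gt
  · have := oneMin_le hx h0
    rw [cornerPair, h.right_eq] at this
    exact absurd h1 this.not_gt

/-- A point of `Σ_(α,β)` whose orbit avoids the excess lies in the essential component as soon as it
lies between the two bounds of the latter. -/
theorem mem_of_avoids (h : InBox α β ω ν) (hx : x ∈ lexShift α β)
    (hβ : shift (periodicSeq ν) ≤ₗ x) (hα : x ≤ₗ shift (periodicSeq ω))
    (hG : ∀ k, shift^[k] x ∉ excess α β ω ν) : x ∈ essentialComponent ω ν := by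
  refine mem_lexShift_of_tails hβ hα (fun n hn => ?_) fun n hn => ?_
  · rw [cornerPair, h.left_eq]
    by_contra hc
    have hX := shift_mem_lexShift hx n
    exact hG n ⟨shift_mem_lexShift hX 1, Or.inl ⟨hn, not_le.1 hc, le_zeroMax hX hn⟩⟩
  · rw [cornerPair, h.right_eq]
    by_contra hc
    have hX := shift_mem_lexShift hx n
    exact hG n ⟨shift_mem_lexShift hX 1, Or.inr ⟨hn, oneMin_le hX hn, not_le.1 hc⟩⟩

theorem right_second (h : InBox α β ω ν) : periodicSeq ν 1 = false := h.corner.head_min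

theorem one_lt_right (h : InBox α β ω ν) : 1 < ν.length := by
  have h1 := h.right_second
  have h0 := h.right_head
  have hpos := List.length_pos_iff.2 h.right_ne
  by_contra hc
  have hl : ν.length = 1 := by omega
  have := periodicSeq_add_length ν 0
  rw [hl] at this
  simp [h1, h0] at this

/-- A preimage of a point of the essential component respects the lower bound of the component.
Otherwise the digit `1` followed by this preimage would lie in the excess, and the removal of `ν`
would lead to a point in both the excess and the component. -/
theorem le_of_shift_mem (h : InBox α β ω ν) (hx : x ∈ lexShift α β)
    (hs : shift x ∈ essentialComponent ω ν) : shift (periodicSeq ν) ≤ₗ x := by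
  by_contra hc
  have h1 : prepend [true] x <ₗ periodicSeq ν := by
    rw [← h.right_eq, prepend_lt_prepend]; exact not_le.1 hc
  have h2 : prepend [true] β ≤ₗ prepend [true] x := prepend_le_prepend.2 (min_le hx)
  have h3 := h.right_lt.trans_le h2
  rw [← periodicSeq_eq_prepend] at h1
  -- the digit `1` in front of `x` begins a copy of `ν`
  have hocc : OccursAt ν (prepend [true] x) 0 := fun i hi => by
    rw [Nat.zero_add, agree_of_between (n := ν.length) (fun i hi => by
      rw [prepend_lt hi, prepend_lt hi]) h3.le h1.le i hi, prepend_lt hi]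
  rw [occursAt_zero_iff_prepend.1 hocc] at h1 h3
  replace h1 := prepend_lt_prepend.1 h1
  replace h3 := prepend_lt_prepend.1 h3
  obtain ⟨n, hn⟩ := Nat.exists_eq_add_of_le' h.one_lt_right
  have hmem : shift^[ν.length] (prepend [true] x) ∈ essentialComponent ω ν := by
    rw [hn, Function.iterate_succ_apply, shift_prepend_singleton, Function.iterate_succ_apply]
    exact shift_mem_lexShift hs n
  have h4 := h.notMem_excess hmem
  have hX := h.essentialComponent_subset hmem
  refine h4 ⟨shift_mem_lexShift hX 1, ?_⟩
  cases h0 : shift^[ν.length] (prepend [true] x) 0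
  · exact Or.inl ⟨rfl, h3, le_zeroMax hX h0⟩
  · exact Or.inr ⟨rfl, oneMin_le hX h0, h1⟩

/-- The essential component is backward invariant in `Σ_(α,β)`. -/
theorem mem_of_shift_mem (h : InBox α β ω ν) (hx : x ∈ lexShift α β)
    (hs : shift x ∈ essentialComponent ω ν) : x ∈ essentialComponent ω ν := by
  cases h0 : x 0
  · refine LexShift.mem_of_shift_mem hs (h.le_of_shift_mem hx hs) (lt_of_head h0 ?_).le
    exact h.corner.head_max
  · refine LexShift.mem_of_shift_mem hs (lt_of_head h.corner.head_min h0).le ?_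
    have := h.mirror.le_of_shift_mem (mirror_mem_lexShift.2 hx)
      (by rw [shift_mirror_one]; exact (mirror_essentialComponent h.left_ne h.right_ne).2 hs)
    rwa [periodicSeq_map_not h.left_ne, shift_mirror_one, mirror_le] at this

theorem mem_of_shift_iterate_mem (h : InBox α β ω ν) (hx : x ∈ lexShift α β) (n : ℕ)
    (hs : shift^[n] x ∈ essentialComponent ω ν) : x ∈ essentialComponent ω ν := by
  induction n with
  | zero => exact hs
  | succ n ih =>
    rw [shift_succ] at hs
    exact ih (h.mem_of_shift_mem (shift_mem_lexShift hx n) hs)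

theorem ne_true (h : InBox α β ω ν) (hx : x ∈ lexShift α β) : ∃ k, x k = false := by
  by_contra! hc
  have hx1 : x = fun _ => true := funext fun k => by simpa using hc k
  have h1 := h.left_lt
  have h2 : prepend ω (periodicSeq ν) 0 = false := by
    rw [prepend_lt (List.length_pos_iff.2 h.left_ne), ← periodicSeq_lt, h.left_head]
  rw [eq_prepend_of_head h2, prepend_lt_prepend] at h1
  have h3 := (le_max hx).trans_lt h1
  rw [hx1] at h3
  exact absurd h3 (le_true _).not_gt

theorem ne_false (h : InBox α β ω ν) (hx : x ∈ lexShift α β) : ∃ k, x k = true := by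
  obtain ⟨k, hk⟩ := h.mirror.ne_true (mirror_mem_lexShift.2 hx)
  exact ⟨k, by simpa [LexShift.mirror] using hk⟩

/-- Every orbit ends up either in the excess or in the essential component. -/
theorem exists_tail (h : InBox α β ω ν) (hx : x ∈ lexShift α β) :
    x ∈ essentialComponent ω ν ∨ ∃ k, shift^[k] x ∈ excess α β ω ν := by
  by_cases hG : ∃ k, shift^[k] x ∈ excess α β ω ν
  · exact Or.inr hG
  push Not at hG
  left
  -- behind a change of digits an orbit that avoids the excess lies between the bounds of the
  -- essential component; the initial part is added by backward invariance
  obtain ⟨k, hk⟩ : ∃ k, x k ≠ x (k + 1) := by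
    by_contra! hc
    have hconst : ∀ k, x k = x 0 := fun k => by
      induction k with
      | zero => rfl
      | succ k ih => rw [← hc, ih]
    obtain ⟨i, hi⟩ := h.ne_true hx
    obtain ⟨j, hj⟩ := h.ne_false hx
    rw [hconst, ← hconst j, hj] at hi
    simp at hi
  refine h.mem_of_shift_iterate_mem hx (k + 1) ?_
  have hX := shift_mem_lexShift hx k
  have hX' := shift_mem_lexShift hx (k + 1)
  have hGk := hG k
  have h1 : shift^[k + 1] x 0 = x (k + 1) := shift_iterate_zero _ _
  have h0 : shift^[k] x 0 = x k := shift_iterate_zero _ _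
  have hG' : ∀ j, shift^[j] (shift^[k + 1] x) ∉ excess α β ω ν := fun j => by
    rw [shift_shift]; exact hG _
  cases hxk : x k
  · have hxk1 : x (k + 1) = true := by rw [hxk] at hk; simpa using hk.symm
    refine h.mem_of_avoids hX' (lt_of_head h.corner.head_min (h1.trans hxk1)).le ?_ hG'
    by_contra hc
    refine hGk ⟨shift_mem_lexShift hX 1, Or.inl ⟨h0.trans hxk, ?_,
      le_zeroMax hX (h0.trans hxk)⟩⟩
    rw [← h.left_eq, eq_prepend_of_head (h0.trans hxk), prepend_lt_prepend, ← shift_succ]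
    exact not_le.1 hc
  · have hxk1 : x (k + 1) = false := by rw [hxk] at hk; simpa using hk.symm
    refine h.mem_of_avoids hX' ?_ (lt_of_head (h1.trans hxk1) h.corner.head_max).le hG'
    by_contra hc
    refine hGk ⟨shift_mem_lexShift hX 1, Or.inr ⟨h0.trans hxk,
      oneMin_le hX (h0.trans hxk), ?_⟩⟩
    rw [← h.right_eq, eq_prepend_of_head (h0.trans hxk), prepend_lt_prepend, ← shift_succ]
    exact not_le.1 hc

end InBox

/-! ### Balance in the essential component -/

/-- An upper bound `c / d` for the proportions of ones in `ω` and `ν` is inherited by their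
concatenations, up to a bounded error. -/
theorem IsConcat.ones_le (hω : ω ≠ []) (hν : ν ≠ []) (h : IsConcat ω ν s x) {c d : ℕ}
    (hl : d * ones (periodicSeq ω) ω.length ≤ c * ω.length)
    (hr : d * ones (periodicSeq ν) ν.length ≤ c * ν.length) (n : ℕ) :
    d * ones x n ≤ c * n + d * (ω.length + ν.length) := by
  have key : ∀ k, d * ones x (substWord ω ν s k).length ≤ c * (substWord ω ν s k).length := by
    intro k
    induction k with
    | zero => simp [substWord_zero]
    | succ k ih =>
      rw [substWord_succ, List.length_append, ones_add, Nat.mul_add, Nat.mul_add]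
      refine Nat.add_le_add ih ?_
      have h1 := (h.shift k) 1
      rw [substWord_one, shift_iterate_zero] at h1
      have h2 : ones (LexShift.shift^[(substWord ω ν s k).length] x) (block ω ν (s k)).length =
          ones (periodicSeq (block ω ν (s k))) (block ω ν (s k)).length := by
        refine ones_congr fun i hi => ?_
        rw [periodicSeq_lt hi, ← h1 i hi, Nat.zero_add]
      rw [h2]
      cases s k
      · exact hl
      · exact hr
  obtain ⟨k, r, rfl, hr⟩ := exists_block hω hν s n
  have h1 : r ≤ ω.length + ν.length := by
    have : (block ω ν (s k)).length ≤ ω.length + ν.length := by cases s k <;> simp [block]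
    omega
  have h2 := _root_.LexShift.ones_le (LexShift.shift^[(substWord ω ν s k).length] x) r
  have h3 := key k
  have h4 := Nat.mul_le_mul_left d (h2.trans h1)
  rw [ones_add, Nat.mul_add, Nat.mul_add]
  omega

theorem ones_mul_period {x : BinSeq} {p : ℕ} (h : shift^[p] x = x) (k : ℕ) :
    ones x (p * k) = ones x p * k := by
  induction k with
  | zero => simp
  | succ k ih => rw [Nat.mul_succ, ones_add, ih, iterate_mul_period h, Nat.mul_succ]

theorem hasFrequency_of_period {x : BinSeq} {p : ℕ} (hp : 0 < p) (h : shift^[p] x = x) :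
    HasFrequency p (ones x p) x := hasFrequency_of_multiples hp (ones_mul_period h)

theorem ones_le_of_hasFrequency {x z : BinSeq} {p c D : ℕ} (hp : 0 < p) (hz : HasFrequency p c z)
    (h : ∀ n, p * ones x n ≤ c * n + D) : ∃ C, ∀ n, ones x n ≤ ones z n + C := by
  obtain ⟨C, hC⟩ := hz
  refine ⟨C + D, fun n => ?_⟩
  have h1 := (hC n).2
  have h2 := h n
  by_contra hc
  have h3 : ones z n + (C + D) + 1 ≤ ones x n := by omega
  have h4 := Nat.mul_le_mul_left p h3
  have h5 : C + D + 1 ≤ p * (C + D + 1) := Nat.le_mul_of_pos_left _ hp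
  have h6 : p * (ones z n + (C + D) + 1) = p * ones z n + p * (C + D + 1) := by ring
  omega

/-- Up to a bounded error, no point of `Σ_(α,β)` has more ones than some point of the essential
component: the points outside end with concatenations of `ω` and `ν`. -/
theorem InBox.exists_ones_le (h : InBox α β ω ν) (hx : x ∈ lexShift α β) :
    ∃ z ∈ essentialComponent ω ν, ∃ C, ∀ n, ones x n ≤ ones z n + C := by
  rcases h.exists_tail hx with hx' | ⟨k, hk⟩
  · exact ⟨x, hx', 0, fun n => le_rfl⟩
  obtain ⟨s, -, hs⟩ := h.exists_concat hk
  have hωp := List.length_pos_iff.2 h.left_ne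
  have hνp := List.length_pos_iff.2 h.right_ne
  suffices hz : ∃ z ∈ essentialComponent ω ν, ∃ C, ∀ n, ones (shift^[k] x) n ≤ ones z n + C by
    obtain ⟨z, hz, C, hC⟩ := hz
    refine ⟨z, hz, k + C, fun n => ?_⟩
    have h1 := ones_mono x (Nat.le_add_left n k)
    rw [ones_add] at h1
    have h2 := ones_le x k
    have h3 := hC n
    omega
  -- the denser of the two words dominates
  rcases le_total (ω.length * ones (periodicSeq ν) ν.length)
    (ones (periodicSeq ω) ω.length * ν.length) with hle | hle
  · exact ⟨_, h.left_mem, ones_le_of_hasFrequency hωp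
      (hasFrequency_of_period hωp (shift_periodicSeq ω))
      (hs.ones_le h.left_ne h.right_ne (by rw [Nat.mul_comm]) hle)⟩
  · exact ⟨_, h.right_mem, ones_le_of_hasFrequency hνp
      (hasFrequency_of_period hνp (shift_periodicSeq ν))
      (hs.ones_le h.left_ne h.right_ne (by linarith) (by rw [Nat.mul_comm]))⟩

/-- The essential component inherits unbalancedness, which makes it accessible to the transitivity
criterion. -/
theorem InBox.unbalanced (h : InBox α β ω ν) (hU : Unbalanced (lexShift α β)) :
    Unbalanced (essentialComponent ω ν) := by
  obtain ⟨x, hx, y, hy, hxy⟩ := hU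
  obtain ⟨x', hx', C, hC⟩ := h.exists_ones_le hx
  obtain ⟨y', hy', D, hD⟩ := h.mirror.exists_ones_le (mirror_mem_lexShift.2 hy)
  rw [← mirror_mirror y', mirror_essentialComponent h.left_ne h.right_ne] at hy'
  refine ⟨x', hx', _, hy', fun E => ?_⟩
  obtain ⟨n, hn⟩ := hxy (C + D + E)
  refine ⟨n, ?_⟩
  have h1 := hC n
  have h2 := hD n
  have h3 := ones_mirror y n
  have h4 := ones_mirror y' n
  omega

end

/-! ### The essential component -/

section

variable {α β : BinSeq} {ω ν : List Bool} {s x y : BinSeq}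

theorem IsEssentialWordPair.not_renormalisable (h : IsEssentialWordPair ω ν) :
    ¬ Renormalisable (shift (periodicSeq ω)) (shift (periodicSeq ν)) := by
  obtain ⟨α', β', ⟨-, h, -, -⟩, hω, hν⟩ := h
  rwa [hω.2.1, hν.2.1, shift_prepend_singleton, shift_prepend_singleton]

theorem IsTransitiveSubsystem.shift_mem {S A : Set BinSeq} (h : IsTransitiveSubsystem S A) :
    ∀ x ∈ A, shift x ∈ A := fun _ hx => h.2.2.2.1 ▸ mem_image_of_mem _ hx

theorem shift_iterate_mem {A : Set BinSeq} (h : ∀ x ∈ A, shift x ∈ A) (hx : x ∈ A) (n : ℕ) :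
    shift^[n] x ∈ A := by
  induction n with
  | zero => exact hx
  | succ n ih => rw [shift_succ]; exact h _ ih

theorem pre_mem_language {A : Set BinSeq} (hx : x ∈ A) (n : ℕ) : pre x n ∈ language A :=
  ⟨x, hx, 0, occursAt_zero_iff.2 (by rw [length_pre])⟩

theorem language_mono {A C : Set BinSeq} (h : A ⊆ C) : language A ⊆ language C :=
  fun _ ⟨x, hx, hw⟩ => ⟨x, h hx, hw⟩

theorem mem_of_pre_mem_language {A : Set BinSeq} (hA : IsClosed A) (hinv : ∀ x ∈ A, shift x ∈ A)
    (h : ∀ n, pre x n ∈ language A) : x ∈ A := by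
  refine agree_of_isClosed hA fun n => ?_
  obtain ⟨y, hy⟩ := (mem_language_iff hinv).1 (h n)
  exact ⟨_, hy, fun i hi => (prepend_pre_lt hi).symm⟩

theorem shift_mem_essentialComponent : ∀ x ∈ essentialComponent ω ν,
    shift x ∈ essentialComponent ω ν := fun _ hx => shift_mem_lexShift hx 1

theorem prepend_pre_append {w : List Bool} {N : ℕ} :
    prepend (w ++ pre y N) (shift^[N] y) = prepend w y := by
  rw [prepend_append, prepend_pre_shift]

theorem pre_prepend (w : List Bool) (y : BinSeq) : pre (prepend w y) w.length = w := by
  rw [← occursAt_zero_iff]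
  intro i hi
  rw [Nat.zero_add, prepend_lt hi]

/-- A word of `Σ_(α,β)` that ends with a long word of the essential component belongs to the
essential component. -/
theorem InBox.exists_prepend_mem (h : InBox α β ω ν) (hG : Glues (lexShift α β)) :
    ∃ N, ∀ (w : List Bool) (y : BinSeq), y ∈ essentialComponent ω ν →
      w ++ pre y N ∈ language (lexShift α β) → prepend w y ∈ essentialComponent ω ν := by
  obtain ⟨N, hN⟩ := hG
  refine ⟨N, fun w y hy hw => ?_⟩
  obtain ⟨z, hz⟩ := (mem_language_iff fun x hx => shift_mem_lexShift hx 1).1 hw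
  have h1 := hN _ hz y (h.essentialComponent_subset hy) w.length 0 fun k hk => by
    rw [prepend_append, prepend_ge, prepend_pre_lt hk, Nat.zero_add]
  rw [prepend_append, pre_prepend] at h1
  refine h.mem_of_shift_iterate_mem h1 w.length ?_
  rw [shift_prepend]
  exact hy

/-- Transitivity comes from non-renormalisability of the corner, maximality from backward
invariance: in a larger transitive set every word is followed by long words of `ω^∞`, which only
happens inside the essential component. -/
theorem InBox.isTransitiveComponent (h : InBox α β ω ν) (hE : IsEssentialWordPair ω ν)
    (hU : Unbalanced (lexShift α β)) (hG : Glues (lexShift α β)) :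
    IsTransitiveComponent (lexShift α β) (essentialComponent ω ν) := by
  have hU' : Unbalanced (lexShift (shift (periodicSeq ω)) (shift (periodicSeq ν))) :=
    h.unbalanced hU
  have hT : IsTransitive (essentialComponent ω ν) :=
    isTransitive_lexShift h.corner (List.length_pos_iff.2 h.left_ne)
      (by rw [cornerPair, h.left_eq, shift_periodicSeq]) (List.length_pos_iff.2 h.right_ne)
      (by rw [cornerPair, h.right_eq, shift_periodicSeq]) hU' hE.not_renormalisable
  refine ⟨⟨h.essentialComponent_subset, ⟨_, h.left_mem⟩, isClosed_lexShift, ?_, hT⟩, ?_⟩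
  · refine Subset.antisymm ?_ fun y hy => ?_
    · rintro _ ⟨x, hx, rfl⟩
      exact shift_mem_essentialComponent x hx
    · exact exists_preimage h.corner (hU'.shift_min_le_shift_max h.corner) hy
  · intro C hC hAC
    refine Subset.antisymm (fun c hc => ?_) hAC
    obtain ⟨N, hN⟩ := h.exists_prepend_mem hG
    refine mem_of_pre_mem_language isClosed_lexShift shift_mem_essentialComponent fun n => ?_
    obtain ⟨b, -, hb⟩ := hC.2.2.2.2 _ (pre_mem_language hc n) _
      (language_mono hAC (pre_mem_language h.left_mem N))
    have := hN _ _ h.left_mem (language_mono hC.1 hb)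
    rw [prepend_append] at this
    exact (mem_language_iff shift_mem_essentialComponent).2 ⟨_, this⟩

theorem InBox.inter_preimage (h : InBox α β ω ν) :
    lexShift α β ∩ shift ⁻¹' essentialComponent ω ν = essentialComponent ω ν :=
  Subset.antisymm (fun _ hx => h.mem_of_shift_mem hx.1 hx.2) fun x hx =>
    ⟨h.essentialComponent_subset hx, shift_mem_essentialComponent x hx⟩

/-! ### Words of `Σ_(α,β)` -/

theorem renewal_shift_mem : ∀ x ∈ renewal ω ν, shift x ∈ renewal ω ν := by
  rintro _ ⟨s, y, k, hs, rfl⟩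
  exact ⟨s, y, k + 1, hs, (shift_succ k y).symm⟩

theorem InBox.mem_renewal (h : InBox α β ω ν) (hy : y ∈ excess α β ω ν) : y ∈ renewal ω ν := by
  obtain ⟨s, -, hs⟩ := h.exists_concat hy
  exact ⟨s, y, 0, hs, rfl⟩

/-- A point below the lower bound of the essential component becomes a point of the excess when the
digit `1` is put in front of it. -/
theorem InBox.mem_renewal_of_lt (h : InBox α β ω ν) (hx : x ∈ lexShift α β)
    (hlt : x <ₗ shift (periodicSeq ν)) : x ∈ renewal ω ν := by
  have h1 : prepend [true] x ∈ excess α β ω ν := by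
    refine ⟨by simpa using hx, Or.inr ⟨by simp, prepend_le_prepend.2 (min_le hx), ?_⟩⟩
    rw [← h.right_eq, prepend_lt_prepend]
    exact hlt
  simpa using renewal_shift_mem _ (h.mem_renewal h1)

theorem InBox.mem_renewal_of_gt (h : InBox α β ω ν) (hx : x ∈ lexShift α β)
    (hlt : shift (periodicSeq ω) <ₗ x) : x ∈ renewal ω ν := by
  have h1 : prepend [false] x ∈ excess α β ω ν := by
    refine ⟨by simpa using hx, Or.inl ⟨by simp, ?_, prepend_le_prepend.2 (le_max hx)⟩⟩
    rw [← h.left_eq, prepend_lt_prepend]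
    exact hlt
  simpa using renewal_shift_mem _ (h.mem_renewal h1)

/-- The word that precedes the first visit of the excess belongs to the essential component: the
tail from this visit on can be replaced by `ω^∞`, the largest point of the component that starts
with `0`. -/
theorem InBox.prepend_pre_left_mem (h : InBox α β ω ν) (hx : x ∈ lexShift α β)
    (hβ : shift (periodicSeq ν) ≤ₗ x) (hα : x ≤ₗ shift (periodicSeq ω)) {k : ℕ}
    (hk : shift^[k] x ∈ excess α β ω ν) (hmin : ∀ l < k, shift^[l] x ∉ excess α β ω ν)
    (hk0 : shift^[k] x 0 = false) :
    prepend (pre x k) (periodicSeq ω) ∈ essentialComponent ω ν := by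
  have hlt : periodicSeq ω <ₗ shift^[k] x := by
    rcases hk.2 with ⟨-, h1, -⟩ | ⟨h1, -⟩
    · exact h1
    · simp [hk0] at h1
  have hup : ∀ l ≤ k, prepend (pre (shift^[l] x) (k - l)) (periodicSeq ω) ≤ₗ shift^[l] x := by
    intro l hl
    conv_rhs => rw [← prepend_pre_shift (shift^[l] x) (k - l)]
    rw [prepend_le_prepend, shift_shift, Nat.sub_add_cancel hl]
    exact hlt.le
  have hlow : ∀ l ≤ k, ∀ t ∈ essentialComponent ω ν, t ≤ₗ shift^[l] x →
      t ≤ₗ prepend (pre (shift^[l] x) (k - l)) (periodicSeq ω) := by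
    intro l hl t ht htx
    by_contra hc
    have hag := agree_of_between (n := k - l) (fun i hi => prepend_pre_lt hi) (not_le.1 hc).le htx
    have h1 := (le_iff_shift fun i hi => (hag i hi).trans (prepend_pre_lt hi)).1 htx
    have h2 := (lt_iff_shift fun i hi => (hag i hi).symm).1 (not_le.1 hc)
    rw [shift_shift, Nat.sub_add_cancel hl] at h1
    rw [shift_prepend_pre] at h2
    have h3 := le_zeroMax (shift_mem_lexShift ht (k - l)) (head_of_le' h1 hk0)
    rw [cornerPair, h.left_eq] at h3
    exact absurd h2 h3.not_gt
  have hup0 := hup 0 (Nat.zero_le _)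
  have hlow0 := hlow 0 (Nat.zero_le _) _ h.corner.min_mem hβ
  refine mem_lexShift_of_tails hlow0 (hup0.trans hα) (fun l hl => ?_) fun l hl => ?_
  all_goals
    rcases le_or_gt k l with hkl | hkl
    · obtain ⟨r, rfl⟩ := Nat.exists_eq_add_of_le hkl
      rw [Nat.add_comm, ← shift_shift, shift_prepend_pre] at hl ⊢
      have hr := shift_mem_lexShift h.left_mem r
      first
      | exact le_zeroMax hr hl
      | exact oneMin_le hr hl
    have hX := shift_mem_lexShift hx l
    rw [shift_prepend_pre_of_le hkl.le] at hl ⊢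
    rw [prepend_pre_lt (by omega)] at hl
    have hE := hmin l hkl
  · refine (hup l hkl.le).trans ?_
    rw [cornerPair, h.left_eq]
    by_contra hc
    exact hE ⟨shift_mem_lexShift hX 1, Or.inl ⟨hl, not_le.1 hc, le_zeroMax hX hl⟩⟩
  · refine hlow l hkl.le _ h.corner.oneMin_mem ?_
    rw [cornerPair, h.right_eq]
    by_contra hc
    exact hE ⟨shift_mem_lexShift hX 1, Or.inr ⟨hl, oneMin_le hX hl, not_le.1 hc⟩⟩

/-- Both cases of `InBox.prepend_pre_left_mem` and its mirror image. -/
theorem InBox.pre_mem_of_first_visit (h : InBox α β ω ν) (hx : x ∈ lexShift α β)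
    (hβ : shift (periodicSeq ν) ≤ₗ x) (hα : x ≤ₗ shift (periodicSeq ω)) {k : ℕ}
    (hk : shift^[k] x ∈ excess α β ω ν) (hmin : ∀ l < k, shift^[l] x ∉ excess α β ω ν) :
    pre x k ∈ language (essentialComponent ω ν) := by
  refine (mem_language_iff shift_mem_essentialComponent).2 ?_
  cases hk0 : shift^[k] x 0
  · exact ⟨_, h.prepend_pre_left_mem hx hβ hα hk hmin hk0⟩
  · have := h.mirror.prepend_pre_left_mem (mirror_mem_lexShift.2 hx)
      (by rw [periodicSeq_map_not h.left_ne, shift_mirror_one, mirror_le]; exact hα)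
      (by rw [periodicSeq_map_not h.right_ne, shift_mirror_one, mirror_le]; exact hβ)
      (k := k) (by rw [shift_mirror, mirror_mem_excess h.left_ne h.right_ne]; exact hk)
      (fun l hl => by rw [shift_mirror, mirror_mem_excess h.left_ne h.right_ne]; exact hmin l hl)
      (by rw [shift_mirror]; simp [LexShift.mirror, hk0])
    rw [periodicSeq_map_not h.right_ne, ← mirror_pre, ← mirror_prepend,
      mirror_essentialComponent h.left_ne h.right_ne] at this
    exact ⟨_, this⟩

/-- A word of `Σ_(α,β)` is a word of the essential component followed by a word of the renewal
system. -/
theorem InBox.pre_decomposition (h : InBox α β ω ν) (hx : x ∈ lexShift α β) (n : ℕ) :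
    ∃ k ≤ n, pre x k ∈ language (essentialComponent ω ν) ∧
      pre (shift^[k] x) (n - k) ∈ language (renewal ω ν) := by
  classical
  have hnil : ∀ x : BinSeq, pre x (n - n) ∈ language (renewal ω ν) := fun x => by
    rw [Nat.sub_self]
    exact pre_mem_language (A := renewal ω ν) (x := periodicSeq ω)
      ⟨_, _, 0, isConcat_periodicSeq false, rfl⟩ 0
  have hnil' : pre x 0 ∈ language (essentialComponent ω ν) := pre_mem_language h.left_mem 0
  rcases lt_or_ge (toLex x) (toLex (shift (periodicSeq ν))) with h1 | h1
  · exact ⟨0, Nat.zero_le _, hnil', pre_mem_language (h.mem_renewal_of_lt hx h1) _⟩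
  rcases lt_or_ge (toLex (shift (periodicSeq ω))) (toLex x) with h2 | h2
  · exact ⟨0, Nat.zero_le _, hnil', pre_mem_language (h.mem_renewal_of_gt hx h2) _⟩
  by_cases hex : ∃ k, shift^[k] x ∈ excess α β ω ν
  · have hk := Nat.find_spec hex
    have hpre := h.pre_mem_of_first_visit hx h1 h2 hk fun l hl => Nat.find_min hex hl
    rcases le_or_gt (Nat.find hex) n with hn | hn
    · exact ⟨_, hn, hpre, pre_mem_language (h.mem_renewal hk) _⟩
    · refine ⟨n, le_rfl, ?_, hnil _⟩
      obtain ⟨y, hy, j, hj⟩ := hpre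
      refine ⟨y, hy, j, fun i hi => ?_⟩
      simp only [length_pre] at hi
      rw [hj i (by rw [length_pre]; omega), getElem_pre, getElem_pre]
  · push Not at hex
    exact ⟨n, le_rfl, pre_mem_language (h.mem_of_avoids hx h1 h2 hex) n, hnil _⟩

/-! ### Other transitive components -/

section other

variable {C : Set BinSeq}

/-- Another transitive component meets the excess; otherwise it would be contained in the essential
component. -/
theorem InBox.exists_excess (h : InBox α β ω ν) (hC : IsTransitiveComponent (lexShift α β) C)
    (hne : C ≠ essentialComponent ω ν) (hA : IsTransitiveSubsystem (lexShift α β)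
      (essentialComponent ω ν)) : ∃ y ∈ C, y ∈ excess α β ω ν := by
  by_contra! hc
  refine hne (hC.2 _ hA fun x hx => ?_).symm
  rcases h.exists_tail (hC.1.1 hx) with h1 | ⟨k, hk⟩
  · exact h1
  · exact absurd hk (hc _ (shift_iterate_mem hC.1.shift_mem hx k))

/-- A prefix of a point of the excess that forces points to be in the excess. -/
theorem exists_forcing_word (hy : y ∈ excess α β ω ν) :
    ∃ n, ∀ z ∈ lexShift α β, (∀ i ≤ n, z i = y i) → z ∈ excess α β ω ν := by
  rcases hy with ⟨-, ⟨h0, h1, -⟩ | ⟨h0, -, h1⟩⟩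
  all_goals
    obtain ⟨d, hd, hd0, hd1⟩ := lt_def.1 h1
    refine ⟨d, fun z hz hzy => ⟨shift_mem_lexShift hz 1, ?_⟩⟩
    have hz0 : z 0 = y 0 := hzy 0 (Nat.zero_le _)
  · refine Or.inl ⟨hz0.trans h0, lt_def.2 ⟨d, fun j hj => ?_, hd0, ?_⟩,
      le_zeroMax hz (hz0.trans h0)⟩
    · rw [hzy j hj.le, hd j hj]
    · rw [hzy d le_rfl, hd1]
  · refine Or.inr ⟨hz0.trans h0, oneMin_le hz (hz0.trans h0), lt_def.2 ⟨d, fun j hj => ?_, ?_, hd1⟩⟩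
    · rw [hzy j hj.le, hd j hj]
    · rw [hzy d le_rfl, hd0]

/-- In a transitive set that meets the excess, every word is preceded by a word that forces the
excess. -/
theorem exists_bridge (hC : IsTransitiveSubsystem (lexShift α β) C)
    (hy : y ∈ C) (hyE : y ∈ excess α β ω ν) {v : List Bool} (hv : v ∈ language C) :
    ∃ b z, prepend (b ++ v) z ∈ C ∧ prepend (b ++ v) z 0 = y 0 ∧
      ∀ z', prepend (b ++ v) z' ∈ lexShift α β → prepend (b ++ v) z' ∈ excess α β ω ν := by
  obtain ⟨n, hn⟩ := exists_forcing_word hyE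
  obtain ⟨b, -, hb⟩ := hC.2.2.2.2 _ (pre_mem_language hy (n + 1)) v hv
  obtain ⟨z, hz⟩ := (mem_language_iff hC.shift_mem).1 hb
  have hag : ∀ z', ∀ i ≤ n, prepend (pre y (n + 1) ++ b ++ v) z' i = y i := fun z' i hi => by
    rw [List.append_assoc, prepend_append, prepend_pre_lt (by omega)]
  exact ⟨pre y (n + 1) ++ b, z, hz, hag z 0 (Nat.zero_le _), fun z' hz' => hn _ hz' (hag z')⟩

/-- Long words of `ω^∞` do not occur in a transitive set that meets the excess: behind a word that
forces the excess they could be continued to `ω^∞`, which lies in the essential component. -/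
theorem InBox.exists_pre_left_notMem (h : InBox α β ω ν) (hG : Glues (lexShift α β))
    (hC : IsTransitiveSubsystem (lexShift α β) C) (hy : y ∈ C) (hyE : y ∈ excess α β ω ν) :
    ∃ N, pre (periodicSeq ω) N ∉ language C := by
  obtain ⟨N, hN⟩ := h.exists_prepend_mem hG
  refine ⟨N, fun hc => ?_⟩
  obtain ⟨b, z, hz, -, hE⟩ := exists_bridge hC hy hyE hc
  have h1 := hN b _ h.left_mem ((mem_language_iff fun x hx => shift_mem_lexShift hx 1).2
    ⟨z, hC.1 hz⟩)
  rw [← prepend_pre_append (N := N)] at h1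
  exact h.notMem_excess h1 (hE _ (h.essentialComponent_subset h1))

/-- Words of another transitive component occur in concatenations of `ω` and `ν` that begin with
`ν` and in which the number of consecutive `ω` is bounded. -/
theorem InBox.exists_bounded_runs (h : InBox α β ω ν) (hG : Glues (lexShift α β))
    (hC : IsTransitiveComponent (lexShift α β) C) (hne : C ≠ essentialComponent ω ν)
    (hA : IsTransitiveSubsystem (lexShift α β) (essentialComponent ω ν)) :
    ∃ M, ∀ v ∈ language C, ∃ s y, IsConcat ω ν s y ∧ IsFactor v y ∧ s 0 = true ∧
      ∀ k, ∃ i ≤ M, s (k + i) = true := by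
  obtain ⟨y₀, hy₀, hyE₀⟩ := h.exists_excess hC hne hA
  obtain ⟨N, hN⟩ := h.exists_pre_left_notMem hG hC.1 hy₀ hyE₀
  have hruns : ∀ s, ∀ y ∈ C, IsConcat ω ν s y → ∀ k, ∃ i ≤ N, s (k + i) = true := by
    intro s y hy hs k
    by_contra! hc
    refine hN ⟨_, shift_iterate_mem hC.1.shift_mem hy (substWord ω ν s k).length, 0,
      fun i hi => ?_⟩
    rw [length_pre] at hi
    have h1 := hs.shift k
    have h2 := h1 N
    have h3 : substWord ω ν (shift^[k] s) N = substWord ω ν (fun _ => false) N :=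
      substWord_congr fun i hi => by
        rw [shift_iterate]; simpa using hc i hi.le
    have hl := le_length_substWord (s := fun _ => false) h.left_ne h.right_ne N
    rw [h3] at h2
    rw [h2 i (by omega), getElem_pre]
    have h4 := (isConcat_periodicSeq (ω := ω) (ν := ν) false) N i (by omega)
    rw [Nat.zero_add] at h4
    exact h4.symm
  -- strip the leading words `ω`
  obtain ⟨y₁, hy₁, hyE₁, hy₁0⟩ : ∃ y ∈ C, y ∈ excess α β ω ν ∧ y 0 = true := by
    obtain ⟨s, hs0, hs⟩ := h.exists_concat hyE₀
    have key : ∀ k, shift^[(substWord ω ν s k).length] y₀ ∈ excess α β ω ν := by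
      intro k
      induction k with
      | zero => simpa [substWord_zero] using hyE₀
      | succ k ih =>
        have h1 := (h.strip ih).2
        have h2 := (hs.shift k).head h.left_head h.left_ne h.right_head
        rw [h2, shift_shift, shift_iterate_zero k s, Nat.add_comm] at h1
        rwa [substWord_succ, List.length_append]
    obtain ⟨i, -, hi⟩ := hruns s y₀ hy₀ hs 0
    refine ⟨_, shift_iterate_mem hC.1.shift_mem hy₀ _, key i, ?_⟩
    rw [(hs.shift i).head h.left_head h.left_ne h.right_head, shift_iterate_zero, ← hi,
      Nat.zero_add]
  refine ⟨N, fun v hv => ?_⟩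
  obtain ⟨b, z, hz, hz0, hzE⟩ := exists_bridge hC.1 hy₁ hyE₁ hv
  obtain ⟨s, hs0, hs⟩ := h.exists_concat (hzE z (hC.1.1 hz))
  refine ⟨s, _, hs, ⟨b.length, fun i hi => ?_⟩, by rw [hs0, hz0, hy₁0], hruns s _ hz hs⟩
  rw [prepend_append, prepend_ge, prepend_lt hi]

end other

end

/-! ### Entropy and exponential bounds -/

section

variable {A : Set BinSeq} {ω ν U V : List Bool} {s x y : BinSeq}

theorem ncard_length_le {S : Set (List Bool)} {n : ℕ} (h : ∀ w ∈ S, w.length = n) :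
    S.Finite ∧ S.ncard ≤ 2 ^ n := by
  have hsub : S ⊆ (fun f : Fin n → Bool => List.ofFn f) '' univ := by
    intro w hw
    have hl := h w hw
    subst hl
    exact ⟨w.get, mem_univ _, List.ofFn_get w⟩
  refine ⟨(toFinite _).subset hsub, ?_⟩
  calc S.ncard ≤ ((fun f : Fin n → Bool => List.ofFn f) '' univ).ncard :=
        ncard_le_ncard hsub (toFinite _)
    _ ≤ (univ : Set (Fin n → Bool)).ncard := ncard_image_le
    _ = 2 ^ n := by simp [ncard_univ]

theorem ncard_words_le (n : ℕ) : (words A n).ncard ≤ 2 ^ n :=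
  (ncard_length_le fun _ hw => hw.2).2

theorem ncard_words_pos (hA : A.Nonempty) (n : ℕ) : (0 : ℝ) < (words A n).ncard := by
  exact_mod_cast (Set.ncard_pos (words_finite A n)).2 (words_nonempty hA n)

/-- An upper bound for the entropy; the linear factor in the bound does not matter. -/
theorem entropy_le_of_bound (hA : A.Nonempty) {c K : ℝ} (hc : 0 < c) (hK : 0 < K)
    (h : ∀ n : ℕ, ((words A n).ncard : ℝ) ≤ K * (n + 1) * c ^ n) : entropy A ≤ Real.logb 2 c := by
  have h2 : Tendsto (fun n : ℕ => Real.logb 2 K / n) atTop (𝓝 0) :=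
    tendsto_const_nhds.div_atTop tendsto_natCast_atTop_atTop
  have h3 : Tendsto (fun n : ℕ => Real.logb 2 (n + 1) / n) atTop (𝓝 0) := by
    have h4 := (Real.tendsto_pow_log_div_mul_add_atTop 1 (-1) 1 one_ne_zero).comp
      (tendsto_atTop_add_const_right atTop (1 : ℝ) tendsto_natCast_atTop_atTop)
    have h5 := h4.div_const (Real.log 2)
    rw [zero_div] at h5
    refine h5.congr fun n => ?_
    simp only [Function.comp, Real.logb]
    ring
  have h6 : Tendsto (fun n : ℕ => Real.logb 2 K / n + Real.logb 2 (n + 1) / n + Real.logb 2 c)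
      atTop (𝓝 (Real.logb 2 c)) := by
    simpa using (h2.add h3).add_const (Real.logb 2 c)
  refine le_of_tendsto_of_tendsto (tendsto_entropy hA) h6 ?_
  filter_upwards [eventually_gt_atTop 0] with n hn
  have hn' : (0 : ℝ) < n := by exact_mod_cast hn
  rw [← add_div, ← sub_le_iff_le_add, le_div_iff₀ hn', sub_mul, div_mul_cancel₀ _ hn'.ne']
  have h7 := Real.logb_le_logb_of_le one_lt_two (ncard_words_pos hA n) (h n)
  rw [Real.logb_mul (by positivity) (by positivity), Real.logb_mul (by positivity) (by positivity),
    Real.logb_pow] at h7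
  linarith

theorem le_entropy_of_bound (hA : A.Nonempty) {c K : ℝ} (hc : 0 < c) (hK : 0 < K)
    (h : ∀ n : ℕ, K * c ^ n ≤ ((words A n).ncard : ℝ)) : Real.logb 2 c ≤ entropy A := by
  have h2 : Tendsto (fun n : ℕ => Real.logb 2 K / n) atTop (𝓝 0) :=
    tendsto_const_nhds.div_atTop tendsto_natCast_atTop_atTop
  have h6 : Tendsto (fun n : ℕ => Real.logb 2 K / n + Real.logb 2 c)
      atTop (𝓝 (Real.logb 2 c)) := by
    simpa using h2.add_const (Real.logb 2 c)
  refine le_of_tendsto_of_tendsto h6 (tendsto_entropy hA) ?_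
  filter_upwards [eventually_gt_atTop 0] with n hn
  have hn' : (0 : ℝ) < n := by exact_mod_cast hn
  rw [le_div_iff₀ hn', add_mul, div_mul_cancel₀ _ hn'.ne']
  have h7 := Real.logb_le_logb_of_le one_lt_two (by positivity) (h n)
  rw [Real.logb_mul (by positivity) (by positivity), Real.logb_pow] at h7
  linarith

theorem exists_bound_of_entropy_lt (hA : A.Nonempty) {c : ℝ} (hc : 1 ≤ c)
    (h : entropy A < Real.logb 2 c) :
    ∃ K : ℝ, 0 < K ∧ ∀ n : ℕ, ((words A n).ncard : ℝ) ≤ K * c ^ n := by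
  have hc0 : 0 < c := by linarith
  obtain ⟨N, hN⟩ := eventually_atTop.1
    (((tendsto_entropy hA).eventually_lt_const h).and (eventually_gt_atTop 0))
  refine ⟨2 ^ N, by positivity, fun n => ?_⟩
  rcases le_or_gt N n with hn | hn
  · have hn' : (0 : ℝ) < n := by exact_mod_cast (hN n hn).2
    have h1 := (hN n hn).1.le
    rw [div_le_iff₀ hn', mul_comm, ← Real.logb_pow,
      Real.logb_le_logb one_lt_two (ncard_words_pos hA n) (by positivity)] at h1
    refine h1.trans (le_mul_of_one_le_left (by positivity) (one_le_pow₀ one_le_two))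
  · have h1 : ((words A n).ncard : ℝ) ≤ 2 ^ n := by exact_mod_cast ncard_words_le n
    have h2 : (2 : ℝ) ^ n ≤ 2 ^ N := pow_le_pow_right₀ one_le_two hn.le
    exact (h1.trans h2).trans (le_mul_of_one_le_right (by positivity) (one_le_pow₀ hc))

theorem entropy_mono {C : Set BinSeq} (hA : A.Nonempty) (h : A ⊆ C) : entropy A ≤ entropy C := by
  refine le_of_tendsto_of_tendsto' (tendsto_entropy hA) (tendsto_entropy (hA.mono h)) fun n => ?_
  refine div_le_div_of_nonneg_right ?_ (Nat.cast_nonneg n)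
  refine Real.logb_le_logb_of_le one_lt_two (ncard_words_pos hA n) ?_
  have hsub : words A n ⊆ words C n := fun w hw => ⟨language_mono h hw.1, hw.2⟩
  exact_mod_cast ncard_le_ncard hsub (words_finite C n)

theorem pow_sub_eq {c : ℝ} (hc : c ≠ 0) {l n : ℕ} (h : l ≤ n) :
    c ^ (n - l) = c ^ n * c⁻¹ ^ l := by
  rw [pow_sub₀ c hc h, inv_pow]

theorem pre_of_occursAt {w : List Bool} (h : OccursAt w y 0) {n : ℕ} (hn : w.length ≤ n) :
    pre y n = w ++ pre (shift^[w.length] y) (n - w.length) := by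
  apply List.ext_getElem
  · simp; omega
  intro i h1 h2
  rw [getElem_pre]
  rcases lt_or_ge i w.length with hi | hi
  · rw [List.getElem_append_left hi, ← h i hi, Nat.zero_add]
  · rw [List.getElem_append_right hi, getElem_pre, shift_iterate, Nat.add_sub_cancel' hi]

theorem pre_append_pre {k n : ℕ} (hk : k ≤ n) :
    pre x k ++ pre (shift^[k] x) (n - k) = pre x n := by
  have := pre_of_occursAt (w := pre x k) (y := x) (occursAt_zero_iff.2 (by rw [length_pre]))
    (n := n) (by simpa using hk)
  rw [this, length_pre]

theorem append_image_injective (w : List Bool) (S : Set (List Bool)) :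
    ((w ++ ·) '' S).ncard = S.ncard :=
  ncard_image_of_injective _ fun _ _ h => List.append_cancel_left h

theorem finite_image_pre (Q : Set BinSeq) (n : ℕ) : ((fun y => pre y n) '' Q).Finite := by
  refine (ncard_length_le (n := n) ?_).1
  rintro _ ⟨y, -, rfl⟩
  exact length_pre y n

/-- An upper bound for the entropy of sequences that are concatenated from finitely many blocks. -/
theorem entropy_le_of_blocks {ι : Type*} [Fintype ι] (b : ι → List Bool) (hb : ∀ i, b i ≠ [])
    {Q : Set BinSeq} (hQ : ∀ y ∈ Q, ∃ i, OccursAt (b i) y 0 ∧ shift^[(b i).length] y ∈ Q)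
    {c : ℝ} (hc : 1 ≤ c) (hsum : ∑ i, c⁻¹ ^ (b i).length ≤ 1) (hA : A.Nonempty)
    (hAQ : ∀ v ∈ language A, ∃ y ∈ Q, IsFactor v y) : entropy A ≤ Real.logb 2 c := by
  have hc0 : 0 < c := by linarith
  set L := ∑ i, (b i).length + 1 with hL
  have hbL : ∀ i, (b i).length < L := fun i =>
    Nat.lt_succ_of_le (Finset.single_le_sum (f := fun i => (b i).length)
      (fun _ _ => Nat.zero_le _) (Finset.mem_univ i))
  -- prefixes of elements of `Q` are counted by their first block, which gives a linear recursion
  have hP : ∀ n, (((fun y => pre y n) '' Q).ncard : ℝ) ≤ 2 ^ L * c ^ n := by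
    intro n
    induction n using Nat.strong_induction_on with
    | _ n ih =>
      rcases lt_or_ge n L with hn | hn
      · have h1 : ((fun y => pre y n) '' Q).ncard ≤ 2 ^ n := by
          refine (ncard_length_le (n := n) ?_).2
          rintro _ ⟨y, -, rfl⟩
          exact length_pre y n
        have h1' : (((fun y => pre y n) '' Q).ncard : ℝ) ≤ 2 ^ n := by exact_mod_cast h1
        have h2 : (2 : ℝ) ^ n ≤ 2 ^ L := pow_le_pow_right₀ one_le_two hn.le
        exact (h1'.trans h2).trans (le_mul_of_one_le_right (by positivity) (one_le_pow₀ hc))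
      · have hsub : (fun y => pre y n) '' Q ⊆
            ⋃ i, (b i ++ ·) '' ((fun y => pre y (n - (b i).length)) '' Q) := by
          rintro _ ⟨y, hy, rfl⟩
          obtain ⟨i, hi, hyi⟩ := hQ y hy
          refine mem_iUnion.2 ⟨i, _, ⟨_, hyi, rfl⟩, ?_⟩
          exact (pre_of_occursAt hi ((hbL i).le.trans hn)).symm
        have hfin : ∀ i, ((b i ++ ·) '' ((fun y => pre y (n - (b i).length)) '' Q)).Finite :=
          fun i => (finite_image_pre Q _).image _
        have h1 := (ncard_le_ncard hsub (finite_iUnion hfin)).trans (ncard_iUnion_le_of_fintype _)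
        have h2 : (((fun y => pre y n) '' Q).ncard : ℝ) ≤
            ∑ i, (((fun y => pre y (n - (b i).length)) '' Q).ncard : ℝ) := by
          simp only [append_image_injective] at h1
          exact_mod_cast h1
        refine h2.trans ?_
        calc ∑ i, (((fun y => pre y (n - (b i).length)) '' Q).ncard : ℝ)
            ≤ ∑ i, 2 ^ L * c ^ n * c⁻¹ ^ (b i).length := by
              refine Finset.sum_le_sum fun i _ => ?_
              have h3 := List.length_pos_iff.2 (hb i)
              have h4 := hbL i
              rw [mul_assoc, ← pow_sub_eq hc0.ne' (by omega)]
              exact ih _ (by omega)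
          _ = 2 ^ L * c ^ n * ∑ i, c⁻¹ ^ (b i).length := by rw [Finset.mul_sum]
          _ ≤ 2 ^ L * c ^ n := mul_le_of_le_one_right (by positivity) hsum
  -- every tail of an element of `Q` starts at a bounded distance from the beginning of a block
  have htail : ∀ k, ∀ y ∈ Q, ∃ y' ∈ Q, ∃ r < L, shift^[k] y = shift^[r] y' := by
    intro k
    induction k using Nat.strong_induction_on with
    | _ k ih =>
      intro y hy
      rcases lt_or_ge k L with hk | hk
      · exact ⟨y, hy, k, hk, rfl⟩
      · obtain ⟨i, -, hyi⟩ := hQ y hy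
        have h3 := List.length_pos_iff.2 (hb i)
        have h4 := hbL i
        obtain ⟨y', hy', r, hr, h⟩ := ih (k - (b i).length) (by omega) _ hyi
        rw [shift_shift, Nat.sub_add_cancel (by omega)] at h
        exact ⟨y', hy', r, hr, h⟩
  refine entropy_le_of_bound hA hc0 (K := L * (2 ^ L * c ^ L)) (by positivity) fun n => ?_
  have hsub : words A n ⊆
      ⋃ r : Fin L, (fun w => w.drop r.1) '' ((fun y => pre y (n + r)) '' Q) := by
    rintro v ⟨hv, hvn⟩
    obtain ⟨y, hy, k, hk⟩ := hAQ v hv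
    obtain ⟨y', hy', r, hr, h⟩ := htail k y hy
    refine mem_iUnion.2 ⟨⟨r, hr⟩, _, ⟨y', hy', rfl⟩, ?_⟩
    apply List.ext_getElem
    · simp [hvn]
    intro i h1 h2
    rw [List.getElem_drop, getElem_pre, ← hk i h2, ← shift_iterate k y, h, shift_iterate]
  have hfin : ∀ r : Fin L, ((fun w => w.drop r.1) '' ((fun y => pre y (n + r)) '' Q)).Finite :=
    fun r => (finite_image_pre Q _).image _
  have h1 := (ncard_le_ncard hsub (finite_iUnion hfin)).trans (ncard_iUnion_le_of_fintype _)
  have h2 : ((words A n).ncard : ℝ) ≤ ∑ r : Fin L,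
      (((fun w => w.drop r.1) '' ((fun y => pre y (n + r)) '' Q)).ncard : ℝ) := by
    exact_mod_cast h1
  calc ((words A n).ncard : ℝ) ≤ _ := h2
    _ ≤ ∑ r : Fin L, 2 ^ L * (c ^ L * c ^ n) := by
      refine Finset.sum_le_sum fun r _ => ?_
      have h3 : (((fun w : List Bool => w.drop r.1) '' ((fun y => pre y (n + r)) '' Q)).ncard : ℝ) ≤
          (((fun y => pre y (n + r)) '' Q).ncard : ℝ) := by
        exact_mod_cast ncard_image_le (finite_image_pre Q _)
      refine (h3.trans (hP _)).trans ?_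
      rw [pow_add c, mul_comm (c ^ n)]
      have h4 : c ^ r.1 ≤ c ^ L := pow_le_pow_right₀ hc r.2.le
      gcongr
    _ = L * (2 ^ L * c ^ L) * c ^ n := by
      rw [Finset.sum_const, Finset.card_univ, Fintype.card_fin, nsmul_eq_mul]; ring
    _ ≤ L * (2 ^ L * c ^ L) * (n + 1) * c ^ n := by
      have h5 : (1 : ℝ) ≤ n + 1 := by
        have : (0 : ℝ) ≤ n := Nat.cast_nonneg n
        linarith
      refine mul_le_mul_of_nonneg_right (le_mul_of_one_le_right (by positivity) h5) (by positivity)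

/-- A lower bound for the entropy of a set that contains all concatenations of two words with
different first letters. -/
theorem le_entropy_of_concat (hU : U ≠ []) (hV : V ≠ []) (hUV : U.head? ≠ V.head?)
    (hA : ∀ s y, IsConcat U V s y → y ∈ A) {c : ℝ} (hc : 1 ≤ c)
    (hsum : 1 ≤ c⁻¹ ^ U.length + c⁻¹ ^ V.length) : Real.logb 2 c ≤ entropy A := by
  have hc0 : 0 < c := by linarith
  set Q : Set BinSeq := {y | ∃ s, IsConcat U V s y} with hQ
  have hne : Q.Nonempty := ⟨_, fun _ => false, isConcat_periodicSeq false⟩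
  have hQA : Q ⊆ A := fun y ⟨s, hs⟩ => hA s y hs
  set L := U.length + V.length with hL
  -- the recursion is an inequality in the other direction, as prefixes with different first blocks
  -- differ
  have hP : ∀ n, c⁻¹ ^ L * c ^ n ≤ (((fun y => pre y n) '' Q).ncard : ℝ) := by
    intro n
    induction n using Nat.strong_induction_on with
    | _ n ih =>
      rcases lt_or_ge n L with hn | hn
      · have h1 : (1 : ℝ) ≤ (((fun y => pre y n) '' Q).ncard : ℝ) := by
          exact_mod_cast (ncard_pos (finite_image_pre Q n)).2 (hne.image _)
        refine le_trans ?_ h1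
        rw [inv_pow, inv_mul_le_one₀ (by positivity)]
        exact pow_le_pow_right₀ hc hn.le
      · have hsub : ∀ a : Bool, (block U V a ++ ·) ''
            ((fun y => pre y (n - (block U V a).length)) '' Q) ⊆ (fun y => pre y n) '' Q := by
          rintro a _ ⟨_, ⟨y, ⟨s, hs⟩, rfl⟩, rfl⟩
          refine ⟨prepend (block U V a) y, ⟨_, isConcat_cons hs a⟩, ?_⟩
          have h1 : OccursAt (block U V a) (prepend (block U V a) y) 0 := fun i hi => by
            rw [Nat.zero_add, prepend_lt hi]
          have h2 : (block U V a).length ≤ n := by cases a <;> simp [block] <;> omega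
          simp only
          rw [pre_of_occursAt h1 h2, shift_prepend]
        have hdisj : Disjoint ((U ++ ·) '' ((fun y => pre y (n - U.length)) '' Q))
            ((V ++ ·) '' ((fun y => pre y (n - V.length)) '' Q)) := by
          rw [Set.disjoint_left]
          rintro _ ⟨w, -, rfl⟩ ⟨w', -, h⟩
          refine hUV ?_
          have := congrArg List.head? h
          simp only [List.head?_append] at this
          cases U <;> cases V <;> simp_all
        have h1 := ncard_le_ncard (union_subset (hsub false) (hsub true)) (finite_image_pre Q n)
        have hb0 : block U V false = U := rfl
        have hb1 : block U V true = V := rfl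
        rw [hb0, hb1, ncard_union_eq hdisj ((finite_image_pre Q _).image _)
          ((finite_image_pre Q _).image _), append_image_injective, append_image_injective] at h1
        have h2 : (((fun y => pre y (n - U.length)) '' Q).ncard : ℝ) +
            ((fun y => pre y (n - V.length)) '' Q).ncard ≤ ((fun y => pre y n) '' Q).ncard := by
          exact_mod_cast h1
        refine le_trans ?_ h2
        have hUp := List.length_pos_iff.2 hU
        have hVp := List.length_pos_iff.2 hV
        have h3 := ih (n - U.length) (by omega)
        have h4 := ih (n - V.length) (by omega)
        rw [pow_sub_eq hc0.ne' (by omega)] at h3 h4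
        calc c⁻¹ ^ L * c ^ n ≤ c⁻¹ ^ L * c ^ n * (c⁻¹ ^ U.length + c⁻¹ ^ V.length) :=
              le_mul_of_one_le_right (by positivity) hsum
          _ = c⁻¹ ^ L * (c ^ n * c⁻¹ ^ U.length) + c⁻¹ ^ L * (c ^ n * c⁻¹ ^ V.length) := by ring
          _ ≤ _ := add_le_add h3 h4
  refine le_entropy_of_bound (hne.mono hQA) hc0 (K := c⁻¹ ^ L) (by positivity) fun n => ?_
  refine (hP n).trans ?_
  have : (fun y => pre y n) '' Q ⊆ words A n := by
    rintro _ ⟨y, hy, rfl⟩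
    exact ⟨pre_mem_language (hQA hy) n, length_pre y n⟩
  exact_mod_cast ncard_le_ncard this (words_finite A n)

/-! ### The entropy of a renewal system -/

/-- The reciprocal of the growth rate of the concatenations of two words of lengths `p` and `q`. -/
theorem exists_growth {p q : ℕ} (hp : 0 < p) (hq : 0 < q) :
    ∃ t : ℝ, 0 < t ∧ t < 1 ∧ t ^ p + t ^ q = 1 := by
  have hcont : ContinuousOn (fun t : ℝ => t ^ p + t ^ q) (Icc 0 1) := by fun_prop
  obtain ⟨t, ht, h⟩ := intermediate_value_Icc (zero_le_one (α := ℝ)) hcont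
    (show (1 : ℝ) ∈ _ by simp [hp.ne', hq.ne'])
  simp only at h
  refine ⟨t, lt_of_le_of_ne ht.1 ?_, lt_of_le_of_ne ht.2 ?_, h⟩
  · rintro rfl
    simp [hp.ne', hq.ne'] at h
  · rintro rfl
    norm_num at h

theorem renewal_nonempty : (renewal ω ν).Nonempty :=
  ⟨_, _, _, 0, isConcat_periodicSeq (ω := ω) (ν := ν) false, rfl⟩

theorem entropy_renewal_le (hω : ω ≠ []) (hν : ν ≠ []) {t : ℝ} (ht0 : 0 < t) (ht1 : t ≤ 1)
    (h : t ^ ω.length + t ^ ν.length ≤ 1) : entropy (renewal ω ν) ≤ Real.logb 2 t⁻¹ := by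
  refine entropy_le_of_blocks (block ω ν) (fun c => by cases c <;> simpa [block])
    (Q := {y | ∃ s, IsConcat ω ν s y}) ?_ ((one_le_inv₀ ht0).2 ht1) ?_ renewal_nonempty ?_
  · rintro y ⟨s, hs⟩
    exact ⟨s 0, prefix_of_isConcat hs rfl, _, hs.tail rfl⟩
  · rw [inv_inv, Fintype.sum_bool]
    simp only [block, if_true, Bool.false_eq_true, if_false]
    linarith
  · rintro v ⟨_, ⟨s, y, k, hs, rfl⟩, l, hl⟩
    refine ⟨y, ⟨s, hs⟩, k + l, fun i hi => ?_⟩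
    rw [← hl i hi, shift_iterate, Nat.add_assoc]

theorem le_entropy_renewal (hω : ω ≠ []) (hν : ν ≠ []) (hων : ω.head? ≠ ν.head?) {t : ℝ}
    (ht0 : 0 < t) (ht1 : t ≤ 1) (h : 1 ≤ t ^ ω.length + t ^ ν.length) :
    Real.logb 2 t⁻¹ ≤ entropy (renewal ω ν) := by
  refine le_entropy_of_concat (A := renewal ω ν) hω hν hων (fun s y hs => ⟨s, y, 0, hs, rfl⟩)
    ((one_le_inv₀ ht0).2 ht1) ?_
  rwa [inv_inv]

theorem length_flatten_replicate (n : ℕ) (w : List Bool) :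
    ((List.replicate n w).flatten).length = n * w.length := by simp

/-- If the number of consecutive `ω` is bounded, then the entropy drops: the sequences are
concatenations of the blocks `ν ωⁱ` with `i ≤ M`, and the sum of `t^|ν ωⁱ|` over these finitely many
blocks is smaller than the value `1` of the full geometric series. -/
theorem entropy_lt_of_bounded_runs (hω : ω ≠ []) (hν : ν ≠ []) {t : ℝ} (ht0 : 0 < t) (ht1 : t < 1)
    (h : t ^ ω.length + t ^ ν.length = 1) (hA : A.Nonempty) {M : ℕ}
    (hM : ∀ v ∈ language A, ∃ s y, IsConcat ω ν s y ∧ IsFactor v y ∧ s 0 = true ∧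
      ∀ k, ∃ i ≤ M, s (k + i) = true) : entropy A < Real.logb 2 t⁻¹ := by
  classical
  -- the blocks `ν ωⁱ` with `i ≤ M`
  let b : Fin (M + 1) → List Bool := fun i => ν ++ (List.replicate i ω).flatten
  have hbl : ∀ i, (b i).length = ν.length + i * ω.length := fun i => by
    simp only [b, List.length_append, length_flatten_replicate]
  have hωp := List.length_pos_iff.2 hω
  have hsum : ∑ i, t ^ (b i).length < 1 := by
    have h1 : ∀ i : Fin (M + 1), t ^ (b i).length = t ^ ν.length * (t ^ ω.length) ^ (i : ℕ) :=
      fun i => by rw [hbl, pow_add, mul_comm (i : ℕ), pow_mul]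
    simp only [h1]
    rw [← Finset.mul_sum, Fin.sum_univ_eq_sum_range (fun i => (t ^ ω.length) ^ i),
      show t ^ ν.length = 1 - t ^ ω.length by linarith, mul_neg_geom_sum]
    have : 0 < (t ^ ω.length) ^ (M + 1) := by positivity
    linarith
  obtain ⟨t', ht', hsum', ht'1⟩ : ∃ t' > t, ∑ i, t' ^ (b i).length < 1 ∧ t' < 1 := by
    have hcont : Continuous fun t : ℝ => ∑ i, t ^ (b i).length := by fun_prop
    have h1 := (hcont.tendsto t).eventually_lt_const hsum
    have h2 := (h1.and (eventually_lt_nhds ht1)).filter_mono (nhdsWithin_le_nhds (s := Ioi t))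
    obtain ⟨t', h3, h4⟩ := (h2.and self_mem_nhdsWithin).exists
    exact ⟨t', h4, h3.1, h3.2⟩
  have ht'0 : 0 < t' := ht0.trans ht'
  refine lt_of_le_of_lt (b := Real.logb 2 t'⁻¹) ?_ ?_
  · refine entropy_le_of_blocks b (fun i => by simp [b, hν])
      (Q := {y | ∃ s, IsConcat ω ν s y ∧ s 0 = true ∧ ∀ k, ∃ i ≤ M, s (k + i) = true}) ?_
      ((one_le_inv₀ ht'0).2 ht'1.le) ?_ hA ?_
    · rintro y ⟨s, hs, hs0, hsM⟩
      have hex : ∃ i, s (1 + i) = true := by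
        obtain ⟨i, -, hi⟩ := hsM 1
        exact ⟨i, hi⟩
      have hle : Nat.find hex ≤ M := by
        obtain ⟨i, hi, hi'⟩ := hsM 1
        exact (Nat.find_min' hex hi').trans hi
      have hw : ∀ j ≤ Nat.find hex, substWord ω ν s (1 + j) =
          ν ++ (List.replicate j ω).flatten := by
        intro j
        induction j with
        | zero => intro _; simp [substWord_one, hs0, block]
        | succ j ih =>
          intro hj
          have h0 : s (1 + j) = false := by simpa using Nat.find_min hex (m := j) (by omega)
          rw [← Nat.add_assoc, substWord_succ, ih (by omega), h0, List.append_assoc,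
            List.replicate_succ', List.flatten_append]
          simp [block]
      have hb : b ⟨Nat.find hex, by omega⟩ = substWord ω ν s (1 + Nat.find hex) :=
        (hw _ le_rfl).symm
      refine ⟨⟨Nat.find hex, by omega⟩, ?_, shift^[1 + Nat.find hex] s, ?_, ?_, fun k => ?_⟩
      · rw [hb]; exact hs _
      · rw [hb]; exact hs.shift _
      · rw [shift_iterate_zero]; exact Nat.find_spec hex
      · obtain ⟨i, hi, hi'⟩ := hsM (1 + Nat.find hex + k)
        exact ⟨i, hi, by rw [shift_iterate]; simpa only [Nat.add_assoc] using hi'⟩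
    · simpa only [inv_inv] using hsum'.le
    · intro v hv
      obtain ⟨s, y, hs, hvy, hs0, hsM⟩ := hM v hv
      exact ⟨y, ⟨s, hs, hs0, hsM⟩, hvy⟩
  · exact Real.logb_lt_logb one_lt_two (by positivity) (inv_strictAnti₀ ht0 ht')

/-- If every word of `S ⊇ A` is a word of `A` followed by a word of `R`, and `R` has at most the
entropy of `A`, then `S` has the entropy of `A`. -/
theorem entropy_le_of_decomposition {S R : Set BinSeq} (hS : S.Nonempty) (hA : A.Nonempty)
    (hR : R.Nonempty) (hAS : A ⊆ S) (hRA : entropy R ≤ entropy A)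
    (h : ∀ x ∈ S, ∀ n, ∃ k ≤ n, pre x k ∈ language A ∧ pre (shift^[k] x) (n - k) ∈ language R)
    (hinv : ∀ x ∈ S, shift x ∈ S) : entropy S = entropy A := by
  have hent0 : 0 ≤ entropy A := by
    refine ge_of_tendsto' (tendsto_entropy hA) fun n => div_nonneg ?_ (Nat.cast_nonneg n)
    refine Real.logb_nonneg one_lt_two ?_
    exact_mod_cast (Set.ncard_pos (words_finite A n)).2 (words_nonempty hA n)
  refine le_antisymm (le_of_forall_pos_le_add fun ε hε => ?_) (entropy_mono hA hAS)
  set c : ℝ := 2 ^ (entropy A + ε) with hc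
  have hlog : Real.logb 2 c = entropy A + ε := Real.logb_rpow two_pos (by norm_num)
  have hc1 : 1 ≤ c := Real.one_le_rpow one_le_two (by linarith)
  obtain ⟨K, hK, hK'⟩ := exists_bound_of_entropy_lt hA hc1 (by rw [hlog]; linarith)
  obtain ⟨K₂, hK₂, hK₂'⟩ := exists_bound_of_entropy_lt hR hc1 (by rw [hlog]; linarith)
  rw [← hlog]
  refine entropy_le_of_bound hS (by linarith) (mul_pos hK hK₂) fun n => ?_
  have hsub : words S n ⊆ ⋃ k : Fin (n + 1), (fun p : List Bool × List Bool => p.1 ++ p.2) ''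
      (words A k ×ˢ words R (n - k)) := by
    rintro w ⟨hw, hwn⟩
    obtain ⟨y, hy⟩ := (mem_language_iff hinv).1 hw
    obtain ⟨k, hk, h1, h2⟩ := h _ hy n
    refine mem_iUnion.2 ⟨⟨k, by omega⟩, (_, _), ⟨⟨h1, length_pre _ _⟩, h2, length_pre _ _⟩, ?_⟩
    change pre _ k ++ pre _ (n - k) = w
    rw [pre_append_pre hk, ← hwn, pre_prepend]
  have hfin : ∀ k : Fin (n + 1), ((fun p : List Bool × List Bool => p.1 ++ p.2) ''
      (words A k ×ˢ words R (n - k))).Finite := fun k =>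
    ((words_finite A k).prod (words_finite R _)).image _
  have h1 := (ncard_le_ncard hsub (finite_iUnion hfin)).trans (ncard_iUnion_le_of_fintype _)
  have h2 : ((words S n).ncard : ℝ) ≤ ∑ k : Fin (n + 1),
      (((fun p : List Bool × List Bool => p.1 ++ p.2) '' (words A k ×ˢ words R (n - k))).ncard : ℝ)
      := by exact_mod_cast h1
  calc ((words S n).ncard : ℝ) ≤ _ := h2
    _ ≤ ∑ k : Fin (n + 1), K * K₂ * c ^ n := by
      refine Finset.sum_le_sum fun k _ => ?_
      have h3 : (((fun p : List Bool × List Bool => p.1 ++ p.2) ''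
          (words A k ×ˢ words R (n - k))).ncard : ℝ) ≤
          ((words A k).ncard : ℝ) * ((words R (n - k)).ncard : ℝ) := by
        have := ncard_image_le (f := fun p : List Bool × List Bool => p.1 ++ p.2)
          ((words_finite A k).prod (words_finite R (n - k)))
        rw [ncard_prod] at this
        exact_mod_cast this
      refine h3.trans ?_
      have h4 := mul_le_mul (hK' k) (hK₂' (n - k)) (Nat.cast_nonneg _) (by positivity)
      refine h4.trans (le_of_eq ?_)
      have h5 : c ^ n = c ^ (k : ℕ) * c ^ (n - k) := by
        rw [← pow_add, Nat.add_sub_cancel' (Nat.lt_succ_iff.1 k.2)]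
      rw [h5]; ring
    _ = K * K₂ * (n + 1) * c ^ n := by
      rw [Finset.sum_const, Finset.card_univ, Fintype.card_fin, nsmul_eq_mul]; push_cast; ring

end

/-! ### Free words in an unbalanced lexicographic subshift -/

section

variable {α β : BinSeq} {U V : List Bool} {s x y z : BinSeq}

/-- Two words with different first letters, all of whose concatenations lie in `Σ_(α,β)`, and whose
numbers of letters are bounded by those of `0α` in `p` digits and of `1β` in `q` digits. -/
def HasFreeWords (α β : BinSeq) (p q : ℕ) : Prop :=
  ∃ U V : List Bool, U ≠ [] ∧ V ≠ [] ∧ U.head? ≠ V.head? ∧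
    U.count true ≤ ones (prepend [false] α) p ∧ U.count false + ones (prepend [false] α) p ≤ p ∧
    V.count true ≤ ones (prepend [true] β) q ∧ V.count false + ones (prepend [true] β) q ≤ q ∧
    ∀ s y, IsConcat U V s y → y ∈ lexShift α β

theorem count_map_not (w : List Bool) (c : Bool) : (w.map not).count c = w.count (!c) := by
  induction w with
  | nil => rfl
  | cons b w ih => simp only [List.map_cons, List.count_cons, ih]; cases b <;> cases c <;> rfl

theorem map_not_map_not (w : List Bool) : (w.map not).map not = w := by
  simp [Function.comp_def]

theorem HasFreeWords.of_mirror {p q : ℕ} (h : HasFreeWords (mirror β) (mirror α) q p) :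
    HasFreeWords α β p q := by
  obtain ⟨U, V, hU, hV, hUV, h1, h2, h3, h4, h5⟩ := h
  rw [← mirror_prepend_true] at h1 h2
  rw [← mirror_prepend_false] at h3 h4
  have h6 := ones_mirror (prepend [true] β) q
  have h7 := ones_mirror (prepend [false] α) p
  refine ⟨V.map not, U.map not, by simpa using hV, by simpa using hU, ?_, ?_, ?_, ?_, ?_, ?_⟩
  · rw [List.head?_map, List.head?_map]
    exact fun h => hUV ((Option.map_injective Bool.not_injective h).symm)
  · rw [count_map_not]; simp only [Bool.not_true]; omega
  · rw [count_map_not]; simp only [Bool.not_false]; omega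
  · rw [count_map_not]; simp only [Bool.not_true]; omega
  · rw [count_map_not]; simp only [Bool.not_false]; omega
  · intro s y hs
    have := hs.mirror
    rw [map_not_map_not, map_not_map_not] at this
    exact mirror_mem_lexShift.1 (h5 _ _ this)

theorem isConcat_swap (h : IsConcat U V s y) : IsConcat V U (mirror s) y := by
  have : ∀ n, substWord V U (mirror s) n = substWord U V s n := by
    intro n
    induction n with
    | zero => rfl
    | succ n ih =>
      rw [substWord_succ, substWord_succ, ih]
      congr 1
      cases hs : s n <;> simp [block, mirror, hs]
  intro n
  rw [this]
  exact h n

/-- The sequence `(10)^∞`. -/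
def oneZero : BinSeq := fun n => decide (n % 2 = 0)

theorem oneZero_succ (n : ℕ) : oneZero (n + 1) = !oneZero n := by
  simp only [oneZero]
  rcases Nat.mod_two_eq_zero_or_one n with h | h <;> simp [Nat.add_mod, h]

theorem shift_oneZero : shift oneZero = mirror oneZero := by
  funext n; exact oneZero_succ n

theorem shift_mirror_oneZero : shift (mirror oneZero) = oneZero := by
  rw [shift_mirror_one, shift_oneZero, mirror_mirror]

theorem ones_oneZero (m : ℕ) : ones oneZero (2 * m + 1) = m + 1 := by
  induction m with
  | zero => rfl
  | succ m ih =>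
    rw [show 2 * (m + 1) + 1 = 2 * m + 1 + 1 + 1 by ring, ones_succ, ones_succ, ih]
    have h1 : oneZero (2 * m + 1) = false := by simp [oneZero, Nat.add_mod]
    have h2 : oneZero (2 * m + 1 + 1) = true := by simp [oneZero, Nat.add_mod]
    rw [h1, h2]; rfl

theorem count_pre (x : BinSeq) (n : ℕ) :
    (pre x n).count true = ones x n ∧ (pre x n).count false + ones x n = n := by
  induction n with
  | zero => simp [pre]
  | succ n ih =>
    have : pre x (n + 1) = pre x n ++ [x n] := by simp [pre, List.range_succ]
    rw [this, List.count_append, List.count_append, ones_succ]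
    cases h : x n <;> simp <;> omega

/-- A sequence without two adjacent zeros is at least `(01)^∞`. -/
theorem mirror_oneZero_le (h : ∀ n, x n = false → x (n + 1) = true) : mirror oneZero ≤ₗ x := by
  by_contra hc
  obtain ⟨d, hd, h0, h1⟩ := lt_def.1 (not_le.1 hc)
  cases d with
  | zero => simp [mirror, oneZero] at h1
  | succ d =>
    have h2 := hd d (Nat.lt_succ_self d)
    simp only [mirror, oneZero_succ, Bool.not_not] at h1 h2
    rw [h1] at h2
    simp [h d (by simpa using h2)] at h0

/-- In a concatenation of `01` and `1(01)^m` no two zeros are adjacent, and the second of two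
adjacent ones begins a block. -/
theorem mem_of_isConcat_alternating {m : ℕ} (hα0 : α 0 = true)
    (hβ : β ≤ₗ mirror oneZero)
    (hα : prepend [true] (periodicSeq (pre oneZero (2 * m + 1))) ≤ₗ α)
    (hs : IsConcat [false, true] (pre oneZero (2 * m + 1)) s y) : y ∈ lexShift α β := by
  set V := pre oneZero (2 * m + 1) with hV
  have hVne : V ≠ [] := List.ne_nil_of_length_pos (by simp [hV])
  have hU0 : periodicSeq [false, true] 0 = false := rfl
  have hV0 : periodicSeq V 0 = true := by
    rw [periodicSeq_lt (by simp [hV])]; simp [hV, oneZero]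
  have halt : ∀ (c : Bool) (r : ℕ) (hr : r < (block [false, true] V c).length),
      (∀ hr' : r + 1 < (block [false, true] V c).length,
        (block [false, true] V c)[r + 1] = !(block [false, true] V c)[r]) ∧
      (r + 1 = (block [false, true] V c).length → (block [false, true] V c)[r] = true) := by
    rintro (_ | _) r hr
    · simp only [block, Bool.false_eq_true, if_false, List.length_cons, List.length_nil] at hr ⊢
      interval_cases r <;> simp
    · simp only [hV, block, if_true, getElem_pre, oneZero_succ, length_pre] at hr ⊢
      refine ⟨fun _ => trivial, fun h => ?_⟩
      obtain rfl : r = 2 * m := by omega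
      simp [oneZero]
  have key : ∀ n, y (n + 1) = (!y n) ∨ (y n = true ∧ shift^[n + 1] y ≤ₗ periodicSeq V) := by
    intro n
    obtain ⟨k, r, rfl, hr⟩ := exists_block (ω := [false, true]) (by simp) hVne s n
    have hdig : ∀ i (hi : i < (block [false, true] V (s k)).length),
        y ((substWord [false, true] V s k).length + i) = (block [false, true] V (s k))[i] := by
      intro i hi
      have := (hs.shift k) 1
      rw [substWord_one, shift_iterate_zero] at this
      rw [← this i hi, Nat.zero_add, shift_iterate]
    rcases Nat.lt_or_ge (r + 1) (block [false, true] V (s k)).length with hr' | hr'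
    · left
      rw [Nat.add_assoc, hdig _ hr', hdig _ hr]
      exact (halt _ r hr).1 hr'
    · right
      have hr1 : r + 1 = (block [false, true] V (s k)).length := by omega
      constructor
      · rw [hdig _ hr]
        exact (halt _ r hr).2 hr1
      · have h1 := (hs.shift (k + 1)).le_right hU0 (by simp) hV0
        rwa [substWord_succ, List.length_append, ← hr1] at h1
  intro n
  constructor
  · refine hβ.trans (mirror_oneZero_le fun i hi => ?_)
    rw [shift_iterate] at hi ⊢
    rcases key (n + i) with h | ⟨h, -⟩
    · rw [← Nat.add_assoc, h, hi]; rfl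
    · rw [hi] at h; simp at h
  · cases hn : y n
    · exact (lt_of_head (by rw [shift_iterate_zero, hn]) hα0).le
    refine le_trans ?_ hα
    rw [eq_prepend_of_head (x := shift^[n] y) (b := true) (by rw [shift_iterate_zero, hn]),
      prepend_le_prepend, ← shift_succ]
    rcases key n with h | ⟨-, h⟩
    · refine (lt_of_head ?_ hV0).le
      rw [shift_iterate_zero, h, hn]; rfl
    · exact h

/-- If `α > 1(10)^∞` and `β ≤ (01)^∞`, then a word `(10)^m 1` no longer than the period of `0α` can
be freely concatenated with `01`. -/
theorem hasFreeWords_of_lt (hLW : LexWorld α β) {p q : ℕ}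
    (hp : 0 < p) (hα : shift^[p] (prepend [false] α) = prepend [false] α) (hq : 0 < q)
    (hβ : shift^[q] (prepend [true] β) = prepend [true] β) (hβ' : β ≤ₗ mirror oneZero)
    (hα' : prepend [true] oneZero <ₗ α) : HasFreeWords α β p q := by
  set a := prepend [false] α with ha
  set b := prepend [true] β with hb
  have hq2 : 2 ≤ q := by
    by_contra hc
    obtain rfl : q = 1 := by omega
    have := congrFun hβ 0
    rw [shift_iterate_zero, hb, prepend_singleton_succ, prepend_singleton_zero, hLW.head_min]
      at this
    simp at this
  have hb2 : ones b 2 = 1 := by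
    simp [ones, Finset.sum_range_succ, hb, hLW.head_min]
  have hbq := ones_add b 2 (q - 2)
  have hbq' := ones_le (shift^[2] b) (q - 2)
  rw [Nat.add_sub_cancel' hq2] at hbq
  -- the number `m` in the word `(10)^m 1` comes from the first difference between `α` and `1(10)^∞`
  suffices h : ∃ m, prepend [true] (periodicSeq (pre oneZero (2 * m + 1))) ≤ₗ α ∧
      m + 1 ≤ ones a p ∧ m + ones a p ≤ p by
    obtain ⟨m, h1, h2, h3⟩ := h
    obtain ⟨h4, h5⟩ := count_pre oneZero (2 * m + 1)
    rw [ones_oneZero] at h4 h5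
    refine ⟨pre oneZero (2 * m + 1), [false, true],
      List.ne_nil_of_length_pos (by simp), by simp, ?_, ?_, ?_, ?_, ?_,
      fun s y hs => mem_of_isConcat_alternating hLW.head_max hβ' h1 (isConcat_swap hs)⟩
    · simp [pre, List.range_succ_eq_map, oneZero]
    · rw [h4, ← ha]; exact h2
    · rw [← ha]; omega
    · rw [← hb, show List.count true [false, true] = 1 from rfl]; omega
    · rw [← hb, show List.count false [false, true] = 1 from rfl]; omega
  obtain ⟨d, hd, hd0, hd1⟩ := lt_def.1 hα'
  obtain ⟨k, rfl⟩ : ∃ k, d = 2 * k + 2 := by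
    rcases d with _ | d
    · simp at hd0
    · rw [prepend_singleton_succ] at hd0
      simp only [oneZero, decide_eq_false_iff_not] at hd0
      exact ⟨d / 2, by omega⟩
  have hαi : ∀ i, i < 2 * k + 1 → α (i + 1) = oneZero i := fun i hi => by
    rw [← hd _ (by omega), prepend_singleton_succ]
  rcases Nat.lt_or_ge (2 * k + 2) p with hlt | hge
  · -- the word ends before the first difference
    refine ⟨k + 1, (lt_def.2 ⟨2 * k + 2, fun j hj => ?_, ?_, hd1⟩).le, ?_⟩
    · rw [← hd j hj]
      rcases j with _ | j
      · rfl
      · rw [prepend_singleton_succ, prepend_singleton_succ, periodicSeq_lt (by simp; omega),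
          getElem_pre]
    · rw [prepend_singleton_succ, periodicSeq_lt (by simp), getElem_pre]
      simp [oneZero, Nat.add_mod]
    · have h1 : ones a (2 * k + 3) = k + 2 := by
        rw [show 2 * k + 3 = 1 + (1 + (2 * k + 1)) by ring, ones_add, ones_add]
        have h2 : shift^[1] (shift^[1] a) = shift α := by simp [ha]
        rw [h2, ones_congr (x := shift α) (y := oneZero) fun i hi => hαi i hi, ones_oneZero]
        simp [ones, ha, hLW.head_max]
        omega
      have h2 := ones_add a (2 * k + 3) (p - (2 * k + 3))
      have h3 := ones_le (shift^[2 * k + 3] a) (p - (2 * k + 3))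
      rw [Nat.add_sub_cancel' (by omega)] at h2
      omega
  · -- the word is a cyclic permutation of the period of `0α`
    have hper : ∀ i, a (p + i) = a i := fun i => by rw [← shift_iterate p a, hα]
    have ha1 : ∀ i, a (i + 1) = α i := fun i => by rw [ha, prepend_singleton_succ]
    have h0 : α (p - 1) = false := by
      rw [← ha1, Nat.sub_add_cancel hp, ← Nat.add_zero p, hper, ha, prepend_singleton_zero]
    have h1 : α p = true := by rw [← ha1, hper, ha, prepend_singleton_succ, hLW.head_max]
    have h2 : α (p + 1) = true := by
      rw [← ha1, Nat.add_assoc, hper, ha1, hαi 0 (by omega)]; rfl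
    have hp1 : p = 2 * k + 1 := by
      by_contra hne
      rcases Nat.lt_or_ge (p + 1) (2 * k + 2) with h3 | h3
      · have h4 := hαi p (by omega)
        have h5 := hαi (p - 1) (by omega)
        rw [Nat.sub_add_cancel hp] at h5
        have h6 := oneZero_succ (p - 1)
        rw [Nat.sub_add_cancel hp, ← h4, ← h5, h1, h2] at h6
        simp at h6
      · obtain rfl : p = 2 * k + 2 := by omega
        have h4 := hαi (2 * k) (by omega)
        rw [show 2 * k + 2 - 1 = 2 * k + 1 by omega, h4] at h0
        simp [oneZero] at h0
    have hσα : shift^[p] (shift α) = shift α := by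
      have := period_shift hα 2
      simpa [ha] using this
    have hV : periodicSeq (pre oneZero (2 * k + 1)) = shift α := by
      rw [← hp1, ← eq_periodicSeq_pre hp hσα]
      congr 1
      exact pre_congr fun i hi => (hαi i (by omega)).symm
    have h3 := ones_shift_period hα 2
    have h4 : shift^[2] a = shift α := by simp [ha]
    rw [h4, ones_congr (x := shift α) (y := oneZero) (n := p) fun i hi => hαi i (by omega), hp1,
      ones_oneZero, ← hp1] at h3
    refine ⟨k, ?_, by omega, by omega⟩
    rw [hV, ← eq_prepend_of_head hLW.head_max]

/-- If `α ≤ 1(10)^∞` and `β ≥ 0(01)^∞`, then all points have as many ones as zeros: their tails are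
eventually built from the words `01` and `10`. -/
theorem not_unbalanced_of_narrow (hα : α ≤ₗ prepend [true] oneZero)
    (hβ : prepend [false] (mirror oneZero) ≤ₗ β) : ¬ Unbalanced (lexShift α β) := by
  -- these points start with `01` or `10`, and removing the two digits leads to the set again
  set G : Set BinSeq := {y | y ∈ lexShift α β ∧
    ((y 0 = false ∧ mirror oneZero ≤ₗ y) ∨ (y 0 = true ∧ y ≤ₗ oneZero))} with hG
  have hsucc : ∀ {y : BinSeq} {c : Bool}, y 0 = c → y = prepend [c] (shift y) :=
    fun h => eq_prepend_of_head h
  have h01 : mirror oneZero = prepend [false] oneZero := by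
    conv_lhs => rw [hsucc (y := mirror oneZero) (c := false) rfl, shift_mirror_oneZero]
  have h10 : oneZero = prepend [true] (mirror oneZero) := by
    conv_lhs => rw [hsucc (y := oneZero) (c := true) rfl, shift_oneZero]
  have hstep : ∀ y ∈ G, shift^[2] y ∈ G ∧ ones y 2 = 1 := by
    rintro y ⟨hy, ⟨h0, h1⟩ | ⟨h0, h1⟩⟩
    · have h2 : oneZero ≤ₗ shift y := by
        rwa [h01, hsucc h0, prepend_le_prepend] at h1
      have h3 : shift y 0 = true := head_of_le h2 rfl
      rw [h10, hsucc h3, prepend_le_prepend] at h2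
      have h4 := (hy 1).2.trans hα
      rw [Function.iterate_one, hsucc h3, prepend_le_prepend] at h4
      have h5 := shift_mem_lexShift hy 2
      refine ⟨⟨h5, ?_⟩, ?_⟩
      · cases h6 : shift^[2] y 0
        · exact Or.inl ⟨rfl, h2⟩
        · exact Or.inr ⟨rfl, h4⟩
      · have h7 : y 1 = true := h3
        simp [ones, Finset.sum_range_succ, h0, h7]
    · have h2 : shift y ≤ₗ mirror oneZero := by
        rwa [h10, hsucc h0, prepend_le_prepend] at h1
      have h3 : shift y 0 = false := head_of_le' h2 rfl
      rw [h01, hsucc h3, prepend_le_prepend] at h2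
      have h4 := hβ.trans (hy 1).1
      rw [Function.iterate_one, hsucc h3, prepend_le_prepend] at h4
      have h5 := shift_mem_lexShift hy 2
      refine ⟨⟨h5, ?_⟩, ?_⟩
      · cases h6 : shift^[2] y 0
        · exact Or.inl ⟨rfl, h4⟩
        · exact Or.inr ⟨rfl, h2⟩
      · have h7 : y 1 = false := h3
        simp [ones, Finset.sum_range_succ, h0, h7]
  have hfreq : ∀ y ∈ G, HasFrequency 2 1 y := by
    intro y hy
    refine hasFrequency_of_multiples two_pos fun k => ?_
    suffices h : shift^[2 * k] y ∈ G ∧ ones y (2 * k) = 1 * k from h.2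
    induction k with
    | zero => exact ⟨hy, by simp⟩
    | succ k ih =>
      obtain ⟨h1, h2⟩ := hstep _ ih.1
      rw [shift_shift, Nat.add_comm] at h1
      exact ⟨h1, by rw [Nat.mul_succ, ones_add, ih.2, h2]; ring⟩
  refine not_unbalanced_of_hasFrequency two_pos (c := 1) fun x hx => ?_
  obtain ⟨k, hk⟩ : ∃ k, shift^[k] x ∈ G := by
    by_cases hc : ∃ k, x k ≠ x (k + 1)
    · obtain ⟨k, hk⟩ := hc
      have h0 := shift_iterate_zero k x
      have h1 : shift (shift^[k] x) 0 = x (k + 1) := by rw [← shift_succ, shift_iterate_zero]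
      cases hxk : x k
      · rw [hxk] at h0 hk
        rcases le_or_gt (toLex (mirror oneZero)) (toLex (shift^[k] x)) with h | h
        · exact ⟨k, shift_mem_lexShift hx k, Or.inl ⟨h0, h⟩⟩
        · rw [h01, hsucc h0] at h
          replace h := prepend_lt_prepend.1 h
          refine ⟨k + 1, shift_mem_lexShift hx _, Or.inr ?_⟩
          rw [shift_succ]
          exact ⟨h1.trans (by simpa using hk.symm), h.le⟩
      · rw [hxk] at h0 hk
        rcases le_or_gt (toLex (shift^[k] x)) (toLex oneZero) with h | h
        · exact ⟨k, shift_mem_lexShift hx k, Or.inr ⟨h0, h⟩⟩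
        · rw [h10, hsucc h0] at h
          replace h := prepend_lt_prepend.1 h
          refine ⟨k + 1, shift_mem_lexShift hx _, Or.inl ?_⟩
          rw [shift_succ]
          exact ⟨h1.trans (by simpa using hk.symm), h.le⟩
    · exfalso
      push Not at hc
      have hconst : ∀ k, x k = x 0 := fun k => by
        induction k with
        | zero => rfl
        | succ k ih => rw [← hc, ih]
      cases hx0 : x 0
      · have h1 : x = fun _ => false := funext fun k => by rw [hconst, hx0]
        have h2 := hβ.trans (min_le hx)
        refine absurd h2 (not_le.2 (lt_def.2 ⟨2, fun j hj => ?_, by rw [h1], by rfl⟩))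
        rw [h1]
        interval_cases j <;> rfl
      · have h1 : x = fun _ => true := funext fun k => by rw [hconst, hx0]
        have h2 := (le_max hx).trans hα
        refine absurd h2 (not_le.2 (lt_def.2 ⟨2, fun j hj => ?_, by rfl, by rw [h1]⟩))
        rw [h1]
        interval_cases j <;> rfl
  exact (hfreq _ hk).of_shift

end

/-! ### Desubstitution and the existence of free words -/

section

variable {α β : BinSeq} {s t x y : BinSeq}

/-- `x` is the image of `s` under the substitution `0 ↦ 0`, `1 ↦ 10`. -/
abbrev IsSubst (s x : BinSeq) : Prop := IsConcat [false] [true, false] s x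

theorem IsSubst.lt (hs : IsSubst s x) (ht : IsSubst t y) (h : s <ₗ t) : x <ₗ y :=
  IsConcat.lt rfl (by simp) rfl hs ht h

theorem IsSubst.le_of_le (hs : IsSubst s x) (ht : IsSubst t y) (h : x ≤ₗ y) : s ≤ₗ t :=
  not_lt.1 fun hc => absurd h (not_le.2 (ht.lt hs hc))

theorem IsSubst.le (hs : IsSubst s x) (ht : IsSubst t y) (h : s ≤ₗ t) : x ≤ₗ y :=
  IsConcat.le rfl (by simp) rfl hs ht h

theorem IsSubst.head (hs : IsSubst s x) : x 0 = s 0 :=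
  IsConcat.head rfl (by simp) rfl hs

theorem IsSubst.injective (hs : IsSubst s x) (ht : IsSubst t x) : s = t :=
  le_antisymm' (hs.le_of_le ht le_rfl) (ht.le_of_le hs le_rfl)

/-- A sequence without two adjacent ones can be desubstituted. -/
theorem exists_isSubst (h : ∀ n, x n = true → x (n + 1) = false) : ∃ s, IsSubst s x := by
  have step : ∀ x ∈ {x : BinSeq | ∀ n, x n = true → x (n + 1) = false},
      OccursAt (block [false] [true, false] (x 0)) x 0 ∧
      shift^[(block [false] [true, false] (x 0)).length] x ∈
        {x : BinSeq | ∀ n, x n = true → x (n + 1) = false} := by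
    intro x hx
    constructor
    · rw [occursAt_zero_iff]
      cases h0 : x 0
      · simp [block, pre, h0]
      · simp [block, pre, List.range_succ, h0, hx 0 h0]
    · intro n hn
      rw [shift_iterate] at hn ⊢
      exact hx _ hn
  obtain ⟨s, -, hs⟩ := exists_isConcat _ step h
  exact ⟨s, hs⟩

theorem length_substWord_subst (s : BinSeq) (k : ℕ) :
    (substWord [false] [true, false] s k).length = k + ones s k := by
  induction k with
  | zero => simp
  | succ k ih =>
    rw [substWord_succ, List.length_append, ih, ones_succ]
    cases s k <;> simp [block] <;> omega

theorem IsSubst.shift (hs : IsSubst s x) (k : ℕ) :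
    IsSubst (shift^[k] s) (LexShift.shift^[k + ones s k] x) := by
  have := IsConcat.shift hs k
  rwa [length_substWord_subst] at this

theorem IsSubst.ones (hs : IsSubst s x) (k : ℕ) :
    ones x (k + LexShift.ones s k) = LexShift.ones s k := by
  induction k with
  | zero => simp
  | succ k ih =>
    have h := (hs.shift k) 1
    rw [substWord_one, shift_iterate_zero] at h
    rw [ones_succ]
    cases hk : s k
    · simp only [hk, block, Bool.false_eq_true, if_false] at h
      have h0 := h 0 (by simp)
      rw [Nat.zero_add, shift_iterate, Nat.add_zero] at h0
      rw [show k + 1 + (LexShift.ones s k + Bool.toNat false) = k + LexShift.ones s k + 1 by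
        simp; omega, ones_succ, ih, h0]
      rfl
    · simp only [hk, block, if_true] at h
      have h0 := h 0 (by decide)
      have h1 := h 1 (by decide)
      rw [Nat.zero_add, shift_iterate] at h0 h1
      rw [show k + 1 + (LexShift.ones s k + Bool.toNat true) = k + LexShift.ones s k + 1 + 1 by
        simp; omega, ones_succ, ones_succ, ih]
      rw [Nat.add_zero] at h0
      rw [h0, h1]
      rfl

/-- Every position is the beginning of a block or lies inside a block `10`. -/
theorem IsSubst.position (hs : IsSubst s x) (n : ℕ) :
    ∃ k, n = k + LexShift.ones s k ∨
      (n = k + LexShift.ones s k + 1 ∧ x (k + LexShift.ones s k) = true ∧ x n = false ∧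
        IsSubst (LexShift.shift^[k + 1] s) (LexShift.shift^[n + 1] x)) := by
  obtain ⟨k, r, rfl, hr⟩ := exists_block (ω := [false]) (ν := [true, false]) (by simp) (by simp) s n
  rw [length_substWord_subst]
  refine ⟨k, ?_⟩
  cases hk : s k
  · simp only [hk, block, Bool.false_eq_true, if_false, List.length_singleton] at hr
    left; omega
  · simp only [hk, block, if_true, List.length_cons, List.length_nil] at hr
    interval_cases r
    · left; rfl
    · right
      have h := (hs.shift k) 1
      rw [substWord_one, shift_iterate_zero, hk] at h
      have h0 := h 0 (by decide)
      have h1 := h 1 (by decide)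
      rw [Nat.zero_add, shift_iterate] at h0 h1
      refine ⟨rfl, h0, h1, ?_⟩
      have h2 := hs.shift (k + 1)
      rw [ones_succ, hk] at h2
      rwa [show k + 1 + (LexShift.ones s k + Bool.toNat true) = k + LexShift.ones s k + 1 + 1 by
        simp; omega] at h2

/-- Removing a block from a point that is preceded by `0` leads to a point that is preceded by `0`.
-/
theorem IsSubst.step (hs : IsSubst s x) (h : prepend [false] x ∈ lexShift α β) :
    ∃ y, IsSubst (LexShift.shift s) y ∧ prepend [false] y ∈ lexShift α β := by
  have h1 := hs.shift 1
  have h2 : LexShift.ones s 1 = (s 0).toNat := by simp [LexShift.ones]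
  rw [h2] at h1
  refine ⟨_, h1, ?_⟩
  have h3 := hs 1
  rw [substWord_one] at h3
  cases h0 : s 0
  · rw [h0] at h3
    have h4 : x 0 = false := h3 0 (by decide)
    have h5 := shift_mem_lexShift h 1
    simp only [Bool.toNat_false, Nat.add_zero, Function.iterate_one] at h5 ⊢
    rwa [← eq_prepend_of_head h4]
  · rw [h0] at h3
    have h4 : x 1 = false := h3 1 (by decide)
    have h5 := shift_mem_lexShift h 2
    have h6 : LexShift.shift^[2] (prepend [false] x) = LexShift.shift x := by simp
    rw [h6] at h5
    simp only [Bool.toNat_true]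
    rwa [shift_succ, Function.iterate_one,
      ← eq_prepend_of_head (show LexShift.shift x 0 = false from h4)]

/-- A pair `(α, β)` of the lexicographic world that comes from `(α', β')` by the substitution `0 ↦
0`, `1 ↦ 10`: then `0α` and `1β` are the images of `0α'` and `1β'`. -/
structure IsDesubst (α β α' β' : BinSeq) : Prop where
  lexWorld : LexWorld α β
  max : IsSubst α' α
  min : IsSubst β' (shift β)

variable {α' β' : BinSeq}

/-- The points of `Σ_(α,β)` that are preceded by `0` come from points of `Σ_(α',β')`. The digit `0`
in front ensures that they obey the lower bound `σ(β)`. -/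
theorem IsDesubst.mem_of_prepend (h : IsDesubst α β α' β') (hs : IsSubst s x)
    (hx : prepend [false] x ∈ lexShift α β) : s ∈ lexShift α' β' := by
  intro n
  obtain ⟨y, hy, hy'⟩ : ∃ y, IsSubst (shift^[n] s) y ∧ prepend [false] y ∈ lexShift α β := by
    induction n with
    | zero => exact ⟨x, hs, hx⟩
    | succ n ih =>
      obtain ⟨y, hy, hy'⟩ := ih
      rw [shift_succ]
      exact hy.step hy'
  constructor
  · refine h.min.le_of_le hy ?_
    have h1 := min_le hy'
    rwa [eq_prepend_of_head h.lexWorld.head_min, prepend_le_prepend] at h1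
  · have h1 := (hy' 1).2
    simp only [Function.iterate_one, shift_prepend_singleton] at h1
    exact hy.le_of_le h.max h1

/-- The substitution maps `Σ_(α',β')` into `Σ_(α,β)`. -/
theorem IsDesubst.mem (h : IsDesubst α β α' β') (hs : IsSubst s x) (hs' : s ∈ lexShift α' β') :
    x ∈ lexShift α β := by
  intro n
  obtain ⟨k, rfl | ⟨rfl, -, h0, hk⟩⟩ := hs.position n
  · have h1 := hs.shift k
    exact ⟨(le_shift_of_head h.lexWorld.head_min).trans (h.min.le h1 (hs' k).1),
      h1.le h.max (hs' k).2⟩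
  · rw [← shift_iterate_zero (k + ones s k + 1) x] at h0
    refine ⟨?_, (lt_of_head h0 h.lexWorld.head_max).le⟩
    rw [eq_prepend_of_head h.lexWorld.head_min, eq_prepend_of_head h0, prepend_le_prepend]
    rw [shift_succ (k + ones s k + 1) x] at hk
    exact h.min.le hk (hs' (k + 1)).1

theorem IsDesubst.head_max (h : IsDesubst α β α' β') : α' 0 = true := by
  rw [← h.max.head, h.lexWorld.head_max]

theorem IsDesubst.lexWorld' (h : IsDesubst α β α' β') (hβ : shift β 0 = false) :
    LexWorld α' β' := by
  refine lexWorld_iff.2 ⟨h.head_max, ?_, h.mem_of_prepend h.max h.lexWorld.zeroMax_mem,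
    h.mem_of_prepend h.min ?_⟩
  · rw [← h.min.head, hβ]
  · rw [← eq_prepend_of_head h.lexWorld.head_min]
    exact h.lexWorld.min_mem

theorem isSubst_zero (hs : IsSubst s x) : IsSubst (prepend [false] s) (prepend [false] x) :=
  isConcat_cons hs false

theorem isSubst_one (hs : IsSubst s x) :
    IsSubst (prepend [true] s) (prepend [true] (prepend [false] x)) := by
  have := isConcat_cons hs true
  rwa [show block [false] [true, false] true = [true] ++ [false] from rfl, prepend_append] at this

theorem IsDesubst.zeroMax (h : IsDesubst α β α' β') :
    IsSubst (prepend [false] α') (prepend [false] α) := isSubst_zero h.max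

theorem IsDesubst.oneMin (h : IsDesubst α β α' β') :
    IsSubst (prepend [true] β') (prepend [true] β) := by
  have := isSubst_one h.min
  rwa [← eq_prepend_of_head h.lexWorld.head_min] at this

/-- Unbalancedness is preserved: in `n` digits of the image of `s` there are `k` blocks with `n = k
+ ones s k` up to one digit, so that a larger number of ones means fewer blocks with more ones. -/
theorem IsDesubst.unbalanced (h : IsDesubst α β α' β')
    (hdesc : ∀ x ∈ lexShift α β, ∃ s, IsSubst s x) (hU : Unbalanced (lexShift α β)) :
    Unbalanced (lexShift α' β') := by
  have tail : ∀ x ∈ lexShift α β, ∃ j ≤ 2, ∃ s ∈ lexShift α' β', IsSubst s (shift^[j] x) := by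
    intro x hx
    have : ∃ j ≤ 2, prepend [false] (shift^[j] x) ∈ lexShift α β := by
      cases h0 : x 0
      · refine ⟨1, by omega, ?_⟩
        rwa [Function.iterate_one, ← eq_prepend_of_head h0]
      · obtain ⟨s, hs⟩ := hdesc x hx
        have h1 := hs 1
        rw [substWord_one, ← hs.head, h0] at h1
        have h2 : shift x 0 = false := h1 1 (by decide)
        refine ⟨2, le_rfl, ?_⟩
        rw [shift_succ, Function.iterate_one, ← eq_prepend_of_head h2]
        exact shift_mem_lexShift hx 1
    obtain ⟨j, hj, hj'⟩ := this
    obtain ⟨s, hs⟩ := hdesc _ (shift_mem_lexShift hx j)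
    exact ⟨j, hj, s, h.mem_of_prepend hs hj', hs⟩
  have count : ∀ {s x : BinSeq}, IsSubst s x → ∀ n, ∃ k, k + ones s k ≤ n ∧
      n ≤ k + ones s k + 1 ∧ ones s k ≤ ones x n ∧ ones x n ≤ ones s k + 1 := by
    intro s x hs n
    obtain ⟨k, rfl | ⟨rfl, h1, -⟩⟩ := hs.position n
    · exact ⟨k, le_rfl, by omega, (hs.ones k).ge, by rw [hs.ones k]; omega⟩
    · refine ⟨k, by omega, le_rfl, ?_⟩
      rw [ones_succ, hs.ones k, h1]
      simp
  obtain ⟨x, hx, y, hy, hxy⟩ := hU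
  obtain ⟨i, hi, s, hs, hsx⟩ := tail x hx
  obtain ⟨j, hj, t, ht, hty⟩ := tail y hy
  refine ⟨s, hs, t, ht, fun D => ?_⟩
  by_contra hc
  push Not at hc
  obtain ⟨n, hn⟩ := hxy (D + 6)
  obtain ⟨k, k1, k2, k3, k4⟩ := count hsx n
  obtain ⟨l, l1, l2, l3, l4⟩ := count hty n
  have h1 : ones x n ≤ i + ones (shift^[i] x) n := by
    have := ones_mono x (Nat.le_add_left n i)
    have := ones_le x i
    have := ones_add x i n
    omega
  have h2 : ones (shift^[j] y) n ≤ ones y n + j := by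
    have h3 := ones_add y j n
    have h4 := ones_add y n j
    have h5 := ones_le (shift^[n] y) j
    rw [Nat.add_comm n j] at h4
    omega
  rcases le_total k l with hkl | hkl
  · have h3 := hc k
    have h4 := ones_mono t hkl
    omega
  · omega

theorem flatMap_subst_count (w : List Bool) :
    (w.flatMap (block [false] [true, false])).count true = w.count true ∧
    (w.flatMap (block [false] [true, false])).count false = w.count true + w.count false := by
  induction w with
  | nil => simp
  | cons c w ih =>
    rw [List.flatMap_cons, List.count_append, List.count_append, ih.1, ih.2]
    cases c <;> simp [block, -List.count_true_add_count_false, -List.count_false_add_count_true] <;>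
      omega

theorem flatMap_subst_head (w : List Bool) :
    (w.flatMap (block [false] [true, false])).head? = w.head? := by
  rcases w with _ | ⟨_ | _, w⟩ <;> simp [block]

theorem IsDesubst.hasFreeWords (h : IsDesubst α β α' β') {k l : ℕ} (hF : HasFreeWords α' β' k l) :
    HasFreeWords α β (k + ones (prepend [false] α') k) (l + ones (prepend [true] β') l) := by
  obtain ⟨U, V, hU, hV, hUV, h1, h2, h3, h4, h5⟩ := hF
  obtain ⟨u1, u2⟩ := flatMap_subst_count U
  obtain ⟨v1, v2⟩ := flatMap_subst_count V
  refine ⟨U.flatMap (block [false] [true, false]), V.flatMap (block [false] [true, false]),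
    ?_, ?_, ?_, ?_, ?_, ?_, ?_, fun s y hs => ?_⟩
  · intro hc
    have hh := congrArg List.head? hc
    exact hU (by simpa [← List.head?_eq_none_iff, flatMap_subst_head] using hh)
  · intro hc
    have hh := congrArg List.head? hc
    exact hV (by simpa [← List.head?_eq_none_iff, flatMap_subst_head] using hh)
  · rwa [flatMap_subst_head, flatMap_subst_head]
  · rw [h.zeroMax.ones, u1]; exact h1
  · rw [h.zeroMax.ones, u2]; omega
  · rw [h.oneMin.ones, v1]; exact h3
  · rw [h.oneMin.ones, v2]; omega
  · have h6 := isConcat_concat hU hV s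
    exact h.mem (IsConcat.comp hU hV h6 hs) (h5 s _ h6)

/-- For `α < (10)^∞` the sequence `10α` exceeds `α`. Hence a period of `0α` cannot end in the middle
of a block `10`: then `10α` would be a tail of `0α`. -/
theorem not_prepend_le (hα : α <ₗ oneZero) :
    ¬ prepend [true] (prepend [false] α) ≤ₗ α := by
  obtain ⟨d, hd, hd0, hd1⟩ := lt_def.1 hα
  refine not_le.2 (lt_def.2 ⟨d, fun i hi => ?_, hd0, ?_⟩)
  · rw [hd i hi]
    rcases i with _ | _ | i
    · rfl
    · rfl
    · rw [prepend_singleton_succ, prepend_singleton_succ, hd i (by omega), oneZero_succ,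
        oneZero_succ, Bool.not_not]
  · rcases d with _ | _ | d
    · rfl
    · simp [oneZero] at hd1
    · rw [prepend_singleton_succ, prepend_singleton_succ, hd d (by omega), ← hd1, oneZero_succ,
        oneZero_succ, Bool.not_not]

/-- The induction step for `α < (10)^∞`: the pair is desubstituted, the sum of the periods
decreases, and free words for the new pair are mapped to free words for the old one. -/
theorem exists_desubst (hLW : LexWorld α β) {p q : ℕ}
    (hp : 0 < p) (hα : shift^[p] (prepend [false] α) = prepend [false] α) (hq : 0 < q)
    (hβ : shift^[q] (prepend [true] β) = prepend [true] β)
    (hU : Unbalanced (lexShift α β)) (hα' : α <ₗ oneZero) :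
    ∃ α' β' k l, LexWorld α' β' ∧ 0 < k ∧ shift^[k] (prepend [false] α') = prepend [false] α' ∧
      0 < l ∧ shift^[l] (prepend [true] β') = prepend [true] β' ∧ Unbalanced (lexShift α' β') ∧
      k + l < p + q ∧ (HasFreeWords α' β' k l → HasFreeWords α β p q) := by
  have hα1 : α 1 = false := by
    have h := shift_mono hα'.le (by rw [hLW.head_max]; rfl)
    exact head_of_le' h rfl
  have hno : ∀ x ∈ lexShift α β, ∀ n, x n = true → x (n + 1) = false := by
    intro x hx n hn
    have h := shift_mono (hx n).2 (by rw [shift_iterate_zero, hn, hLW.head_max])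
    rw [← shift_succ] at h
    rw [← shift_iterate_zero (n + 1) x]
    exact head_of_le' h hα1
  have hdesc : ∀ x ∈ lexShift α β, ∃ s, IsSubst s x := fun x hx => exists_isSubst (hno x hx)
  obtain ⟨α', hmax⟩ := hdesc α hLW.max_mem
  obtain ⟨β', hmin⟩ := hdesc (shift β) (shift_mem_lexShift hLW.min_mem 1)
  have h : IsDesubst α β α' β' := ⟨hLW, hmax, hmin⟩
  have hβ1 : shift β 0 = false := by
    by_contra hc
    rw [Bool.not_eq_false] at hc
    refine not_unbalanced_of_narrow (α := α) (β := β) ?_ ?_ hU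
    · refine hα'.le.trans (lt_def.2 ⟨1, fun j hj => ?_, rfl, rfl⟩).le
      obtain rfl : j = 0 := by omega
      rfl
    · rw [eq_prepend_of_head hLW.head_min, prepend_le_prepend]
      exact (lt_of_head rfl hc).le
  have hLW' := h.lexWorld' hβ1
  have ha := h.zeroMax
  have hb := h.oneMin
  obtain ⟨k, hk⟩ : ∃ k, p = k + ones (prepend [false] α') k := by
    obtain ⟨k, hk | ⟨hk, h1, h2, -⟩⟩ := ha.position p
    · exact ⟨k, hk⟩
    · exfalso
      set j := k + ones (prepend [false] α') k
      have h3 := (shift_mem_lexShift hLW.zeroMax_mem j 0).2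
      rw [Function.iterate_zero_apply,
        eq_prepend_of_head (x := shift^[j] (prepend [false] α)) (b := true)
          (by rw [shift_iterate_zero, h1]), ← shift_succ, ← hk, hα] at h3
      exact not_prepend_le hα' h3
  obtain ⟨l, hl⟩ : ∃ l, q = l + ones (prepend [true] β') l := by
    obtain ⟨l, hl | ⟨hl, h1, h2, -⟩⟩ := hb.position q
    · exact ⟨l, hl⟩
    · exfalso
      rw [← shift_iterate_zero q (prepend [true] β), hβ] at h2
      simp at h2
  have hk0 : 0 < k := by
    rcases Nat.eq_zero_or_pos k with rfl | h1
    · simp at hk; omega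
    · exact h1
  have hl0 : 0 < l := by
    rcases Nat.eq_zero_or_pos l with rfl | h1
    · simp at hl; omega
    · exact h1
  refine ⟨α', β', k, l, hLW', hk0, ?_, hl0, ?_, h.unbalanced hdesc hU, ?_, ?_⟩
  · have h1 := ha.shift k
    rw [← hk, hα] at h1
    exact h1.injective ha
  · have h1 := hb.shift l
    rw [← hl, hβ] at h1
    exact h1.injective hb
  · have h1 : ones (prepend [true] β') 1 ≤ ones (prepend [true] β') l := ones_mono _ hl0
    have h2 : ones (prepend [true] β') 1 = 1 := by simp [ones]
    omega
  · rw [hk, hl]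
    exact h.hasFreeWords

/-- Farey descent: an unbalanced lexicographic subshift with periodic bounds contains all free
concatenations of two words that are no longer than the periods. The pair or its mirror image is
desubstituted as long as `α < (10)^∞` or `β > (01)^∞`; the remaining pairs are covered by
`hasFreeWords_of_lt`, or they are balanced. -/
theorem exists_free_words (hLW : LexWorld α β) {p q : ℕ}
    (hp : 0 < p) (hα : shift^[p] (prepend [false] α) = prepend [false] α) (hq : 0 < q)
    (hβ : shift^[q] (prepend [true] β) = prepend [true] β)
    (hU : Unbalanced (lexShift α β)) : HasFreeWords α β p q := by
  induction hN : p + q using Nat.strong_induction_on generalizing α β p q with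
  | _ N ih =>
    have desc : ∀ {α β : BinSeq} {p q : ℕ}, LexWorld α β → 0 < p →
        shift^[p] (prepend [false] α) = prepend [false] α → 0 < q →
        shift^[q] (prepend [true] β) = prepend [true] β → Unbalanced (lexShift α β) →
        p + q = N → α <ₗ oneZero → HasFreeWords α β p q := by
      intro α β p q hLW hp hα hq hβ hU hN hlt
      obtain ⟨α', β', k, l, h1, h2, h3, h4, h5, h6, h7, h8⟩ :=
        exists_desubst hLW hp hα hq hβ hU hlt
      exact h8 (ih (k + l) (hN ▸ h7) h1 h2 h3 h4 h5 h6 rfl)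
    have hα' : shift^[p] (prepend [true] (mirror α)) = prepend [true] (mirror α) := by
      rw [← mirror_prepend_false, shift_mirror, hα]
    have hβ' : shift^[q] (prepend [false] (mirror β)) = prepend [false] (mirror β) := by
      rw [← mirror_prepend_true, shift_mirror, hβ]
    rcases lt_or_ge (toLex α) (toLex oneZero) with h1 | h1
    · exact desc hLW hp hα hq hβ hU hN h1
    rcases lt_or_ge (toLex (mirror β)) (toLex oneZero) with h2 | h2
    · exact (desc hLW.mirror hq hβ' hp hα' hU.mirror (by omega) h2).of_mirror
    have h3 : β ≤ₗ mirror oneZero := by rwa [← mirror_le, mirror_mirror]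
    have h4 : mirror α ≤ₗ mirror oneZero := mirror_le.2 h1
    rcases lt_or_ge (toLex (prepend [true] oneZero)) (toLex α) with h5 | h5
    · exact hasFreeWords_of_lt hLW hp hα hq hβ h3 h5
    rcases lt_or_ge (toLex (prepend [true] oneZero)) (toLex (mirror β)) with h6 | h6
    · exact (hasFreeWords_of_lt hLW.mirror hq hβ' hp hα' h4 h6).of_mirror
    refine absurd hU (not_unbalanced_of_narrow h5 ?_)
    rwa [← mirror_le, mirror_prepend_false, mirror_mirror]

end

/-! ### The entropies of the essential component and of the renewal system -/

section

section Entropy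

variable {α β : BinSeq} {ω ν : List Bool} {C : Set BinSeq}

theorem length_eq_count (w : List Bool) : w.length = w.count true + w.count false := by
  induction w with
  | nil => rfl
  | cons c w ih =>
    rw [List.length_cons, List.count_cons, List.count_cons, ih]
    cases c <;> simp <;> omega

theorem InBox.head_ne (h : InBox α β ω ν) : ω.head? ≠ ν.head? := by
  rw [head?_eq_some_iff.2 ⟨h.left_ne, h.left_head⟩, head?_eq_some_iff.2 ⟨h.right_ne, h.right_head⟩]
  simp

/-- The entropy of `{ω,ν}^∞` is `log₂ t⁻¹`, where `t^|ω| + t^|ν| = 1`; the free words inside the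
essential component are no longer than `ω` and `ν` and produce at least this entropy. -/
theorem InBox.exists_entropy_renewal (h : InBox α β ω ν) (hU : Unbalanced (lexShift α β)) :
    ∃ t : ℝ, 0 < t ∧ t < 1 ∧ t ^ ω.length + t ^ ν.length = 1 ∧
      entropy (renewal ω ν) = Real.logb 2 t⁻¹ ∧
      Real.logb 2 t⁻¹ ≤ entropy (essentialComponent ω ν) := by
  have hω := List.length_pos_iff.2 h.left_ne
  have hν := List.length_pos_iff.2 h.right_ne
  obtain ⟨t, ht0, ht1, ht⟩ := exists_growth hω hν
  refine ⟨t, ht0, ht1, ht, le_antisymm (entropy_renewal_le h.left_ne h.right_ne ht0 ht1.le ht.le)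
    (le_entropy_renewal h.left_ne h.right_ne h.head_ne ht0 ht1.le ht.ge), ?_⟩
  obtain ⟨U, V, hU, hV, hUV, h1, h2, h3, h4, h5⟩ := exists_free_words h.corner hω
    (by rw [h.left_eq, shift_periodicSeq]) hν (by rw [h.right_eq, shift_periodicSeq])
    (h.unbalanced hU)
  have hUl := length_eq_count U
  have hVl := length_eq_count V
  refine le_entropy_of_concat hU hV hUV h5 ((one_le_inv₀ ht0).2 ht1.le) ?_
  rw [inv_inv, ← ht]
  exact add_le_add (pow_le_pow_of_le_one ht0.le ht1.le (by omega))
    (pow_le_pow_of_le_one ht0.le ht1.le (by omega))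

theorem InBox.entropy_renewal_le (h : InBox α β ω ν) (hU : Unbalanced (lexShift α β)) :
    entropy (renewal ω ν) ≤ entropy (essentialComponent ω ν) := by
  obtain ⟨t, -, -, -, h1, h2⟩ := h.exists_entropy_renewal hU
  exact h1.trans_le h2

theorem InBox.entropy_eq (h : InBox α β ω ν) (hU : Unbalanced (lexShift α β)) :
    entropy (essentialComponent ω ν) = entropy (lexShift α β) :=
  (entropy_le_of_decomposition ⟨α, h.lexWorld.max_mem⟩ ⟨_, h.left_mem⟩ renewal_nonempty
    h.essentialComponent_subset (h.entropy_renewal_le hU) (fun _ hx n => h.pre_decomposition hx n)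
    fun _ hx => shift_mem_lexShift hx 1).symm

theorem InBox.entropy_lt (h : InBox α β ω ν) (hU : Unbalanced (lexShift α β))
    (hG : Glues (lexShift α β)) (hC : IsTransitiveComponent (lexShift α β) C)
    (hne : C ≠ essentialComponent ω ν)
    (hA : IsTransitiveSubsystem (lexShift α β) (essentialComponent ω ν)) :
    entropy C < entropy (renewal ω ν) := by
  obtain ⟨t, ht0, ht1, ht, h1, -⟩ := h.exists_entropy_renewal hU
  obtain ⟨M, hM⟩ := h.exists_bounded_runs hG hC hne hA
  rw [h1]
  exact entropy_lt_of_bounded_runs h.left_ne h.right_ne ht0 ht1 ht hC.1.2.1 hM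

end Entropy

/-! ### Existence of transitive components -/

section Components

variable {S A : Set BinSeq} {x : BinSeq}

/-- The closure of the union of a chain of transitive subsystems is a transitive subsystem. -/
theorem exists_transitiveSubsystem_of_chain (hS : IsClosed S) {c : Set (Set BinSeq)}
    (hc : ∀ A ∈ c, IsTransitiveSubsystem S A) (hchain : IsChain (· ⊆ ·) c) (hne : c.Nonempty) :
    ∃ B, IsTransitiveSubsystem S B ∧ ∀ A ∈ c, A ⊆ B := by
  set B : Set BinSeq := {x | ∀ n, ∃ A ∈ c, ∃ y ∈ A, ∀ i < n, x i = y i} with hB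
  have hsub : ∀ A ∈ c, A ⊆ B := fun A hA x hx n => ⟨A, hA, x, hx, fun _ _ => rfl⟩
  have hlang : ∀ w ∈ language B, ∃ A ∈ c, w ∈ language A := by
    rintro w ⟨x, hx, k, hk⟩
    obtain ⟨A, hA, y, hy, hxy⟩ := hx (k + w.length)
    refine ⟨A, hA, y, hy, k, fun i hi => ?_⟩
    rw [← hxy _ (by omega)]
    exact hk i hi
  refine ⟨B, ⟨fun x hx => ?_, ?_, ?_, ?_, ?_⟩, hsub⟩
  · refine agree_of_isClosed hS fun n => ?_
    obtain ⟨A, hA, y, hy, hxy⟩ := hx n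
    exact ⟨y, (hc A hA).1 hy, hxy⟩
  · obtain ⟨A, hA⟩ := hne
    exact (hc A hA).2.1.mono (hsub A hA)
  · refine isClosed_of_agree fun x hx n => ?_
    obtain ⟨y, hy, hxy⟩ := hx n
    obtain ⟨A, hA, z, hz, hyz⟩ := hy n
    exact ⟨A, hA, z, hz, fun i hi => (hxy i hi).trans (hyz i hi)⟩
  · apply Subset.antisymm
    · rintro _ ⟨x, hx, rfl⟩ n
      obtain ⟨A, hA, y, hy, hxy⟩ := hx (n + 1)
      exact ⟨A, hA, _, (hc A hA).shift_mem y hy, fun i hi => hxy (i + 1) (by omega)⟩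
    · intro x hx
      -- if no preimage belongs to the closure, then a long prefix of `x` has no preimage in any
      -- member of the chain
      by_contra hcon
      have hb : ∀ b : Bool, ∃ n, ∀ A ∈ c, ∀ y ∈ A, ¬ ∀ i < n, prepend [b] x i = y i := by
        intro b
        by_contra h
        push Not at h
        exact hcon ⟨prepend [b] x, h, by simp⟩
      choose n hn using hb
      obtain ⟨A, hA, y, hy, hxy⟩ := hx (max (n false) (n true))
      obtain ⟨z, hz, rfl⟩ := (hc A hA).2.2.2.1.ge hy
      refine hn (z 0) A hA z hz fun i hi => ?_
      rcases i with _ | i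
      · rfl
      · rw [prepend_singleton_succ]
        refine hxy i (lt_of_lt_of_le (by omega : i < n (z 0)) ?_)
        cases z 0
        · exact le_max_left _ _
        · exact le_max_right _ _
  · intro u hu v hv
    obtain ⟨A, hA, hu⟩ := hlang u hu
    obtain ⟨A', hA', hv⟩ := hlang v hv
    obtain ⟨D, hD, hu, hv⟩ : ∃ D ∈ c, u ∈ language D ∧ v ∈ language D := by
      rcases hchain.total hA hA' with h | h
      · exact ⟨A', hA', language_mono h hu, hv⟩
      · exact ⟨A, hA, hu, language_mono h hv⟩
    obtain ⟨b, hb, hb'⟩ := (hc D hD).2.2.2.2 u hu v hv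
    exact ⟨b, language_mono (hsub D hD) hb, language_mono (hsub D hD) hb'⟩

/-- Every transitive subsystem is contained in a transitive component, by Zorn's lemma. -/
theorem IsTransitiveSubsystem.exists_component (hS : IsClosed S)
    (hA : IsTransitiveSubsystem S A) : ∃ B, IsTransitiveComponent S B ∧ A ⊆ B := by
  obtain ⟨B, hAB, hB⟩ := zorn_subset_nonempty {A | IsTransitiveSubsystem S A}
    (fun c hc hchain hne => exists_transitiveSubsystem_of_chain hS hc hchain hne) A hA
  exact ⟨B, ⟨hB.prop, fun A' hA' h => (hB.eq_of_subset hA' h).symm⟩, hAB⟩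

/-- A periodic orbit is a transitive subsystem. -/
theorem isTransitiveSubsystem_orbit (hS : ∀ n, shift^[n] x ∈ S) (hx : IsPeriodicSeq x) :
    IsTransitiveSubsystem S (range fun n => shift^[n] x) := by
  obtain ⟨p, hp, hpx⟩ := hx
  have hlang : ∀ w, w ∈ language (range fun n => shift^[n] x) ↔ ∃ k, OccursAt w x k := by
    intro w
    constructor
    · rintro ⟨_, ⟨n, rfl⟩, k, hk⟩
      refine ⟨n + k, fun i hi => ?_⟩
      rw [← hk i hi]
      change _ = shift^[n] x (k + i)
      rw [shift_iterate, Nat.add_assoc]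
    · rintro ⟨k, hk⟩
      exact ⟨x, ⟨0, rfl⟩, k, hk⟩
  refine ⟨?_, range_nonempty _, ?_, ?_, ?_⟩
  · rintro _ ⟨n, rfl⟩
    exact hS n
  · refine Finite.isClosed (((finite_lt_nat p).image fun n => shift^[n] x).subset ?_)
    rintro _ ⟨n, rfl⟩
    exact ⟨n % p, Nat.mod_lt n hp, (period_mod hpx n).symm⟩
  · apply Subset.antisymm
    · rintro _ ⟨_, ⟨n, rfl⟩, rfl⟩
      exact ⟨n + 1, shift_succ n x⟩
    · rintro _ ⟨n, rfl⟩
      refine ⟨shift^[n + (p - 1)] x, ⟨_, rfl⟩, ?_⟩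
      rw [← shift_succ, Nat.add_assoc, Nat.sub_add_cancel hp, ← shift_shift, hpx]
  · intro u hu v hv
    obtain ⟨k, hk⟩ := (hlang u).1 hu
    obtain ⟨l, hl⟩ := (hlang v).1 hv
    set m := k + u.length with hm
    have hml : m ≤ l + p * m := (Nat.le_mul_of_pos_left m hp).trans (Nat.le_add_left _ _)
    obtain ⟨r, hr⟩ := Nat.exists_eq_add_of_le hml
    have hv' : ∀ i (hi : i < v.length), x (m + r + i) = v[i] := by
      intro i hi
      rw [← hl i hi, ← hr, show l + p * m + i = p * m + (l + i) by ring,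
        ← shift_iterate (p * m) x, iterate_mul_period hpx]
    refine ⟨pre (shift^[m] x) r, (hlang _).2 ⟨m, fun i hi => ?_⟩, (hlang _).2 ⟨k, ?_⟩⟩
    · rw [getElem_pre, shift_iterate]
    · rw [occursAt_iff_shift, occursAt_append, occursAt_append]
      refine ⟨⟨occursAt_iff_shift.1 hk, ?_⟩, fun i hi => ?_⟩
      · rw [shift_shift, Nat.add_comm, ← hm]
        exact fun i hi => by rw [Nat.zero_add, getElem_pre]
      · rw [shift_shift, shift_iterate, List.length_append, length_pre, ← hv' i hi]
        congr 1
        omega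

end Components

/-- Unless `(α, β)` is the corner of the box, one of the periodic orbits of `α` and `β` is not
contained in the essential component. -/
theorem InBox.exists_other_component {α β : BinSeq} {ω ν : List Bool} (h : InBox α β ω ν)
    (hα : IsPeriodicSeq α) (hβ : IsPeriodicSeq β) (hne : (α, β) ≠ cornerPair ω ν) :
    ∃ B, IsTransitiveComponent (lexShift α β) B ∧ B ≠ essentialComponent ω ν := by
  have key : ∀ x ∈ lexShift α β, IsPeriodicSeq x → x ∉ essentialComponent ω ν →
      ∃ B, IsTransitiveComponent (lexShift α β) B ∧ B ≠ essentialComponent ω ν := by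
    intro x hx hp hxA
    obtain ⟨B, hB, hsub⟩ := (isTransitiveSubsystem_orbit (shift_mem_lexShift hx)
      hp).exists_component isClosed_lexShift
    exact ⟨B, hB, fun hc => hxA (hc ▸ hsub ⟨0, rfl⟩)⟩
  by_cases hα' : α ∈ essentialComponent ω ν
  · by_cases hβ' : β ∈ essentialComponent ω ν
    · have h1 : α = shift (periodicSeq ω) := le_antisymm' (hα' 0).2 h.corner_le
      have h2 : β = shift (periodicSeq ν) := le_antisymm' h.le_corner (hβ' 0).1
      exact absurd (Prod.ext h1 h2) hne
    · exact key β h.lexWorld.min_mem hβ hβ'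
  · exact key α h.lexWorld.max_mem hα hα'

end

/-! ### Cycles of the doubling map -/

section

variable {α β x y : BinSeq}

theorem summable_proj (x : BinSeq) :
    Summable fun i : ℕ => (if x i then (1 : ℝ) else 0) / 2 ^ (i + 1) := by
  refine Summable.of_nonneg_of_le (fun i => by positivity) (fun i => ?_)
    (summable_geometric_two' (1 : ℝ))
  rw [pow_succ', div_div]
  gcongr
  split_ifs <;> norm_num

theorem proj_eq (x : BinSeq) :
    proj x = (if x 0 then (1 : ℝ) else 0) / 2 + proj (shift x) / 2 := by
  rw [proj, (summable_proj x).tsum_eq_zero_add, proj, ← tsum_div_const]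
  congr 1
  · simp
  · refine tsum_congr fun i => ?_
    rw [pow_succ (2 : ℝ) (i + 1), div_div]
    rfl

theorem proj_nonneg (x : BinSeq) : 0 ≤ proj x := tsum_nonneg fun i => by positivity

theorem proj_mirror (x : BinSeq) : proj (mirror x) + proj x = 1 := by
  rw [proj, proj, ← (summable_proj _).tsum_add (summable_proj x)]
  have h := tsum_geometric_two' (1 : ℝ)
  refine (tsum_congr fun i => ?_).trans h
  rw [← add_div, pow_succ', div_div]
  congr 1
  cases hx : x i <;> simp [mirror, hx]

theorem proj_le_one (x : BinSeq) : proj x ≤ 1 := by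
  have := proj_nonneg (mirror x)
  have := proj_mirror x
  linarith

theorem proj_pos {n : ℕ} (h : x n = true) : 0 < proj x := by
  refine (summable_proj x).tsum_pos (fun i => by positivity) n ?_
  rw [h, if_pos rfl]
  positivity

theorem proj_lt_one {n : ℕ} (h : x n = false) : proj x < 1 := by
  have := proj_pos (x := mirror x) (n := n) (by simp [mirror, h])
  have := proj_mirror x
  linarith

/-- The projection is strictly increasing except at the two expansions of a dyadic rational. -/
theorem proj_lt (h : x <ₗ y)
    (h' : ∀ n, (∃ m, n < m ∧ y m = true) ∨ ∃ m, n < m ∧ x m = false) : proj x < proj y := by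
  obtain ⟨d, hd, h0, h1⟩ := lt_def.1 h
  induction d generalizing x y with
  | zero =>
    rw [proj_eq x, proj_eq y, h0, h1]
    have hx := proj_le_one (shift x)
    have hy := proj_nonneg (shift y)
    rcases h' 0 with ⟨m, hm, hm'⟩ | ⟨m, hm, hm'⟩
    · have := proj_pos (x := shift y) (n := m - 1) (by rw [shift, Nat.sub_add_cancel hm, hm'])
      simp
      linarith
    · have := proj_lt_one (x := shift x) (n := m - 1) (by rw [shift, Nat.sub_add_cancel hm, hm'])
      simp
      linarith
  | succ d ih =>
    have hs : shift x <ₗ shift y :=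
      lt_def.2 ⟨d, fun j hj => hd (j + 1) (by omega), h0, h1⟩
    have h2 := ih hs (fun n => ?_) (fun j hj => hd (j + 1) (by omega)) h0 h1
    · rw [proj_eq x, proj_eq y, hd 0 (by omega)]
      linarith
    · rcases h' (n + 1) with ⟨m, hm, hm'⟩ | ⟨m, hm, hm'⟩
      · exact Or.inl ⟨m - 1, by omega, by rw [shift, Nat.sub_add_cancel (by omega), hm']⟩
      · exact Or.inr ⟨m - 1, by omega, by rw [shift, Nat.sub_add_cancel (by omega), hm']⟩

theorem proj_true : proj (fun _ => true) = 1 := by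
  have := proj_eq (fun _ => true)
  have h : shift (fun _ => true) = fun _ => true := rfl
  rw [h] at this
  simp at this
  linarith

theorem proj_false : proj (fun _ => false) = 0 := by simp [proj]

/-- The representative in `[0,1)` of a point of the circle. -/
noncomputable def rep (t : UnitAddCircle) : ℝ := AddCircle.equivIco (1 : ℝ) 0 t

theorem coe_rep (t : UnitAddCircle) : (rep t : UnitAddCircle) = t := AddCircle.coe_equivIco

theorem rep_nonneg (t : UnitAddCircle) : 0 ≤ rep t := (AddCircle.equivIco (1 : ℝ) 0 t).2.1

theorem rep_lt_one (t : UnitAddCircle) : rep t < 1 :=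
  (AddCircle.equivIco (1 : ℝ) 0 t).2.2.trans_eq (zero_add 1)

theorem rep_coe {r : ℝ} (h0 : 0 ≤ r) (h1 : r < 1) : rep (r : UnitAddCircle) = r :=
  AddCircle.equivIco_coe_of_mem (by simpa using ⟨h0, h1⟩)

theorem rep_doubling (t : UnitAddCircle) :
    rep (doubling t) = 2 * rep t - if 1 / 2 ≤ rep t then 1 else 0 := by
  have h0 := rep_nonneg t
  have h1 := rep_lt_one t
  have h2 : doubling t = ((2 * rep t - if 1 / 2 ≤ rep t then 1 else 0 : ℝ) : UnitAddCircle) := by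
    have h3 : doubling t = ((2 * rep t : ℝ) : UnitAddCircle) := by
      rw [doubling, two_nsmul, two_mul, AddCircle.coe_add, coe_rep]
    rw [h3, AddCircle.coe_sub]
    split_ifs
    · rw [AddCircle.coe_period, sub_zero]
    · rw [AddCircle.coe_zero, sub_zero]
  rw [h2]
  split_ifs with h
  · exact rep_coe (by linarith) (by linarith)
  · exact rep_coe (by linarith) (by linarith)

/-- The binary digits of a point of the circle. -/
noncomputable def digits (t : UnitAddCircle) : BinSeq :=
  fun n => decide (1 / 2 ≤ rep (doubling^[n] t))

theorem shift_digits (t : UnitAddCircle) (n : ℕ) :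
    shift^[n] (digits t) = digits (doubling^[n] t) := by
  funext i
  rw [shift_iterate, digits, digits, ← Function.iterate_add_apply, Nat.add_comm]

/-- The binary digits represent the point: applying the doubling map doubles the error, which
remains at most `1`. -/
theorem proj_digits (t : UnitAddCircle) : proj (digits t) = rep t := by
  have key : ∀ n t, |proj (digits t) - rep t| ≤ 1 / 2 ^ n := by
    intro n
    induction n with
    | zero =>
      intro t
      rw [abs_le]
      have h1 := proj_nonneg (digits t)
      have h2 := proj_le_one (digits t)
      have h3 := rep_nonneg t
      have h4 := rep_lt_one t
      constructor <;> norm_num <;> linarith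
    | succ n ih =>
      intro t
      have h1 := ih (doubling t)
      have h2 : shift (digits t) = digits (doubling t) := shift_digits t 1
      have h3 : digits t 0 = decide (1 / 2 ≤ rep t) := rfl
      have h4 : proj (digits t) - rep t = (proj (digits (doubling t)) - rep (doubling t)) / 2 := by
        rw [proj_eq (digits t), h2, rep_doubling, h3]
        simp only [decide_eq_true_eq]
        ring
      rw [h4, abs_div, abs_two, pow_succ, ← div_div]
      linarith
  have h : |proj (digits t) - rep t| ≤ 0 := by
    refine ge_of_tendsto' (x := atTop) (f := fun n : ℕ => (1 / 2 : ℝ) ^ n) ?_ fun n => ?_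
    · exact tendsto_pow_atTop_nhds_zero_of_lt_one (by norm_num) (by norm_num)
    · have := key n t
      rwa [one_div_pow]
  exact sub_eq_zero.1 (abs_nonpos_iff.1 h)

theorem digits_injective : Function.Injective digits := fun s t h => by
  rw [← coe_rep s, ← coe_rep t, ← proj_digits, ← proj_digits, h]

theorem minimalPeriod_digits (t : UnitAddCircle) :
    Function.minimalPeriod shift (digits t) = Function.minimalPeriod doubling t := by
  have h : ∀ n, Function.IsPeriodicPt shift n (digits t) ↔ Function.IsPeriodicPt doubling n t := by
    intro n
    rw [Function.IsPeriodicPt, Function.IsPeriodicPt, Function.IsFixedPt, Function.IsFixedPt,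
      shift_digits, digits_injective.eq_iff]
  refine Nat.dvd_antisymm ?_ ?_
  · rw [← Function.isPeriodicPt_iff_minimalPeriod_dvd, h]
    exact Function.isPeriodicPt_minimalPeriod _ _
  · rw [← Function.isPeriodicPt_iff_minimalPeriod_dvd, ← h]
    exact Function.isPeriodicPt_minimalPeriod _ _

/-- A periodic sequence of least period at least `2` contains both digits infinitely often. -/
theorem exists_digit {n : ℕ} (hn : 2 ≤ n) (hx : Function.minimalPeriod shift x = n) (c : Bool)
    (k : ℕ) : ∃ m, k < m ∧ x m = c := by
  by_contra hc
  push Not at hc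
  have hp : shift^[n] x = x := by
    rw [← hx]; exact Function.isPeriodicPt_minimalPeriod _ _
  have hconst : ∀ m, x m = !c := by
    intro m
    have h1 : x (n * (k + 1) + m) = x m := by
      rw [← shift_iterate (n * (k + 1)) x, iterate_mul_period hp]
    rw [← h1]
    have h2 : k + 1 ≤ n * (k + 1) := Nat.le_mul_of_pos_left _ (by omega)
    exact Bool.eq_not.2 (hc (n * (k + 1) + m) (by omega))
  have h1 : Function.IsPeriodicPt shift 1 x := funext fun m => by
    rw [shift_iterate, hconst, hconst]
  have h2 := Nat.le_of_dvd one_pos h1.minimalPeriod_dvd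
  omega

/-- A point outside the hole lies to the left or to the right of it, according to its first digit.
-/
theorem rep_le_or_le_rep_of_notMem_hole {a b : ℝ} (ha : a < 1 / 2) (hb : 1 / 2 < b)
    {t : UnitAddCircle} (h : t ∉ hole a b) :
    (digits t 0 = false → rep t ≤ a) ∧ (digits t 0 = true → b ≤ rep t) := by
  have h1 : rep t ∉ Ioo a b := fun hc => h ⟨_, hc, coe_rep t⟩
  have h2 : digits t 0 = decide (1 / 2 ≤ rep t) := rfl
  rw [h2]
  constructor
  · intro h3
    by_contra hc
    simp only [decide_eq_false_iff_not] at h3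
    exact h1 ⟨by linarith, by linarith⟩
  · intro h3
    by_contra hc
    simp only [decide_eq_true_eq] at h3
    exact h1 ⟨by linarith, by linarith⟩

/-- The digits of a cycle that avoids the hole eventually lie in `Σ_(α,β)`. Such a cycle obeys the
bounds `0α` and `1β`; the outer bounds `α` and `β` hold from the first digit `1` after a digit `0`
on. -/
theorem exists_shift_digits_mem (hLW : LexWorld α β)
    (hD : (proj (prepend [false] α), proj (prepend [true] β)) ∈ D₁) {n : ℕ} (hn : 2 ≤ n)
    {t : UnitAddCircle} (ht : Function.minimalPeriod doubling t = n)
    (hhole : ∀ k, doubling^[k] t ∉ hole (proj (prepend [false] α)) (proj (prepend [true] β))) :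
    ∃ k, shift^[k] (digits t) ∈ lexShift α β := by
  have hx := (minimalPeriod_digits t).trans ht
  set x := digits t with hxdef
  have inf : ∀ c k i, ∃ m, i < m ∧ shift^[k] x m = c := fun c k i => by
    obtain ⟨m, hm, hm'⟩ := exists_digit hn hx c (k + i)
    refine ⟨m - k, by omega, ?_⟩
    rw [shift_iterate, Nat.add_sub_cancel' (by omega), hm']
  obtain ⟨⟨-, ha⟩, ⟨hb, -⟩, -⟩ := hD
  have tails : ∀ k, (shift^[k] x 0 = false → shift^[k] x ≤ₗ prepend [false] α) ∧
      (shift^[k] x 0 = true → prepend [true] β ≤ₗ shift^[k] x) := by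
    intro k
    have h1 := rep_le_or_le_rep_of_notMem_hole ha hb (hhole k)
    rw [← shift_digits, ← proj_digits, ← shift_digits, ← hxdef] at h1
    constructor
    · intro h0
      by_contra hc
      have := proj_lt (not_le.1 hc) fun i => Or.inl (inf true k i)
      linarith [h1.1 h0]
    · intro h0
      by_contra hc
      have := proj_lt (not_le.1 hc) fun i => Or.inr (inf false k i)
      linarith [h1.2 h0]
  -- a digit `0` followed by a digit `1`
  obtain ⟨m, hm0, hm1⟩ : ∃ m, x m = false ∧ x (m + 1) = true := by
    by_contra hc
    push Not at hc
    obtain ⟨m, -, hm⟩ := exists_digit hn hx false 0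
    have h0 : ∀ i, x (m + i) = false := fun i => by
      induction i with
      | zero => exact hm
      | succ i ih => exact Bool.eq_false_of_not_eq_true (hc _ ih)
    obtain ⟨l, hl, hl'⟩ := exists_digit hn hx true m
    have := h0 (l - m)
    rw [Nat.add_sub_cancel' hl.le, hl'] at this
    simp at this
  refine ⟨m + 1, mem_lexShift_of_tails ?_ ?_ (fun i => ?_) fun i => ?_⟩
  · exact (lt_of_head hLW.head_min (by rw [shift_iterate_zero, hm1])).le
  · have h1 := (tails m).1 (by rw [shift_iterate_zero, hm0])
    rw [eq_prepend_of_head (x := shift^[m] x) (b := false) (by rw [shift_iterate_zero, hm0]),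
      prepend_le_prepend, ← shift_succ] at h1
    exact h1
  · rw [shift_shift]; exact (tails _).1
  · rw [shift_shift]; exact (tails _).2

/-- If only finitely many lengths are bad, then there are cycles of lengths `n` and `n + 1` which
avoid the hole. A common frequency of ones would be a multiple of both `1/n` and `1/(n+1)`, hence an
integer, although both digits occur. -/
theorem unbalanced_of_mem_D₂ (hLW : LexWorld α β)
    (hD : (proj (prepend [false] α), proj (prepend [true] β)) ∈ D₂) :
    Unbalanced (lexShift α β) := by
  obtain ⟨hD, hfin⟩ := hD
  obtain ⟨N, hN⟩ := hfin.bddAbove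
  set n := max N 3 + 1 with hn
  have good : ∀ m, n ≤ m → ∃ x ∈ lexShift α β, Function.minimalPeriod shift x = m := by
    intro m hm
    have hm3 : 3 ≤ m := by omega
    have h1 : m ∉ bad (proj (prepend [false] α)) (proj (prepend [true] β)) := fun h => by
      have := hN h
      omega
    have h2 : ∃ t : UnitAddCircle, Function.minimalPeriod doubling t = m ∧
        ∀ k, doubling^[k] t ∉ hole (proj (prepend [false] α)) (proj (prepend [true] β)) := by
      by_contra hc
      push Not at hc
      exact h1 ⟨hm3, hc⟩
    obtain ⟨t, ht, hk⟩ := h2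
    obtain ⟨k, hk⟩ := exists_shift_digits_mem hLW hD (by omega) ht hk
    refine ⟨_, hk, ?_⟩
    rw [← ht, ← minimalPeriod_digits]
    refine Function.minimalPeriod_apply_iterate ?_ k
    rw [← Function.minimalPeriod_pos_iff_mem_periodicPts, minimalPeriod_digits, ht]
    omega
  obtain ⟨x, hx, hxn⟩ := good n le_rfl
  obtain ⟨y, hy, hyn⟩ := good (n + 1) (by omega)
  have hxp : shift^[n] x = x := by rw [← hxn]; exact Function.isPeriodicPt_minimalPeriod _ _
  have hyp : shift^[n + 1] y = y := by rw [← hyn]; exact Function.isPeriodicPt_minimalPeriod _ _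
  by_contra hU
  have bdd : ∀ x ∈ lexShift α β, ∀ y ∈ lexShift α β, ∃ C, ∀ k, ones x k ≤ ones y k + C := by
    intro x hx y hy
    by_contra hc
    push Not at hc
    exact hU ⟨x, hx, y, hy, hc⟩
  obtain ⟨C, hC⟩ := bdd x hx y hy
  obtain ⟨D, hD⟩ := bdd y hy x hx
  -- compare the numbers of ones in a common multiple of the two periods
  have cx : ∀ k, ones x (n * (n + 1) * k) = ones x n * (n + 1) * k := fun k => by
    rw [mul_assoc, ones_mul_period hxp, mul_assoc]
  have cy : ∀ k, ones y (n * (n + 1) * k) = ones y (n + 1) * n * k := fun k => by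
    rw [mul_comm n, mul_assoc, ones_mul_period hyp, mul_assoc]
  have heq : ones x n * (n + 1) = ones y (n + 1) * n := by
    apply le_antisymm
    · by_contra hc
      have h1 := hC (n * (n + 1) * (C + 1))
      rw [cx, cy] at h1
      have h2 := Nat.mul_le_mul_right (C + 1) (Nat.succ_le_of_lt (not_le.1 hc))
      rw [Nat.succ_eq_add_one, add_mul] at h2
      omega
    · by_contra hc
      have h1 := hD (n * (n + 1) * (D + 1))
      rw [cx, cy] at h1
      have h2 := Nat.mul_le_mul_right (D + 1) (Nat.succ_le_of_lt (not_le.1 hc))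
      rw [Nat.succ_eq_add_one, add_mul] at h2
      omega
  have hdvd : n ∣ ones x n :=
    Nat.Coprime.dvd_of_dvd_mul_right (Nat.coprime_self_add_right.2 (Nat.coprime_one_right n))
      ⟨ones y (n + 1), by rw [heq, mul_comm]⟩
  have hpos : ∀ m, x m = true → 0 < ones x n := by
    intro m hm
    have h1 : 0 < ones x (n * (m + 1)) := by
      have h2 : ones x (m + 1) ≤ ones x (n * (m + 1)) :=
        ones_mono x (Nat.le_mul_of_pos_left _ (by omega))
      rw [ones_succ, hm] at h2
      simp only [Bool.toNat_true] at h2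
      omega
    rw [ones_mul_period hxp] at h1
    exact Nat.pos_of_mul_pos_right h1
  have hlt : ∀ m, x m = false → ones x n < n := by
    intro m hm
    by_contra hc
    have h0 : ones x n = n := le_antisymm (ones_le x n) (not_lt.1 hc)
    have h1 := ones_mul_period hxp (m + 1)
    have h2 : m + 1 ≤ n * (m + 1) := Nat.le_mul_of_pos_left _ (by omega)
    have h3 := ones_add x (m + 1) (n * (m + 1) - (m + 1))
    rw [Nat.add_sub_cancel' h2, h1, h0, ones_succ, hm] at h3
    have h4 := ones_le x m
    have h5 := ones_le (shift^[m + 1] x) (n * (m + 1) - (m + 1))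
    simp only [Bool.toNat_false] at h3
    omega
  obtain ⟨m, -, hm⟩ := exists_digit (by omega) hxn true 0
  obtain ⟨m', -, hm'⟩ := exists_digit (by omega) hxn false 0
  have h1 := Nat.le_of_dvd (hpos m hm) hdvd
  have h2 := hlt m' hm'
  omega

theorem ne_const_of_mem_D₁ (hD : (proj (prepend [false] α), proj (prepend [true] β)) ∈ D₁) :
    (α ≠ fun _ => true) ∧ (β ≠ fun _ => false) := by
  obtain ⟨⟨-, ha⟩, ⟨hb, -⟩, -⟩ := hD
  constructor
  · rintro rfl
    change proj _ < 1 / 2 at ha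
    rw [proj_eq, shift_prepend_singleton, proj_true] at ha
    simp at ha
  · rintro rfl
    change 1 / 2 < proj _ at hb
    rw [proj_eq, shift_prepend_singleton, proj_false] at hb
    simp at hb

end

end LexShift

theorem mainTheorem6 (α β : BinSeq) (hLW : LexWorld α β)
    (hD₂ : (proj (prepend [false] α), proj (prepend [true] β)) ∈ D₂)
    (hSFT : IsSFT (lexShift α β)) :
    (∃ ω ν : List Bool, IsEssentialWordPair ω ν ∧ (α, β) ∈ renormBox ω ν) ∧
    ∀ ω ν : List Bool, IsEssentialWordPair ω ν → (α, β) ∈ renormBox ω ν →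
      IsTransitiveComponent (lexShift α β) (essentialComponent ω ν) ∧
      lexShift α β ∩ shift ⁻¹' essentialComponent ω ν = essentialComponent ω ν ∧
      entropy (essentialComponent ω ν) = entropy (lexShift α β) ∧
      (∀ C : Set BinSeq, IsTransitiveComponent (lexShift α β) C →
        (entropy C = entropy (lexShift α β) ↔ C = essentialComponent ω ν)) ∧
      (∀ B : Set BinSeq, IsTransitiveComponent (lexShift α β) B → B ≠ essentialComponent ω ν →
        entropy B < entropy (renewal ω ν)) ∧
      entropy (renewal ω ν) ≤ entropy (essentialComponent ω ν) ∧
      ((α, β) ≠ cornerPair ω ν →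
        ∃ B : Set BinSeq, IsTransitiveComponent (lexShift α β) B ∧ B ≠ essentialComponent ω ν) := by
  have hG := hSFT.glues
  have hU := unbalanced_of_mem_D₂ hLW hD₂
  obtain ⟨hα1, hβ0⟩ := ne_const_of_mem_D₁ hD₂.1
  obtain ⟨p, hp, hα⟩ := hG.exists_period hLW
  obtain ⟨q, hq, hβ⟩ := hG.mirror.exists_period hLW.mirror
  rw [shift_mirror, (Function.LeftInverse.injective mirror_mirror).eq_iff] at hβ
  have hα' : IsPeriodicSeq (prepend [false] α) := ⟨p, hp, period_zeroMax hLW hp hα hα1⟩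
  have hβ' : IsPeriodicSeq (prepend [true] β) := ⟨q, hq, period_oneMin hLW hq hβ hβ0⟩
  refine ⟨exists_isEssentialWordPair hLW hα' hβ', fun ω ν hE hB => ?_⟩
  have h := inBox_of_mem_renormBox hE hB hα' hβ'
  have hA := h.isTransitiveComponent hE hU hG
  have hlt : ∀ B : Set BinSeq, IsTransitiveComponent (lexShift α β) B →
      B ≠ essentialComponent ω ν → entropy B < entropy (renewal ω ν) :=
    fun B hB hne => h.entropy_lt hU hG hB hne hA.1
  refine ⟨hA, h.inter_preimage, h.entropy_eq hU, fun C hC => ⟨fun hCe => ?_, ?_⟩, hlt,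
    h.entropy_renewal_le hU, h.exists_other_component ⟨p, hp, hα⟩ ⟨q, hq, hβ⟩⟩
  · by_contra hne
    refine ((hlt C hC hne).trans_le (h.entropy_renewal_le hU)).ne ?_
    rw [hCe, h.entropy_eq hU]
  · rintro rfl
    exact h.entropy_eq hU
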